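/- Let $q\ge 0$, $m$, $p$ be integers, $n=q+m$, $r=\min\{p,m\}$, $v=\max\{p,m\}$. Let $(Z,U)$, with $Z$ a $q\times p$ and $U$ an $m\times p$ random matrix, have the elliptically symmetric density $$(z,u)\mapsto |\Sigma|^{-n/2} f\big(\mathrm{tr}\,(z-\theta)\Sigma^{-1}(z-\theta)^\top+\mathrm{tr}\,u\Sigma^{-1}u^\top\big)$$ with respect to Lebesgue measure, where the $q\times p$ matrix $\theta$ and the $p\times p$ positive definite matrix $\Sigma$ are unknown and $f\ge 0$ is a measurable function for which these functions are probability densities. Let $S=U^\top U$, let $S^+$ be its Moore–Penrose inverse, and let $E$ denote expectation under this density. Put $F^*(t)=\frac12\int_t^\infty f(\nu)\,d\nu$ and $$K^*=\int |\Sigma|^{-n/2}F^*\big(\mathrm{tr}\,(z-\theta)\Sigma^{-1}(z-\theta)^\top+\mathrm{tr}\,u\Sigma^{-1}u^\top\big)\,dz\,du ,$$ which does not depend on $(\theta,\Sigma)$. Assume that $K^*$, $E[\mathrm{tr}(\Sigma^{-1}S)]$ and $E[\mathrm{tr}(\Sigma S^+)]$ are finite for all $(\theta,\Sigma)$. Let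 $a_o=1/(K^*v)$ and $\hat\Sigma_{a_o}=a_oS$. Almost surely $S=HLH^\top$ with $H$ a $p\times r$ matrix satisfying $H^\top H=I_r$ and $L=\mathrm{diag}(l_1,\dots,l_r)$, $l_1>\dots>l_r>0$. For $\alpha\ge1$ and $b>0$ let $$\hat\Sigma_{\alpha,b}=a_o\big(S+HL\Psi(L)H^\top\big),\qquad \Psi(L)=b\,\frac{L^{-\alpha}}{\mathrm{tr}(L^{-\alpha})}.$$ Measure an estimator $\hat\Sigma$ by the risk $$R(\hat\Sigma;\theta,\Sigma)=E\big[\mathrm{tr}\big(S^+\Sigma(\Sigma^{-1}\hat\Sigma-I_p)^2\big)\big].$$ If $\alpha\ge 1$ and $$0<b\le\frac{2(r-1)}{v-r+1},$$ then $\hat\Sigma_{\alpha,b}$ dominates $\hat\Sigma_{a_o}$: $R(\hat\Sigma_{\alpha,b};\theta,\Sigma)\le R(\hat\Sigma_{a_o};\theta,\Sigma)$ for all $(\theta,\Sigma)$, with strict inequality for some $(\theta,\Sigma)$. -/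

import Mathlib

open MeasureTheory Matrix
open scoped ENNReal

noncomputable section

namespace EllipticalScale

/-! ### The sampling model -/

/-- A pair `(z, u)` of a `q × p` array and an `m × p` array, with Lebesgue measure on `ℝ^{(q+m)p}`. -/
abbrev Sample (q m p : ℕ) : Type := (Fin q → Fin p → ℝ) × (Fin m → Fin p → ℝ)

variable {q m p : ℕ}

/-- The quadratic form `tr (z - θ) Σ⁻¹ (z - θ)ᵀ + tr u Σ⁻¹ uᵀ`. -/
def quadForm (θ : Matrix (Fin q) (Fin p) ℝ) (Sig : Matrix (Fin p) (Fin p) ℝ)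
    (x : Sample q m p) : ℝ :=
  trace ((of x.1 - θ) * Sig⁻¹ * (of x.1 - θ)ᵀ) + trace (of x.2 * Sig⁻¹ * (of x.2)ᵀ)

/-- The factor `|Σ|^{-n/2}` with `n = q + m`. -/
def detFactor (q m : ℕ) {p : ℕ} (Sig : Matrix (Fin p) (Fin p) ℝ) : ℝ :=
  Sig.det ^ (-(((q + m : ℕ) : ℝ) / 2))

/-- The law of `(Z, U)`, with density `|Σ|^{-n/2} f (quadForm)` with respect to Lebesgue
measure. -/
def law (f : ℝ → ℝ) (θ : Matrix (Fin q) (Fin p) ℝ) (Sig : Matrix (Fin p) (Fin p) ℝ) :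
    Measure (Sample q m p) :=
  volume.withDensity fun x => ENNReal.ofReal (detFactor q m Sig * f (quadForm θ Sig x))

/-- `F*(t) = (1/2) ∫_t^∞ f(ν) dν`, as an element of `[0, ∞]`. -/
def Fstar (f : ℝ → ℝ) (t : ℝ) : ℝ≥0∞ :=
  2⁻¹ * ∫⁻ v in Set.Ioi t, ENNReal.ofReal (f v)

/-- The total mass of `|Σ|^{-n/2} F*(quadForm)`. -/
def starMass (f : ℝ → ℝ) (m : ℕ) (θ : Matrix (Fin q) (Fin p) ℝ)
    (Sig : Matrix (Fin p) (Fin p) ℝ) : ℝ≥0∞ :=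
  ∫⁻ x : Sample q m p, ENNReal.ofReal (detFactor q m Sig) * Fstar f (quadForm θ Sig x)

/-- The normalizing constant `K*`, computed at `θ = 0`, `Σ = I`; it is the same for all
`(θ, Σ)`, see `starMass_eq`. -/
def Kstar (f : ℝ → ℝ) (q m p : ℕ) : ℝ :=
  (starMass f m (0 : Matrix (Fin q) (Fin p) ℝ) 1).toReal

lemma quadForm_std (x : Sample q m p) :
    quadForm 0 1 x = (∑ i, x.1 i ⬝ᵥ x.1 i) + ∑ i, x.2 i ⬝ᵥ x.2 i := by
  simp [quadForm, trace, mul_apply, dotProduct]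

/-- Applying `B` to every row. -/
def rowMap (q m : ℕ) {p : ℕ} (B : Matrix (Fin p) (Fin p) ℝ) : Sample q m p →ₗ[ℝ] Sample q m p :=
  LinearMap.prodMap
    (LinearMap.pi fun i => B.toLin'.comp (LinearMap.proj i))
    (LinearMap.pi fun i => B.toLin'.comp (LinearMap.proj i))

lemma det_rowMap (B : Matrix (Fin p) (Fin p) ℝ) :
    LinearMap.det (rowMap q m B) = B.det ^ (q + m) := by
  rw [rowMap, LinearMap.det_prodMap, LinearMap.det_pi, LinearMap.det_pi]
  simp [pow_add]

/-- The point `(θ, 0)`. -/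
def shift (m : ℕ) (θ : Matrix (Fin q) (Fin p) ℝ) : Sample q m p := (fun i j => θ i j, 0)

lemma quadForm_rowMap (θ : Matrix (Fin q) (Fin p) ℝ) (B : Matrix (Fin p) (Fin p) ℝ)
    (hB : IsUnit B.det) (x : Sample q m p) :
    quadForm θ (B * Bᵀ) (shift m θ + rowMap q m B x) = quadForm 0 1 x := by
  have h (k : ℕ) (y : Fin k → Fin p → ℝ) :
      (of (fun i => B *ᵥ y i) : Matrix (Fin k) (Fin p) ℝ) = of y * Bᵀ := by
    ext i j; simp [mulVec, mul_apply, dotProduct, mul_comm]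
  have e1 : (of (shift m θ + rowMap q m B x).1 - θ : Matrix (Fin q) (Fin p) ℝ) = of x.1 * Bᵀ := by
    rw [← h]; ext i j; simp [rowMap, shift]
  have e2 : (of (shift m θ + rowMap q m B x).2 : Matrix (Fin m) (Fin p) ℝ) = of x.2 * Bᵀ := by
    rw [← h]; ext i j; simp [rowMap, shift]
  have hBt : IsUnit Bᵀ.det := by rwa [det_transpose]
  have key : Bᵀ * (B * Bᵀ)⁻¹ * B = 1 := by
    rw [Matrix.mul_inv_rev, ← Matrix.mul_assoc, mul_nonsing_inv _ hBt, Matrix.one_mul,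
      nonsing_inv_mul _ hB]
  have key2 (k : ℕ) (y : Matrix (Fin k) (Fin p) ℝ) :
      y * Bᵀ * (B * Bᵀ)⁻¹ * (y * Bᵀ)ᵀ = y * yᵀ := by
    rw [transpose_mul, transpose_transpose]
    calc _ = y * (Bᵀ * (B * Bᵀ)⁻¹ * B) * yᵀ := by simp only [Matrix.mul_assoc]
      _ = _ := by rw [key, Matrix.mul_one]
  rw [quadForm, e1, e2, key2, key2]
  simp [quadForm]

open scoped MatrixOrder Matrix.Norms.L2Operator in
lemma exists_factor {Sig : Matrix (Fin p) (Fin p) ℝ} (hSig : Sig.PosDef) :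
    ∃ B : Matrix (Fin p) (Fin p) ℝ, Sig = B * Bᵀ := by
  obtain ⟨B, hB⟩ := CStarAlgebra.nonneg_iff_eq_star_mul_self.mp hSig.posSemidef.nonneg
  refine ⟨Bᵀ, ?_⟩
  rw [hB, transpose_transpose, star_eq_conjTranspose, conjTranspose_eq_transpose_of_trivial]

lemma measurable_quadForm (θ : Matrix (Fin q) (Fin p) ℝ) (Sig : Matrix (Fin p) (Fin p) ℝ) :
    Measurable (quadForm θ Sig : Sample q m p → ℝ) := by
  suffices h : Continuous fun x : Sample q m p => quadForm θ Sig x from h.measurable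
  simp only [quadForm, trace, diag, mul_apply, transpose_apply, Matrix.sub_apply, of_apply]
  fun_prop

lemma isAddHaarMeasure_volume : (volume : Measure (Sample q m p)).IsAddHaarMeasure := by
  have h (k : ℕ) : (volume : Measure (Fin k → Fin p → ℝ)).IsAddHaarMeasure := by
    have (_ : Fin k) : (volume : Measure (Fin p → ℝ)).IsAddHaarMeasure := inferInstance
    exact Measure.pi.isAddHaarMeasure fun _ : Fin k => (volume : Measure (Fin p → ℝ))
  have := h q
  have := h m
  exact Measure.prod.instIsAddHaarMeasure volume volume

/-- The mass of `|Σ|^{-n/2} φ(quadForm)` does not depend on `(θ, Σ)`. -/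
theorem lintegral_quadForm (φ : ℝ → ℝ≥0∞) (hφ : Measurable φ) (θ : Matrix (Fin q) (Fin p) ℝ)
    {Sig : Matrix (Fin p) (Fin p) ℝ} (hSig : Sig.PosDef) :
    ∫⁻ x : Sample q m p, ENNReal.ofReal (detFactor q m Sig) * φ (quadForm θ Sig x)
      = ∫⁻ x : Sample q m p, φ (quadForm 0 1 x) := by
  have := isAddHaarMeasure_volume (q := q) (m := m) (p := p)
  obtain ⟨B, rfl⟩ := exists_factor hSig
  have hdet : 0 < B.det ^ 2 := by
    have := hSig.det_pos
    rwa [det_mul, det_transpose, ← sq] at this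
  have hB0 : B.det ≠ 0 := fun h => by simp [h] at hdet
  have hm := measurable_quadForm (q := q) (m := m) θ (B * Bᵀ)
  have hR : LinearMap.det (rowMap q m B) ≠ 0 := by
    rw [det_rowMap]; exact pow_ne_zero _ hB0
  have hRm : Measurable (rowMap q m B) :=
    (LinearMap.continuous_of_finiteDimensional _).measurable
  have hc : detFactor q m (B * Bᵀ) = |(LinearMap.det (rowMap q m B))⁻¹| := by
    rw [det_rowMap, detFactor, det_mul, det_transpose, abs_inv, abs_pow,
      ← abs_mul_abs_self, Real.rpow_neg (by positivity), ← sq, ← Real.rpow_natCast,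
      ← Real.rpow_mul (abs_nonneg _), ← Real.rpow_natCast]
    congr 2
    push_cast; ring
  rw [lintegral_const_mul _ (f := fun x => φ (quadForm θ (B * Bᵀ) x)) (hφ.comp hm), hc,
    ← lintegral_add_left_eq_self (μ := (volume : Measure (Sample q m p))) _ (shift m θ),
    ← smul_eq_mul, ← lintegral_smul_measure,
    ← Measure.map_linearMap_addHaar_eq_smul_addHaar _ hR, lintegral_map _ hRm]
  · simp_rw [quadForm_rowMap θ B (isUnit_iff_ne_zero.mpr hB0)]
  · exact hφ.comp (hm.comp (measurable_id.const_add _))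

theorem measurable_Fstar (f : ℝ → ℝ) : Measurable (Fstar f) := by
  have : Antitone (Fstar f) := fun s t h =>
    mul_le_mul_right (lintegral_mono_set (Set.Ioi_subset_Ioi h)) _
  exact this.measurable

/-- `K*` does not depend on `(θ, Σ)`. -/
theorem starMass_eq (f : ℝ → ℝ) (θ : Matrix (Fin q) (Fin p) ℝ)
    {Sig : Matrix (Fin p) (Fin p) ℝ} (hSig : Sig.PosDef) :
    starMass f m θ Sig = starMass f m (0 : Matrix (Fin q) (Fin p) ℝ) 1 := by
  rw [starMass, lintegral_quadForm _ (measurable_Fstar f) θ hSig, starMass]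
  simp [detFactor]

/-! ### The Moore–Penrose inverse -/

/-- The four Penrose equations for a real matrix. -/
structure IsMoorePenrose {k l : ℕ} (A : Matrix (Fin k) (Fin l) ℝ) (P : Matrix (Fin l) (Fin k) ℝ) :
    Prop where
  mul_mul : A * P * A = A
  mul_mul' : P * A * P = P
  symm_left : (A * P)ᵀ = A * P
  symm_right : (P * A)ᵀ = P * A

theorem IsMoorePenrose.unique {k l : ℕ} {A : Matrix (Fin k) (Fin l) ℝ}
    {P Q : Matrix (Fin l) (Fin k) ℝ} (hP : IsMoorePenrose A P) (hQ : IsMoorePenrose A Q) :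
    P = Q := by
  have h1 : A * P = A * Q := by
    have : A * P = A * Q * (A * P) := by rw [← Matrix.mul_assoc, hQ.mul_mul]
    rw [← hP.symm_left, this, transpose_mul, hP.symm_left, hQ.symm_left, ← Matrix.mul_assoc,
      hP.mul_mul]
  have h2 : P * A = Q * A := by
    have : P * A = P * A * (Q * A) := by
      rw [← Matrix.mul_assoc, Matrix.mul_assoc P, Matrix.mul_assoc P, hQ.mul_mul]
    rw [← hP.symm_right, this, transpose_mul, hP.symm_right, hQ.symm_right, Matrix.mul_assoc,
      ← Matrix.mul_assoc A, hP.mul_mul]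
  rw [← hP.mul_mul', h2, Matrix.mul_assoc, h1, ← Matrix.mul_assoc, hQ.mul_mul']

theorem IsMoorePenrose.exists_of_isSymm {k : ℕ} {A : Matrix (Fin k) (Fin k) ℝ}
    (hA : A.IsHermitian) : ∃ P, IsMoorePenrose A P := by
  set U : Matrix (Fin k) (Fin k) ℝ := (hA.eigenvectorUnitary).1 with hU
  set d := hA.eigenvalues
  have hUU : Uᵀ * U = 1 := by
    have := Unitary.coe_star_mul_self hA.eigenvectorUnitary
    rwa [star_eq_conjTranspose, conjTranspose_eq_transpose_of_trivial] at this
  have hs : A = U * diagonal d * Uᵀ := by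
    have := hA.spectral_theorem
    rw [Unitary.conjStarAlgAut_apply, star_eq_conjTranspose,
      conjTranspose_eq_transpose_of_trivial] at this
    exact this
  have hm (x y : Fin k → ℝ) : U * diagonal x * Uᵀ * (U * diagonal y * Uᵀ)
      = U * diagonal (fun i => x i * y i) * Uᵀ := by
    rw [← diagonal_mul_diagonal]
    calc _ = U * diagonal x * (Uᵀ * U) * diagonal y * Uᵀ := by simp only [Matrix.mul_assoc]
      _ = _ := by rw [hUU]; simp only [Matrix.mul_assoc, Matrix.one_mul]
  have ht (x : Fin k → ℝ) : (U * diagonal x * Uᵀ)ᵀ = U * diagonal x * Uᵀ := by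
    simp [transpose_mul, Matrix.mul_assoc]
  refine ⟨U * diagonal (fun i => (d i)⁻¹) * Uᵀ, ?_, ?_, ?_, ?_⟩
  · rw [hs, hm, hm]; congr 3; ext i; exact mul_inv_mul_cancel _
  · rw [hs, hm, hm]; congr 3; ext i; by_cases h : d i = 0 <;> simp [h]
  · rw [hs, hm, ht]
  · rw [hs, hm, ht]

open Classical in
/-- The Moore–Penrose inverse `A⁺`. -/
def pinv {k l : ℕ} (A : Matrix (Fin k) (Fin l) ℝ) : Matrix (Fin l) (Fin k) ℝ :=
  if h : ∃ P, IsMoorePenrose A P then h.choose else 0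

/-! ### Data-based loss and risk -/

/-- The residual matrix `S = Uᵀ U`. -/
def scatter (x : Sample q m p) : Matrix (Fin p) (Fin p) ℝ := (of x.2)ᵀ * of x.2

theorem scatter_isHermitian (x : Sample q m p) : (scatter x).IsHermitian := by
  simp [IsHermitian, scatter, transpose_mul]

theorem pinv_scatter (x : Sample q m p) : IsMoorePenrose (scatter x) (pinv (scatter x)) := by
  have h := IsMoorePenrose.exists_of_isSymm (scatter_isHermitian x)
  rw [pinv, dif_pos h]
  exact h.choose_spec

/-- The data-based loss `tr (S⁺ Σ (Σ⁻¹ Σ̂ - I)²)`. -/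
def loss (S Sig est : Matrix (Fin p) (Fin p) ℝ) : ℝ :=
  trace (pinv S * Sig * (Sig⁻¹ * est - 1) ^ 2)

/-- An estimator of `Σ`. -/
abbrev Estimator (q m p : ℕ) : Type := Sample q m p → Matrix (Fin p) (Fin p) ℝ

/-- The risk, valued in `[0, ∞]`. For a symmetric estimate `A` and `Σ` positive definite,
`Σ (Σ⁻¹ A - I)² = (A - Σ) Σ⁻¹ (A - Σ)`, so that the loss is nonnegative and `ENNReal.ofReal` does
not truncate it; all estimators below are symmetric. -/
def risk (f : ℝ → ℝ) (θ : Matrix (Fin q) (Fin p) ℝ) (Sig : Matrix (Fin p) (Fin p) ℝ)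
    (est : Estimator q m p) : ℝ≥0∞ :=
  ∫⁻ x, ENNReal.ofReal (loss (scatter x) Sig (est x)) ∂(law f θ Sig)

/-- `est₁` dominates `est₂`: its risk is nowhere larger, and somewhere smaller. -/
def Dominates (f : ℝ → ℝ) (est₁ est₂ : Estimator q m p) : Prop :=
  (∀ (θ : Matrix (Fin q) (Fin p) ℝ) (Sig : Matrix (Fin p) (Fin p) ℝ), Sig.PosDef →
    risk f θ Sig est₁ ≤ risk f θ Sig est₂) ∧
  ∃ (θ : Matrix (Fin q) (Fin p) ℝ) (Sig : Matrix (Fin p) (Fin p) ℝ), Sig.PosDef ∧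
    risk f θ Sig est₁ < risk f θ Sig est₂

/-- The class of generating functions: the functions in the model are probability densities, `K*`
is finite, and `E[tr Σ⁻¹ S]` and `E[tr Σ S⁺]` are finite (both traces are nonnegative). -/
structure IsGenerator (q m p : ℕ) (f : ℝ → ℝ) : Prop where
  measurable : Measurable f
  nonneg : ∀ t, 0 ≤ t → 0 ≤ f t
  isProbabilityMeasure : ∀ (θ : Matrix (Fin q) (Fin p) ℝ) (Sig : Matrix (Fin p) (Fin p) ℝ),
    Sig.PosDef → IsProbabilityMeasure (law f θ Sig : Measure (Sample q m p))
  starMass_lt_top : ∀ (θ : Matrix (Fin q) (Fin p) ℝ) (Sig : Matrix (Fin p) (Fin p) ℝ),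
    Sig.PosDef → starMass f m θ Sig < ∞
  moment : ∀ (θ : Matrix (Fin q) (Fin p) ℝ) (Sig : Matrix (Fin p) (Fin p) ℝ), Sig.PosDef →
    ∫⁻ x : Sample q m p, ENNReal.ofReal (trace (Sig⁻¹ * scatter x)) ∂(law f θ Sig) < ∞
  inv_moment : ∀ (θ : Matrix (Fin q) (Fin p) ℝ) (Sig : Matrix (Fin p) (Fin p) ℝ), Sig.PosDef →
    ∫⁻ x : Sample q m p, ENNReal.ofReal (trace (Sig * pinv (scatter x))) ∂(law f θ Sig) < ∞

/-! ### The estimators -/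

/-- `S = H L Hᵀ` with `H` a `p × r` semi-orthogonal matrix and `L = diag(l₁ > ⋯ > l_r > 0)`. -/
structure IsEigenDecomp {r : ℕ} (S : Matrix (Fin p) (Fin p) ℝ) (H : Matrix (Fin p) (Fin r) ℝ)
    (l : Fin r → ℝ) : Prop where
  semiorthogonal : Hᵀ * H = 1
  strictAnti : StrictAnti l
  pos : ∀ i, 0 < l i
  eq : S = H * diagonal l * Hᵀ

/-- The diagonal of `Ψ(L) = b L^{-α} / tr (L^{-α})`. -/
def haffPsi (α b : ℝ) {r : ℕ} (l : Fin r → ℝ) (i : Fin r) : ℝ :=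
  b * l i ^ (-α) / ∑ j, l j ^ (-α)

/-- `a_o = 1 / (K* v)`, `v = max(p, m)`. -/
def aOpt (f : ℝ → ℝ) (q m p : ℕ) : ℝ := 1 / (Kstar f q m p * (max p m : ℕ))

/-- `Σ̂_{a_o} = a_o S`. -/
def optEstimator (f : ℝ → ℝ) (q m p : ℕ) : Estimator q m p :=
  fun x => aOpt f q m p • scatter x

open Classical in
/-- `Σ̂_{α,b} = a_o (S + H L Ψ(L) Hᵀ)`, where `S = H L Hᵀ` is an eigenvalue decomposition of `S`
with `r = min(p, m)` distinct positive eigenvalues. The value does not depend on the decomposition,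
see `haffEstimator_eq`; outside the Lebesgue-null set where there is none, it is set to `a_o S`. -/
def haffEstimator (f : ℝ → ℝ) (q m p : ℕ) (α b : ℝ) : Estimator q m p := fun x =>
  if h : ∃ Hl : Matrix (Fin p) (Fin (min p m)) ℝ × (Fin (min p m) → ℝ),
      IsEigenDecomp (scatter x) Hl.1 Hl.2 then
    aOpt f q m p • (scatter x +
      h.choose.1 * diagonal h.choose.2 * diagonal (haffPsi α b h.choose.2) * h.choose.1ᵀ)
  else aOpt f q m p • scatter x

/-- A polynomial without constant term acts on an eigenvalue decomposition. -/
lemma IsEigenDecomp.aeval {r : ℕ} {S : Matrix (Fin p) (Fin p) ℝ} {H : Matrix (Fin p) (Fin r) ℝ}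
    {l : Fin r → ℝ} (h : IsEigenDecomp S H l) (P : Polynomial ℝ) :
    Polynomial.aeval S (Polynomial.X * P)
      = H * diagonal (fun i => l i * P.eval (l i)) * Hᵀ := by
  have hpow (n : ℕ) : S ^ (n + 1) = H * diagonal (fun i => l i ^ (n + 1)) * Hᵀ := by
    induction n with
    | zero => simpa using h.eq
    | succ n ih =>
      rw [pow_succ, ih, h.eq]
      calc _ = H * diagonal (fun i => l i ^ (n + 1)) * (Hᵀ * H) * diagonal l * Hᵀ := by
            simp only [Matrix.mul_assoc]
        _ = H * (diagonal (fun i => l i ^ (n + 1)) * diagonal l) * Hᵀ := by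
            rw [h.semiorthogonal]; simp only [Matrix.mul_assoc, Matrix.one_mul]
        _ = _ := by rw [diagonal_mul_diagonal]; simp only [pow_succ]
  induction P using Polynomial.induction_on' with
  | add P Q hP hQ =>
    rw [mul_add, map_add, hP, hQ, ← Matrix.add_mul, ← Matrix.mul_add, diagonal_add]
    simp only [Polynomial.eval_add, mul_add]
  | monomial n c =>
    rw [Polynomial.X_mul_monomial, Polynomial.aeval_monomial, hpow, ← Algebra.smul_def,
      ← Matrix.smul_mul, ← Matrix.mul_smul, ← diagonal_smul]
    congr 3
    ext i
    simp only [Pi.smul_apply, smul_eq_mul, Polynomial.eval_monomial]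
    ring

/-- `H φ(L) Hᵀ` depends only on `S` and `φ`. -/
lemma IsEigenDecomp.fun_eq {r r' : ℕ} {S : Matrix (Fin p) (Fin p) ℝ}
    {H : Matrix (Fin p) (Fin r) ℝ} {l : Fin r → ℝ} {H' : Matrix (Fin p) (Fin r') ℝ}
    {l' : Fin r' → ℝ} (h : IsEigenDecomp S H l) (h' : IsEigenDecomp S H' l') (φ : ℝ → ℝ) :
    H * diagonal (fun i => φ (l i)) * Hᵀ = H' * diagonal (fun i => φ (l' i)) * H'ᵀ := by
  classical
  let s : Finset ℝ := Finset.univ.image l ∪ Finset.univ.image l'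
  let P : Polynomial ℝ := Lagrange.interpolate s id (fun x => φ x / x)
  have hP (x : ℝ) (hx : x ∈ s) (hx0 : 0 < x) : x * P.eval x = φ x := by
    have : P.eval x = φ x / x :=
      Lagrange.eval_interpolate_at_node (fun x => φ x / x) (v := id) Function.injective_id.injOn hx
    rw [this, mul_div_cancel₀ _ hx0.ne']
  have e := (h.aeval P).symm.trans (h'.aeval P)
  have e1 : (fun i => l i * P.eval (l i)) = fun i => φ (l i) :=
    funext fun i => hP _ (by simp [s]) (h.pos i)
  have e2 : (fun i => l' i * P.eval (l' i)) = fun i => φ (l' i) :=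
    funext fun i => hP _ (by simp [s]) (h'.pos i)
  rwa [e1, e2] at e

lemma IsEigenDecomp.trace_fun {r : ℕ} {S : Matrix (Fin p) (Fin p) ℝ}
    {H : Matrix (Fin p) (Fin r) ℝ} {l : Fin r → ℝ} (h : IsEigenDecomp S H l) (d : Fin r → ℝ) :
    trace (H * diagonal d * Hᵀ) = ∑ i, d i := by
  rw [trace_mul_comm, ← Matrix.mul_assoc, h.semiorthogonal, Matrix.one_mul, trace_diagonal]

/-- The value of `Σ̂_{α,b}` does not depend on the chosen decomposition. -/
theorem haffEstimator_eq (f : ℝ → ℝ) (α b : ℝ) (x : Sample q m p)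
    {H : Matrix (Fin p) (Fin (min p m)) ℝ} {l : Fin (min p m) → ℝ}
    (h : IsEigenDecomp (scatter x) H l) :
    haffEstimator f q m p α b x
      = aOpt f q m p • (scatter x + H * diagonal l * diagonal (haffPsi α b l) * Hᵀ) := by
  have hex : ∃ Hl : Matrix (Fin p) (Fin (min p m)) ℝ × (Fin (min p m) → ℝ),
      IsEigenDecomp (scatter x) Hl.1 Hl.2 := ⟨(H, l), h⟩
  rw [haffEstimator, dif_pos hex]
  have h' := hex.choose_spec
  have ht : ∑ j, hex.choose.2 j ^ (-α) = ∑ j, l j ^ (-α) := by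
    rw [← h.trace_fun (fun j => l j ^ (-α)), ← h'.trace_fun (fun j => hex.choose.2 j ^ (-α)), h.fun_eq h' (fun t => t ^ (-α))]
  have e := h'.fun_eq h (fun t => t * (b * t ^ (-α) / ∑ j, l j ^ (-α)))
  congr 2
  rw [Matrix.mul_assoc _ (diagonal _) (diagonal _), diagonal_mul_diagonal,
    Matrix.mul_assoc _ (diagonal _) (diagonal _), diagonal_mul_diagonal]
  simpa only [haffPsi, ht] using e

end EllipticalScale

end

noncomputable section

namespace EllipticalScale

/-! ### Polynomial approximation of `l ↦ l ^ (-α)` -/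

section BinomialSeries

open Filter Topology Polynomial

/-! Write `a = a_o`, `Q` for the quadratic form, and `S = H L Hᵀ`. Since `tr Ψ = b`, expanding the
loss shows that the risk difference is `a² E[tr Σ⁻¹ H L (2Ψ + Ψ²) Hᵀ] - 2 a b`. As `a v K* = 1`, it
suffices that this expectation is `< 2 b v K*` (`lintegral_haffCore_lt`); the inequality is strict
at every parameter.

The engine is a Stein–Haff identity. Because `∇_U F*(Q) = -f(Q) U Σ⁻¹`, a vector field `G` satisfies
`∫ f(Q) tr(Σ⁻¹ Uᵀ G) = ∫ F*(Q) div G`, to be used with `G = U (2ψ + ψ²)(S)`. There are two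
obstacles: a general `f` gives little regularity, and `G` is singular where `S` drops rank.

The first is removed by homogeneity. If `h` is homogeneous of degree two, the image of `h dx` under
`Q` is a multiple of `vol{Q < t} dt`, and the mass of `F*(Q)` is `½ ∫ f(t) vol{Q < t} dt`. Hence the
ratio of `∫ f(Q) h` to `∫ F*(Q)` is the same for all generators (`lintegral_radial_mul_Fstar_comm`),
and one generator is enough: `f(s) = 4 (1 - s)₊`, with `F*(s) = (1 - s)₊²`, continuously
differentiable and supported in a compact ellipsoid.

The second is removed by replacing `l ^ (-α)` by its Taylor polynomials at a point `c` above all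
eigenvalues occurring in the ellipsoid. For a polynomial no eigenvector has to be differentiated,
and the divergence is an identity between power sums (`IsEigenDecomp.sum_dHaffField`). The binomial
coefficients are positive, so the approximants are positive and decreasing and satisfy `-l P' ≤ α P`
uniformly in the order. This bounds the divergences by a constant (`abs_haffDiv_le`) and permits
dominated convergence (`integral_haffCore_lt`).

The limiting divergence is below `2 b v` pointwise (`haffDiv_rpow_lt`): for `α ≥ 1` the eigenvalue
interactions gain `r - 1`, the bound on `b` spends this gain on the quadratic term, and `r ≥ 2`
gives strictness. -/

lemma multichoose_eq_div (α : ℝ) (k : ℕ) :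
    Ring.multichoose α k = (ascPochhammer ℝ k).eval α / k.factorial := by
  have h := Ring.factorial_nsmul_multichoose_eq_ascPochhammer α k
  rw [ascPochhammer_smeval_cast, ascPochhammer_smeval_eq_eval, nsmul_eq_mul] at h
  rw [← h, mul_div_cancel_left₀]
  exact_mod_cast k.factorial_ne_zero

/-- Coefficient form of `(1 - x) g' = α g` for `g = (1 - x) ^ (-α)`; it makes truncated sums
telescope in `neg_mul_derivative_powTaylor_le`. -/
lemma succ_mul_multichoose (α : ℝ) (k : ℕ) :
    (k + 1) * Ring.multichoose α (k + 1) = (α + k) * Ring.multichoose α k := by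
  have : (k.factorial : ℝ) ≠ 0 := by exact_mod_cast k.factorial_ne_zero
  have : (k : ℝ) + 1 ≠ 0 := by positivity
  rw [multichoose_eq_div, multichoose_eq_div, ascPochhammer_succ_eval, Nat.factorial_succ]
  push_cast
  field_simp

/-- Differentiating the series with exponent `α` gives `α` times the one with exponent `α + 1`, so
derivatives of Taylor polynomials are again binomial partial sums. -/
lemma succ_mul_multichoose' (α : ℝ) (k : ℕ) :
    (k + 1) * Ring.multichoose α (k + 1) = α * Ring.multichoose (α + 1) k := by
  have : (k.factorial : ℝ) ≠ 0 := by exact_mod_cast k.factorial_ne_zero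
  have : (k : ℝ) + 1 ≠ 0 := by positivity
  rw [multichoose_eq_div, multichoose_eq_div, ascPochhammer_succ_left, Nat.factorial_succ]
  simp only [eval_mul, eval_X, eval_comp, eval_add, eval_one]
  push_cast
  field_simp

lemma multichoose_pos {α : ℝ} (hα : 0 < α) (k : ℕ) : 0 < Ring.multichoose α k := by
  rw [multichoose_eq_div]
  exact div_pos (ascPochhammer_pos _ _ hα) (by exact_mod_cast k.factorial_pos)

/-- The binomial series of `(1 - x) ^ (-α)`. -/
lemma hasSum_multichoose (α : ℝ) {x : ℝ} (hx : |x| < 1) :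
    HasSum (fun k => Ring.multichoose α k * x ^ k) ((1 - x) ^ (-α)) := by
  have h := (Real.one_div_one_sub_rpow_hasFPowerSeriesOnBall_zero α).hasSum (y := x)
    (by simpa [enorm_eq_nnnorm, ← NNReal.coe_lt_coe] using hx)
  have e : (1 - (0 + x)) ^ α = (1 - x) ^ α := by rw [zero_add]
  rw [e, one_div, ← Real.rpow_neg (by linarith [(abs_lt.mp hx).2])] at h
  have e' : (fun k => Ring.multichoose α k * x ^ k) = fun k =>
      FormalMultilinearSeries.ofScalars ℝ (fun k => Ring.choose (α + k - 1) k) k fun _ => x := by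
    ext k
    rw [FormalMultilinearSeries.ofScalars_apply_eq, smul_eq_mul, Ring.choose,
      show α + k - 1 - k + 1 = α by ring]
  rwa [e']

/-- The Taylor polynomial of `l ^ (-α)` of order `n` at `l = c`. -/
def powTaylor (α c : ℝ) (n : ℕ) : ℝ[X] :=
  ∑ k ∈ Finset.range (n + 1), C (c ^ (-α) * Ring.multichoose α k) * (1 - C c⁻¹ * X) ^ k

lemma eval_powTaylor (α c : ℝ) (n : ℕ) (l : ℝ) :
    (powTaylor α c n).eval l
      = c ^ (-α) * ∑ k ∈ Finset.range (n + 1), Ring.multichoose α k * (1 - c⁻¹ * l) ^ k := by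
  simp [powTaylor, eval_finsetSum, Finset.mul_sum, mul_assoc]

lemma eval_derivative_powTaylor (α c : ℝ) (n : ℕ) (l : ℝ) :
    (powTaylor α c n).derivative.eval l
      = -(c ^ (-α) * c⁻¹ * ∑ k ∈ Finset.range n,
          (k + 1) * Ring.multichoose α (k + 1) * (1 - c⁻¹ * l) ^ k) := by
  rw [powTaylor, derivative_sum, eval_finsetSum, Finset.sum_range_succ']
  simp only [derivative_C_mul, derivative_pow, eval_mul, eval_C]
  simp only [derivative_sub, derivative_one, derivative_C_mul, derivative_X, eval_pow, eval_sub,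
    eval_one, eval_mul, eval_C, eval_X, eval_zero, Finset.mul_sum, Nat.cast_zero, zero_mul,
    mul_zero, add_zero, ← Finset.sum_neg_distrib]
  refine Finset.sum_congr rfl fun k _ => ?_
  push_cast [Nat.add_sub_cancel]
  ring

/-- For `l ≤ c` every term of the polynomial is nonnegative, and the constant term is `c ^ (-α)`.
The bound depends neither on `n` nor on `l`, so it survives limits towards rank-deficient points. -/
lemma rpow_le_eval_powTaylor {α c : ℝ} (hα : 0 < α) (hc : 0 < c) (n : ℕ) {l : ℝ}
    (hl : l ≤ c) : c ^ (-α) ≤ (powTaylor α c n).eval l := by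
  have hx : 0 ≤ 1 - c⁻¹ * l := by
    rw [inv_mul_eq_div, sub_nonneg, div_le_one hc]; exact hl
  rw [eval_powTaylor]
  refine le_mul_of_one_le_right (Real.rpow_nonneg hc.le _) ?_
  rw [Finset.sum_range_succ']
  have : 0 ≤ ∑ k ∈ Finset.range n, Ring.multichoose α (k + 1) * (1 - c⁻¹ * l) ^ (k + 1) :=
    Finset.sum_nonneg fun k _ => mul_nonneg (multichoose_pos hα _).le (pow_nonneg hx _)
  simp [this]

lemma eval_powTaylor_pos {α c : ℝ} (hα : 0 < α) (hc : 0 < c) (n : ℕ) {l : ℝ}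
    (hl : l ≤ c) : 0 < (powTaylor α c n).eval l :=
  (Real.rpow_pos_of_pos hc _).trans_le (rpow_le_eval_powTaylor hα hc n hl)

lemma derivative_powTaylor_nonpos {α c : ℝ} (hα : 0 < α) (hc : 0 < c) (n : ℕ) {l : ℝ}
    (hl : l ≤ c) : (powTaylor α c n).derivative.eval l ≤ 0 := by
  have hx : 0 ≤ 1 - c⁻¹ * l := by
    rw [inv_mul_eq_div, sub_nonneg, div_le_one hc]; exact hl
  rw [eval_derivative_powTaylor, neg_nonpos]
  refine mul_nonneg (by positivity) (Finset.sum_nonneg fun k _ => ?_)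
  have := multichoose_pos hα (k + 1)
  positivity

/-- The exact function has equality here. Truncating `(1 - x) g' = α g` leaves a remainder of
favourable sign, so the constant `α` serves for all `n`. -/
lemma neg_mul_derivative_powTaylor_le {α c : ℝ} (hα : 0 < α) (hc : 0 < c) (n : ℕ) {l : ℝ}
    (hl : l ≤ c) :
    -(l * (powTaylor α c n).derivative.eval l) ≤ α * (powTaylor α c n).eval l := by
  have hx : 0 ≤ 1 - c⁻¹ * l := by
    rw [inv_mul_eq_div, sub_nonneg, div_le_one hc]; exact hl
  rw [eval_derivative_powTaylor, eval_powTaylor]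
  set x := 1 - c⁻¹ * l with hxd
  have hl' : l * c⁻¹ = 1 - x := by rw [hxd]; ring
  have key : (1 - x) * ∑ k ∈ Finset.range n, (k + 1) * Ring.multichoose α (k + 1) * x ^ k
      ≤ α * ∑ k ∈ Finset.range (n + 1), Ring.multichoose α k * x ^ k := by
    have e : ∀ j : ℕ, (1 - x) * ∑ k ∈ Finset.range j, (k + 1) * Ring.multichoose α (k + 1) * x ^ k
        = α * (∑ k ∈ Finset.range j, Ring.multichoose α k * x ^ k)
          - j * Ring.multichoose α j * x ^ j := by
      intro j
      induction j with
      | zero => simp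
      | succ j ih =>
        rw [Finset.sum_range_succ, mul_add, ih, Finset.sum_range_succ]
        have := succ_mul_multichoose α j
        push_cast
        linear_combination (x ^ j) * this
    rw [e n, Finset.sum_range_succ]
    have := multichoose_pos hα n
    have h1 : 0 ≤ (n : ℝ) * Ring.multichoose α n * x ^ n := by positivity
    have h2 : 0 ≤ α * (Ring.multichoose α n * x ^ n) := by positivity
    linarith
  have hcc := mul_le_mul_of_nonneg_left key (Real.rpow_nonneg hc.le (-α))
  calc _ = c ^ (-α) * ((l * c⁻¹) *
        ∑ k ∈ Finset.range n, (k + 1) * Ring.multichoose α (k + 1) * x ^ k) := by ring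
    _ ≤ _ := by rw [hl']; linarith

lemma tendsto_eval_powTaylor {α c : ℝ} (hc : 0 < c) {l : ℝ}
    (hl0 : 0 < l) (hl : l ≤ c) :
    Tendsto (fun n => (powTaylor α c n).eval l) atTop (𝓝 (l ^ (-α))) := by
  have hx : 0 ≤ 1 - c⁻¹ * l := by
    rw [inv_mul_eq_div, sub_nonneg, div_le_one hc]; exact hl
  have hx1 : |1 - c⁻¹ * l| < 1 := by
    rw [abs_of_nonneg hx]; have : 0 < c⁻¹ * l := by positivity
    linarith
  have h := ((hasSum_multichoose α hx1).tendsto_sum_nat.comp (tendsto_add_atTop_nat 1)).const_mul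
    (c ^ (-α))
  have e : c ^ (-α) * (1 - (1 - c⁻¹ * l)) ^ (-α) = l ^ (-α) := by
    rw [sub_sub_cancel, ← Real.mul_rpow hc.le (by positivity), mul_inv_cancel_left₀ hc.ne']
  rw [e] at h
  exact h.congr fun n => (eval_powTaylor α c n l).symm

lemma tendsto_derivative_powTaylor {α c : ℝ} (hc : 0 < c) {l : ℝ}
    (hl0 : 0 < l) (hl : l ≤ c) :
    Tendsto (fun n => (powTaylor α c n).derivative.eval l) atTop (𝓝 (-α * l ^ (-α - 1))) := by
  have hx : 0 ≤ 1 - c⁻¹ * l := by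
    rw [inv_mul_eq_div, sub_nonneg, div_le_one hc]; exact hl
  have hx1 : |1 - c⁻¹ * l| < 1 := by
    rw [abs_of_nonneg hx]; have : 0 < c⁻¹ * l := by positivity
    linarith
  have h := ((hasSum_multichoose (α + 1) hx1).tendsto_sum_nat).const_mul
    (-(c ^ (-α) * c⁻¹ * α))
  have e : -(c ^ (-α) * c⁻¹ * α) * (1 - (1 - c⁻¹ * l)) ^ (-(α + 1)) = -α * l ^ (-α - 1) := by
    have : c ^ (-α) * c⁻¹ = c ^ (-(α + 1)) := by
      rw [neg_add, Real.rpow_add hc, Real.rpow_neg_one]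
    have h2 : c ^ (-(α + 1)) * (c⁻¹ * l) ^ (-(α + 1)) = l ^ (-α - 1) := by
      rw [← Real.mul_rpow hc.le (by positivity), mul_inv_cancel_left₀ hc.ne', neg_add']
    rw [sub_sub_cancel, this, ← h2]
    ring
  rw [e] at h
  refine h.congr fun n => ?_
  rw [eval_derivative_powTaylor, Finset.mul_sum, Finset.mul_sum, ← Finset.sum_neg_distrib]
  refine Finset.sum_congr rfl fun k _ => ?_
  rw [succ_mul_multichoose']
  ring

end BinomialSeries

/-! ### The divergence of a spectral function, in terms of eigenvalues -/

section SpectralDivergence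

open Filter Topology

variable {r : ℕ}

/-- The divergence of `u ↦ u φ(uᵀ u)`, where `l` are the nonzero eigenvalues of `uᵀ u`, and `φ`
and `φ'` are the values of the function and of its derivative there. -/
def specDiv (v : ℝ) (l φ φ' : Fin r → ℝ) : ℝ :=
  v * ∑ i, φ i + 2 * ∑ i, l i * φ' i + ∑ i, ∑ j, l i * (φ i - φ j) / (l i - l j)

/-- The divergence of `u ↦ u (2ψ + ψ²)(uᵀ u)`, where `ψ = b φ / ∑ φ`. -/
def haffDiv (v b : ℝ) (l φ φ' : Fin r → ℝ) : ℝ :=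
  2 * b * (specDiv v l φ φ' / (∑ i, φ i) - 2 * (∑ i, l i * φ' i * φ i) / (∑ i, φ i) ^ 2)
  + b ^ 2 * (specDiv v l (fun i => φ i ^ 2) (fun i => 2 * φ i * φ' i) / (∑ i, φ i) ^ 2
    - 4 * (∑ i, l i * φ' i * φ i ^ 2) / (∑ i, φ i) ^ 3)

lemma tendsto_specDiv (v : ℝ) (l : Fin r → ℝ) {φ φ' : ℕ → Fin r → ℝ} {g g' : Fin r → ℝ}
    (h : ∀ i, Tendsto (fun n => φ n i) atTop (𝓝 (g i)))
    (h' : ∀ i, Tendsto (fun n => φ' n i) atTop (𝓝 (g' i))) :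
    Tendsto (fun n => specDiv v l (φ n) (φ' n)) atTop (𝓝 (specDiv v l g g')) := by
  refine (((tendsto_finsetSum _ fun i _ => h i).const_mul v).add
    ((tendsto_finsetSum _ fun i _ => (h' i).const_mul (l i)).const_mul 2)).add
    (tendsto_finsetSum _ fun i _ => tendsto_finsetSum _ fun j _ => ?_)
  exact (((h i).sub (h j)).const_mul (l i)).div_const _

lemma tendsto_haffDiv (v b : ℝ) (l : Fin r → ℝ) {φ φ' : ℕ → Fin r → ℝ} {g g' : Fin r → ℝ}
    (h : ∀ i, Tendsto (fun n => φ n i) atTop (𝓝 (g i)))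
    (h' : ∀ i, Tendsto (fun n => φ' n i) atTop (𝓝 (g' i))) (h0 : ∑ i, g i ≠ 0) :
    Tendsto (fun n => haffDiv v b l (φ n) (φ' n)) atTop (𝓝 (haffDiv v b l g g')) := by
  have hT := tendsto_finsetSum Finset.univ fun i _ => h i
  have h1 := tendsto_specDiv v l h h'
  have h2 := tendsto_specDiv v l (fun i => (h i).pow 2) (fun i => ((h i).const_mul 2).mul (h' i))
  have h3 := tendsto_finsetSum Finset.univ fun i _ => ((h' i).const_mul (l i)).mul (h i)
  have h4 := tendsto_finsetSum Finset.univ fun i _ => ((h' i).const_mul (l i)).mul ((h i).pow 2)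
  exact (((h1.div hT h0).sub ((h3.const_mul 2).div (hT.pow 2) (pow_ne_zero 2 h0))).const_mul
    (2 * b)).add (((h2.div (hT.pow 2) (pow_ne_zero 2 h0)).sub
    ((h4.const_mul 4).div (hT.pow 3) (pow_ne_zero 3 h0))).const_mul (b ^ 2))

/-- The bound does not see the gap `x - y`, which is what allows domination although eigenvalues may
come arbitrarily close. -/
lemma abs_divDiff_le {x y fx fy C : ℝ} (hx : 0 < x) (hy : 0 < y) (hfx : 0 ≤ fx) (hfy : 0 ≤ fy)
    (hC : 0 ≤ C)
    (h : x < y → fy ≤ fx ∧ x * (fx - fy) ≤ C * fx * (y - x))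
    (h' : y < x → fx ≤ fy ∧ y * (fy - fx) ≤ C * fy * (x - y)) :
    |x * (fx - fy) / (x - y)| ≤ (C + 1) * (fx + fy) := by
  rcases lt_trichotomy x y with hxy | rfl | hxy
  · obtain ⟨h1, h2⟩ := h hxy
    rw [abs_div, abs_of_neg (sub_neg.2 hxy), abs_of_nonneg (mul_nonneg hx.le (sub_nonneg.2 h1)),
      neg_sub, div_le_iff₀ (sub_pos.2 hxy)]
    refine h2.trans (mul_le_mul_of_nonneg_right ?_ (sub_pos.2 hxy).le)
    nlinarith [mul_nonneg hC hfy]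
  · simp; positivity
  · obtain ⟨h1, h2⟩ := h' hxy
    have hd := sub_pos.2 hxy
    rw [abs_div, abs_of_pos hd, abs_mul, abs_of_pos hx, abs_of_nonpos (sub_nonpos.2 h1),
      neg_sub, div_le_iff₀ hd]
    -- The slope hypothesis controls only the smaller point `y`; writing `x = y + (x - y)` costs the
    -- additional `fy`, hence `C + 1`.
    have h3 : (x - y) * (fy - fx) ≤ (x - y) * fy :=
      mul_le_mul_of_nonneg_left (by linarith) hd.le
    have h4 : 0 ≤ (C + 1) * fx * (x - y) := by positivity
    nlinarith

lemma abs_specDiv_le {v C : ℝ} (hv : 0 ≤ v) (hC : 0 ≤ C) {l φ φ' : Fin r → ℝ}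
    (hl : ∀ i, 0 < l i) (hφ : ∀ i, 0 ≤ φ i)
    (hφ' : ∀ i, |l i * φ' i| ≤ C * φ i)
    (h : ∀ i j, l i < l j → φ j ≤ φ i ∧ l i * (φ i - φ j) ≤ C * φ i * (l j - l i)) :
    |specDiv v l φ φ'| ≤ (v + 2 * C + 2 * (C + 1) * r) * ∑ i, φ i := by
  have h1 : |∑ i, l i * φ' i| ≤ C * ∑ i, φ i := by
    rw [Finset.mul_sum]
    exact (Finset.abs_sum_le_sum_abs _ _).trans (Finset.sum_le_sum fun i _ => hφ' i)
  have h2 : |∑ i, ∑ j, l i * (φ i - φ j) / (l i - l j)| ≤ 2 * (C + 1) * r * ∑ i, φ i := by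
    calc _ ≤ ∑ i, ∑ j, (C + 1) * (φ i + φ j) :=
          (Finset.abs_sum_le_sum_abs _ _).trans (Finset.sum_le_sum fun i _ =>
            (Finset.abs_sum_le_sum_abs _ _).trans (Finset.sum_le_sum fun j _ =>
              abs_divDiff_le (hl i) (hl j) (hφ i) (hφ j) hC (h i j) (h j i)))
      _ = _ := by
          simp only [mul_add, Finset.sum_add_distrib, Finset.sum_const, Finset.card_univ,
            Fintype.card_fin, nsmul_eq_mul, ← Finset.mul_sum]
          ring
  have h0 : 0 ≤ ∑ i, φ i := Finset.sum_nonneg fun i _ => hφ i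
  have h3 : |v * ∑ i, φ i| = v * ∑ i, φ i := abs_of_nonneg (mul_nonneg hv h0)
  unfold specDiv
  refine (abs_add_le _ _).trans ((add_le_add (abs_add_le _ _) le_rfl).trans ?_)
  rw [h3, abs_mul, abs_two]
  linarith

/-- A bound for `haffDiv` that depends on `φ` only through the constant `C`. -/
def haffBound (r : ℕ) (v b C : ℝ) : ℝ :=
  2 * b * (v + 2 * C + 2 * (C + 1) * r + 2 * C)
    + b ^ 2 * (v + 2 * (2 * C) + 2 * (2 * C + 1) * r + 4 * C)

lemma abs_haffDiv_le {v b C : ℝ} (hv : 0 ≤ v) (hb : 0 ≤ b) (hC : 0 ≤ C) {l φ φ' : Fin r → ℝ}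
    (hl : ∀ i, 0 < l i) (hφ : ∀ i, 0 < φ i)
    (hφ' : ∀ i, |l i * φ' i| ≤ C * φ i)
    (h : ∀ i j, l i < l j → φ j ≤ φ i ∧ l i * (φ i - φ j) ≤ C * φ i * (l j - l i))
    (hT : 0 < ∑ i, φ i) :
    |haffDiv v b l φ φ'| ≤ haffBound r v b C := by
  set T := ∑ i, φ i with hTd
  have hle (i) : φ i ≤ T := Finset.single_le_sum (fun j _ => (hφ j).le) (Finset.mem_univ i)
  have hsq : ∑ i, φ i ^ 2 ≤ T ^ 2 := by
    rw [sq T, hTd, Finset.sum_mul]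
    exact Finset.sum_le_sum fun i _ => by nlinarith [hle i, hφ i]
  have A := abs_specDiv_le hv hC hl (fun i => (hφ i).le) hφ' h
  -- Squaring `φ` doubles its logarithmic derivative, so `φ²` meets the same hypotheses with `2 *
  -- C`.
  have B := abs_specDiv_le (v := v) (C := 2 * C) (φ := fun i => φ i ^ 2)
    (φ' := fun i => 2 * φ i * φ' i) hv (by positivity) hl (fun i => by positivity)
    (fun i => by
      have : |l i * (2 * φ i * φ' i)| = 2 * φ i * |l i * φ' i| := by
        rw [show l i * (2 * φ i * φ' i) = 2 * φ i * (l i * φ' i) by ring, abs_mul,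
          abs_of_pos (by have := hφ i; positivity)]
      rw [this]
      nlinarith [hφ' i, hφ i])
    (fun i j hij => by
      obtain ⟨h1, h2⟩ := h i j hij
      refine ⟨pow_le_pow_left₀ (hφ j).le h1 2, ?_⟩
      have h3 : l i * (φ i ^ 2 - φ j ^ 2) = l i * (φ i - φ j) * (φ i + φ j) := by ring
      have h4 : φ i + φ j ≤ 2 * φ i := by linarith
      have h5 : 0 ≤ l i * (φ i - φ j) := mul_nonneg (hl i).le (sub_nonneg.2 h1)
      rw [h3]
      calc _ ≤ l i * (φ i - φ j) * (2 * φ i) := mul_le_mul_of_nonneg_left h4 h5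
        _ ≤ C * φ i * (l j - l i) * (2 * φ i) :=
          mul_le_mul_of_nonneg_right h2 (by have := hφ i; positivity)
        _ = _ := by ring)
  have D1 : |∑ i, l i * φ' i * φ i| ≤ C * T ^ 2 := by
    refine (Finset.abs_sum_le_sum_abs _ _).trans ?_
    calc _ ≤ ∑ i, C * φ i ^ 2 := Finset.sum_le_sum fun i _ => by
            rw [abs_mul, abs_of_pos (hφ i)]; nlinarith [hφ' i, hφ i]
      _ ≤ _ := by rw [← Finset.mul_sum]; exact mul_le_mul_of_nonneg_left hsq hC
  have D2 : |∑ i, l i * φ' i * φ i ^ 2| ≤ C * T ^ 3 := by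
    refine (Finset.abs_sum_le_sum_abs _ _).trans ?_
    calc _ ≤ ∑ i, C * T * φ i ^ 2 := Finset.sum_le_sum fun i _ => by
            rw [abs_mul, abs_of_nonneg (sq_nonneg (φ i))]
            exact mul_le_mul_of_nonneg_right
              ((hφ' i).trans (mul_le_mul_of_nonneg_left (hle i) hC)) (sq_nonneg _)
      _ ≤ C * T * T ^ 2 := by
            rw [← Finset.mul_sum]; exact mul_le_mul_of_nonneg_left hsq (by positivity)
      _ = _ := by ring
  have E1 : |specDiv v l φ φ' / T| ≤ v + 2 * C + 2 * (C + 1) * r := by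
    rw [abs_div, abs_of_pos hT, div_le_iff₀ hT]; exact A
  have E2 : |2 * (∑ i, l i * φ' i * φ i) / T ^ 2| ≤ 2 * C := by
    rw [abs_div, abs_mul, abs_two, abs_of_pos (by positivity : 0 < T ^ 2),
      div_le_iff₀ (by positivity)]
    linarith
  have E3 : |specDiv v l (fun i => φ i ^ 2) (fun i => 2 * φ i * φ' i) / T ^ 2|
      ≤ v + 2 * (2 * C) + 2 * (2 * C + 1) * r := by
    rw [abs_div, abs_of_pos (by positivity : 0 < T ^ 2), div_le_iff₀ (by positivity)]
    exact B.trans (mul_le_mul_of_nonneg_left hsq (by positivity))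
  have E4 : |4 * (∑ i, l i * φ' i * φ i ^ 2) / T ^ 3| ≤ 4 * C := by
    rw [abs_div, abs_mul, abs_of_pos (by norm_num : (0 : ℝ) < 4),
      abs_of_pos (by positivity : 0 < T ^ 3), div_le_iff₀ (by positivity)]
    linarith
  unfold haffDiv haffBound
  rw [← hTd]
  refine (abs_add_le _ _).trans (add_le_add ?_ ?_)
  · rw [abs_mul, abs_of_nonneg (by positivity : 0 ≤ 2 * b)]
    exact mul_le_mul_of_nonneg_left ((abs_sub _ _).trans (add_le_add E1 E2)) (by positivity)
  · rw [abs_mul, abs_of_nonneg (by positivity : 0 ≤ b ^ 2)]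
    exact mul_le_mul_of_nonneg_left ((abs_sub _ _).trans (add_le_add E3 E4)) (by positivity)

/-- If `l φ(l)` is antitone, the interaction terms are at most `-(r - 1) ∑ φ`. -/
lemma sum_divDiff_le {l φ : Fin r → ℝ} (hl : Function.Injective l)
    (h : ∀ i j, l i < l j → l j * φ j ≤ l i * φ i) :
    ∑ i, ∑ j, l i * (φ i - φ j) / (l i - l j) ≤ -((r - 1) * ∑ i, φ i) := by
  -- Symmetrization: the two ordered terms of a pair add up to `2 (l_i φ_i - l_j φ_j) / (l_i - l_j)
  -- - (φ_i + φ_j)`, and the quotient is nonpositive when `l φ(l)` is antitone.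
  have hp (i j : Fin r) : l i * (φ i - φ j) / (l i - l j) + l j * (φ j - φ i) / (l j - l i)
      ≤ if i = j then 0 else -(φ i + φ j) := by
    split_ifs with hij
    · simp [hij]
    · rcases lt_or_gt_of_ne (hl.ne hij) with hlt | hlt
      · have hd := sub_pos.2 hlt
        have e : l i * (φ i - φ j) / (l i - l j) + l j * (φ j - φ i) / (l j - l i)
            = 2 * (l j * φ j - l i * φ i) / (l j - l i) - (φ i + φ j) := by
          rw [← neg_sub (l j) (l i)]; field_simp; ring
        have : 2 * (l j * φ j - l i * φ i) / (l j - l i) ≤ 0 :=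
          div_nonpos_of_nonpos_of_nonneg (by linarith [h i j hlt]) hd.le
        linarith
      · have hd := sub_pos.2 hlt
        have e : l i * (φ i - φ j) / (l i - l j) + l j * (φ j - φ i) / (l j - l i)
            = 2 * (l i * φ i - l j * φ j) / (l i - l j) - (φ i + φ j) := by
          rw [← neg_sub (l i) (l j)]; field_simp; ring
        have : 2 * (l i * φ i - l j * φ j) / (l i - l j) ≤ 0 :=
          div_nonpos_of_nonpos_of_nonneg (by linarith [h j i hlt]) hd.le
        linarith
  have e2 : ∑ i, ∑ j, l i * (φ i - φ j) / (l i - l j)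
      = ∑ i, ∑ j, l j * (φ j - φ i) / (l j - l i) := Finset.sum_comm
  have e3 : ∑ i, ∑ j, (l i * (φ i - φ j) / (l i - l j) + l j * (φ j - φ i) / (l j - l i))
      ≤ ∑ i : Fin r, ∑ j : Fin r, if i = j then 0 else -(φ i + φ j) :=
    Finset.sum_le_sum fun i _ => Finset.sum_le_sum fun j _ => hp i j
  have e4 : ∑ i : Fin r, ∑ j : Fin r, (if i = j then 0 else -(φ i + φ j))
      = -(2 * ((r - 1) * ∑ i, φ i)) := by
    have (i j : Fin r) : (if i = j then 0 else -(φ i + φ j))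
        = (if i = j then 2 * φ i else 0) - (φ i + φ j) := by
      split_ifs with hij
      · rw [hij]; ring
      · ring
    simp only [this, Finset.sum_sub_distrib, Finset.sum_add_distrib, Finset.sum_ite_eq,
      Finset.mem_univ, if_true, Finset.sum_const, Finset.card_univ, Fintype.card_fin,
      nsmul_eq_mul, ← Finset.mul_sum]
    ring
  simp only [Finset.sum_add_distrib] at e3
  rw [e4, ← e2] at e3
  linarith

/-- For `r ≥ 2` the cross terms are present and positive. This is the source of strictness in the
theorem. -/
lemma sum_pow_two_lt_sq_sum (hr : 2 ≤ r) {φ : Fin r → ℝ} (hφ : ∀ i, 0 < φ i) :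
    ∑ i, φ i ^ 2 < (∑ i, φ i) ^ 2 := by
  rw [sq (∑ i, φ i), Finset.sum_mul]
  have hne : (Finset.univ : Finset (Fin r)).Nonempty := ⟨⟨0, by omega⟩, Finset.mem_univ _⟩
  refine Finset.sum_lt_sum_of_nonempty hne fun i _ => ?_
  rw [sq]
  refine mul_lt_mul_of_pos_left ?_ (hφ i)
  have : Nontrivial (Fin r) := Fin.nontrivial_iff_two_le.2 hr
  obtain ⟨j, hj⟩ := exists_ne i
  exact Finset.single_lt_sum hj (Finset.mem_univ _) (Finset.mem_univ _) (hφ j)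
    fun k _ _ => (hφ k).le

/-- With `w = v - r + 1` and `ρ = ∑ φ² / (∑ φ)² < 1`, the linear part is at most `2 b (w - 2 α (1 -
ρ))`. In the quadratic part the terms in `α` cancel, leaving at most `b² w ρ ≤ 2 b (r - 1)` by the
bound on `b`. Since `v = w + r - 1`, a slack of `4 b α (1 - ρ)` remains. -/
theorem haffDiv_rpow_lt {v b α : ℝ} (hr : 2 ≤ r) (hα : 1 ≤ α) (hb : 0 < b) (hv : r ≤ v)
    (hb' : b ≤ 2 * (r - 1) / (v - r + 1)) {l : Fin r → ℝ} (hl : ∀ i, 0 < l i)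
    (hinj : Function.Injective l) :
    haffDiv v b l (fun i => l i ^ (-α)) (fun i => -α * l i ^ (-α - 1)) < 2 * b * v := by
  set φ : Fin r → ℝ := fun i => l i ^ (-α) with hφd
  have hφ (i) : 0 < φ i := Real.rpow_pos_of_pos (hl i) _
  have hlφ' (i) : l i * (-α * l i ^ (-α - 1)) = -α * φ i := by
    rw [Real.rpow_sub_one (hl i).ne']; field_simp [(hl i).ne']; rfl
  set T := ∑ i, φ i with hTd
  have hne : (Finset.univ : Finset (Fin r)).Nonempty := ⟨⟨0, by omega⟩, Finset.mem_univ _⟩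
  have hT : 0 < T := Finset.sum_pos (fun i _ => hφ i) hne
  set q := ∑ i, φ i ^ 2 with hqd
  have hq0 : 0 < q := Finset.sum_pos (fun i _ => pow_pos (hφ i) 2) hne
  have hq : q < T ^ 2 := sum_pow_two_lt_sq_sum hr hφ
  have hcub : ∑ i, φ i ^ 3 ≤ q * T := by
    rw [hqd, Finset.sum_mul]
    exact Finset.sum_le_sum fun i _ => by
      rw [pow_succ]
      exact mul_le_mul_of_nonneg_left
        (Finset.single_le_sum (fun j _ => (hφ j).le) (Finset.mem_univ i)) (by positivity)
  -- The threshold `α = 1` comes from here: `l φ(l) = l ^ (1 - α)`.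
  have anti1 (i j) (hij : l i < l j) : l j * φ j ≤ l i * φ i := by
    have e (k) : l k * φ k = l k ^ (1 - α) := by
      rw [sub_eq_add_neg, Real.rpow_add (hl k), Real.rpow_one]
    rw [e, e]
    exact Real.rpow_le_rpow_of_nonpos (hl i) hij.le (by linarith)
  have anti2 (i j) (hij : l i < l j) : l j * φ j ^ 2 ≤ l i * φ i ^ 2 := by
    have h1 : φ j ≤ φ i := Real.rpow_le_rpow_of_nonpos (hl i) hij.le (by linarith)
    rw [sq, sq, ← mul_assoc, ← mul_assoc]
    exact mul_le_mul (anti1 i j hij) h1 (hφ j).le (mul_pos (hl i) (hφ i)).le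
  have s1 : specDiv v l φ (fun i => -α * l i ^ (-α - 1)) ≤ (v - r + 1 - 2 * α) * T := by
    have := sum_divDiff_le hinj anti1
    unfold specDiv
    simp only [hlφ', ← Finset.mul_sum]
    rw [← hTd] at this ⊢
    linarith
  have s2 : specDiv v l (fun i => φ i ^ 2) (fun i => 2 * φ i * (-α * l i ^ (-α - 1)))
      ≤ (v - r + 1 - 4 * α) * q := by
    have := sum_divDiff_le (φ := fun i => φ i ^ 2) hinj anti2
    have e (i) : l i * (2 * φ i * (-α * l i ^ (-α - 1))) = -(2 * α) * φ i ^ 2 := by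
      rw [show l i * (2 * φ i * (-α * l i ^ (-α - 1)))
        = 2 * φ i * (l i * (-α * l i ^ (-α - 1))) by ring, hlφ']; ring
    unfold specDiv
    simp only [e, ← Finset.mul_sum]
    rw [← hqd] at this ⊢
    linarith
  have s3 : ∑ i, l i * (-α * l i ^ (-α - 1)) * φ i = -α * q := by
    simp only [hlφ', hqd, Finset.mul_sum]; exact Finset.sum_congr rfl fun i _ => by ring
  have s4 : ∑ i, l i * (-α * l i ^ (-α - 1)) * φ i ^ 2 = -α * ∑ i, φ i ^ 3 := by
    simp only [hlφ', Finset.mul_sum]; exact Finset.sum_congr rfl fun i _ => by ring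
  set w := v - r + 1 with hwd
  have hw : 1 ≤ w := by linarith
  have hbw : b * w ≤ 2 * (r - 1) := (le_div_iff₀ (by linarith)).1 hb'
  have t1 : specDiv v l φ (fun i => -α * l i ^ (-α - 1)) / T ≤ w - 2 * α := by
    rwa [div_le_iff₀ hT]
  set ρ := q / T ^ 2 with hρ
  have hρ1 : ρ < 1 := by rwa [hρ, div_lt_one (by positivity)]
  have t2 : specDiv v l (fun i => φ i ^ 2) (fun i => 2 * φ i * (-α * l i ^ (-α - 1))) / T ^ 2
      ≤ (w - 4 * α) * ρ := by
    rw [hρ, ← mul_div_assoc]; gcongr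
  have t3 : 2 * (-α * q) / T ^ 2 = -(2 * α * ρ) := by rw [hρ]; ring
  have t4 : -(4 * (-α * ∑ i, φ i ^ 3) / T ^ 3) ≤ 4 * α * ρ := by
    have : (∑ i, φ i ^ 3) / T ^ 3 ≤ ρ := by
      rw [hρ, div_le_div_iff₀ (by positivity) (by positivity)]
      nlinarith [mul_le_mul_of_nonneg_right hcub (sq_nonneg T)]
    calc _ = 4 * α * ((∑ i, φ i ^ 3) / T ^ 3) := by ring
      _ ≤ _ := by gcongr
  unfold haffDiv
  rw [s3, s4, t3, ← hTd]
  have u1 : 2 * b * (specDiv v l φ (fun i => -α * l i ^ (-α - 1)) / T - -(2 * α * ρ))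
      ≤ 2 * b * (w - 2 * α * (1 - ρ)) :=
    mul_le_mul_of_nonneg_left (by linarith) (by positivity)
  have u2 : b ^ 2 * (specDiv v l (fun i => φ i ^ 2) (fun i => 2 * φ i * (-α * l i ^ (-α - 1)))
      / T ^ 2 - 4 * (-α * ∑ i, φ i ^ 3) / T ^ 3) ≤ b ^ 2 * (w * ρ) :=
    mul_le_mul_of_nonneg_left (by linarith) (by positivity)
  have u3 : b ^ 2 * (w * ρ) ≤ b * (2 * (r - 1)) := by
    have h1 : w * ρ ≤ w := by nlinarith
    calc b ^ 2 * (w * ρ) ≤ b ^ 2 * w := by gcongr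
      _ = b * (b * w) := by ring
      _ ≤ _ := by gcongr
  have u4 : 0 < 2 * b * (2 * α * (1 - ρ)) := by
    have : 0 < 1 - ρ := by linarith
    positivity
  have : 2 * b * v = 2 * b * w + b * (2 * (r - 1)) := by rw [hwd]; ring
  linarith

end SpectralDivergence

/-! ### Divergence of polynomial functions of the scatter matrix -/

section PolynomialDivergence

open Polynomial

variable {q m p : ℕ}

/-- Besides the `l i`, the matrix has `p - r` zero eigenvalues, each contributing `P(0)`. Splitting
off the constant coefficient leaves a multiple of `X`, to which `IsEigenDecomp.aeval` applies. -/
lemma IsEigenDecomp.trace_aeval {r : ℕ} {S : Matrix (Fin p) (Fin p) ℝ}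
    {H : Matrix (Fin p) (Fin r) ℝ} {l : Fin r → ℝ} (h : IsEigenDecomp S H l) (P : ℝ[X]) :
    trace (Polynomial.aeval S P) = ∑ i, P.eval (l i) + ((p : ℝ) - r) * P.eval 0 := by
  have e : Polynomial.aeval S P
      = H * diagonal (fun i => l i * P.divX.eval (l i)) * Hᵀ + P.coeff 0 • 1 := by
    conv_lhs => rw [← divX_mul_X_add P, mul_comm, map_add, h.aeval]
    rw [aeval_C, Algebra.algebraMap_eq_smul_one]
  have e2 (i) : P.eval (l i) = l i * P.divX.eval (l i) + P.coeff 0 := by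
    have := congrArg (Polynomial.eval (l i)) (divX_mul_X_add P)
    rw [eval_add, eval_mul, eval_X, eval_C] at this
    rw [← this, mul_comm]
  rw [e, trace_add, h.trace_fun, trace_smul, trace_one, ← coeff_zero_eq_eval_zero]
  simp only [e2, Finset.sum_add_distrib, Finset.sum_const, Finset.card_univ, Fintype.card_fin,
    nsmul_eq_mul, smul_eq_mul]
  ring

lemma IsEigenDecomp.trace_pow {r : ℕ} {S : Matrix (Fin p) (Fin p) ℝ}
    {H : Matrix (Fin p) (Fin r) ℝ} {l : Fin r → ℝ} (h : IsEigenDecomp S H l) (k : ℕ) :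
    trace (S ^ k) = ∑ i, l i ^ k + ((p : ℝ) - r) * 0 ^ k := by
  simpa using h.trace_aeval (X ^ k)

/-- The derivative of `P(S)` in the direction `E`. -/
def dAeval (P : ℝ[X]) (S E : Matrix (Fin p) (Fin p) ℝ) : Matrix (Fin p) (Fin p) ℝ :=
  P.sum fun k c => c • ∑ i ∈ Finset.range k, S ^ i * E * S ^ (k - 1 - i)

lemma dAeval_monomial (k : ℕ) (c : ℝ) (S E : Matrix (Fin p) (Fin p) ℝ) :
    dAeval (monomial k c) S E = c • ∑ i ∈ Finset.range k, S ^ i * E * S ^ (k - 1 - i) := by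
  rw [dAeval, sum_monomial_index]; simp

lemma dAeval_add (P Q : ℝ[X]) (S E : Matrix (Fin p) (Fin p) ℝ) :
    dAeval (P + Q) S E = dAeval P S E + dAeval Q S E :=
  sum_add_index _ _ _ (by simp) fun _ _ _ => add_smul _ _ _

/-- Under the trace, cyclicity makes the `k` noncommuting terms in the derivative of `S ^ k` equal.
-/
lemma trace_dAeval (P : ℝ[X]) (S E : Matrix (Fin p) (Fin p) ℝ) :
    trace (dAeval P S E) = trace (Polynomial.aeval S P.derivative * E) := by
  induction P using Polynomial.induction_on' with
  | add P Q hP hQ => rw [dAeval_add, trace_add, hP, hQ]; simp [Matrix.add_mul]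
  | monomial k c =>
    rw [dAeval_monomial, derivative_monomial, Polynomial.aeval_monomial, trace_smul, trace_sum,
      ← Algebra.smul_def, Matrix.smul_mul, trace_smul]
    have (i : ℕ) (hi : i ∈ Finset.range k) :
        trace (S ^ i * E * S ^ (k - 1 - i)) = trace (S ^ (k - 1) * E) := by
      rw [trace_mul_comm, ← Matrix.mul_assoc, ← pow_add]
      congr 3
      have := Finset.mem_range.1 hi
      omega
    rw [Finset.sum_congr rfl this]
    simp
    ring

/-- The two contractions over matrix units from which every divergence is assembled: a transposed
unit yields one trace, a plain unit (next lemma) a product of traces. -/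
lemma sum_mul_single_transpose_mul (A B : Matrix (Fin m) (Fin p) ℝ) :
    ∑ a : Fin m, ∑ b : Fin p, (A * (single a b (1 : ℝ))ᵀ * B) a b = trace (A * Bᵀ) := by
  simp only [trace, diag, mul_apply, transpose_apply]
  refine Finset.sum_congr rfl fun a _ => Finset.sum_congr rfl fun b _ => ?_
  simp [single_apply, ite_and]

lemma sum_mul_single_mul (A : Matrix (Fin m) (Fin m) ℝ) (B : Matrix (Fin p) (Fin p) ℝ) :
    ∑ a : Fin m, ∑ b : Fin p, (A * single a b (1 : ℝ) * B) a b = trace A * trace B := by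
  simp only [trace, diag, mul_apply, Finset.sum_mul_sum]
  refine Finset.sum_congr rfl fun a _ => Finset.sum_congr rfl fun b _ => ?_
  simp [single_apply, ite_and]

/-- The derivative of `uᵀ u` in the direction of the `(a, b)` entry. -/
def dGram (U : Matrix (Fin m) (Fin p) ℝ) (a : Fin m) (b : Fin p) : Matrix (Fin p) (Fin p) ℝ :=
  (single a b (1 : ℝ))ᵀ * U + Uᵀ * single a b (1 : ℝ)

/-- The derivative of `u P(uᵀ u)` in the direction of the `(a, b)` entry. -/
def dMulAeval (P : ℝ[X]) (U : Matrix (Fin m) (Fin p) ℝ) (a : Fin m) (b : Fin p) :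
    Matrix (Fin m) (Fin p) ℝ :=
  single a b (1 : ℝ) * Polynomial.aeval (Uᵀ * U) P + U * dAeval P (Uᵀ * U) (dGram U a b)

/-- In each product-rule term the half of `dGram` with the transposed unit contributes `tr S^k`, and
the other half `tr S^(i+1) tr S^(k-1-i)`. Differentiating the leading `u` gives `m tr S^k`. -/
lemma sum_dMulAeval_pow (k : ℕ) (U : Matrix (Fin m) (Fin p) ℝ) :
    ∑ a, ∑ b, dMulAeval (X ^ k) U a b a b
      = (m + k) * trace ((Uᵀ * U) ^ k)
        + ∑ i ∈ Finset.range k, trace ((Uᵀ * U) ^ (i + 1)) * trace ((Uᵀ * U) ^ (k - 1 - i)) := by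
  set S := Uᵀ * U with hS
  have hSt : Sᵀ = S := by rw [hS, transpose_mul, transpose_transpose]
  have h1 (i : ℕ) (hi : i ∈ Finset.range k) :
      ∑ a, ∑ b, (U * (S ^ i * dGram U a b * S ^ (k - 1 - i))) a b
        = trace (S ^ k) + trace (S ^ (i + 1)) * trace (S ^ (k - 1 - i)) := by
    have e (a b) : U * (S ^ i * dGram U a b * S ^ (k - 1 - i))
        = (U * S ^ i) * (single a b (1 : ℝ))ᵀ * (U * S ^ (k - 1 - i))
          + (U * S ^ i * Uᵀ) * single a b (1 : ℝ) * S ^ (k - 1 - i) := by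
      rw [dGram]
      simp only [Matrix.mul_add, Matrix.add_mul, Matrix.mul_assoc]
    simp only [e, Matrix.add_apply, Finset.sum_add_distrib, sum_mul_single_transpose_mul,
      sum_mul_single_mul]
    congr 1
    · rw [transpose_mul, transpose_pow, hSt, trace_mul_comm, ← Matrix.mul_assoc,
        Matrix.mul_assoc _ Uᵀ U, ← hS, ← pow_succ, ← pow_add]
      congr 2
      have := Finset.mem_range.1 hi
      omega
    · rw [trace_mul_comm, ← Matrix.mul_assoc, ← hS, ← pow_succ']
  have h0 : ∑ a, ∑ b, (single a b (1 : ℝ) * S ^ k : Matrix (Fin m) (Fin p) ℝ) a b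
      = m * trace (S ^ k) := by
    have := sum_mul_single_mul (1 : Matrix (Fin m) (Fin m) ℝ) (S ^ k)
    simpa using this
  have h2 (a b) : dMulAeval (X ^ k) U a b
      = single a b (1 : ℝ) * S ^ k + ∑ i ∈ Finset.range k,
          U * (S ^ i * dGram U a b * S ^ (k - 1 - i)) := by
    rw [dMulAeval, ← monomial_one_right_eq_X_pow, dAeval_monomial, Polynomial.aeval_monomial,
      one_smul, Matrix.mul_sum, map_one, one_mul]
  simp only [h2, Matrix.add_apply, Finset.sum_add_distrib, h0, Matrix.sum_apply]
  have h3 : ∑ a, ∑ b, ∑ i ∈ Finset.range k, (U * (S ^ i * dGram U a b * S ^ (k - 1 - i))) a b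
      = ∑ i ∈ Finset.range k, ∑ a, ∑ b, (U * (S ^ i * dGram U a b * S ^ (k - 1 - i))) a b := by
    rw [Finset.sum_comm' (t' := Finset.univ) (s' := fun _ => Finset.univ) (by simp)]
    simp_rw [Finset.sum_comm (s := Finset.range k)]
    rw [Finset.sum_comm]
  rw [h3, Finset.sum_congr rfl h1, Finset.sum_add_distrib]
  simp
  ring

lemma dMulAeval_add (P Q : ℝ[X]) (U : Matrix (Fin m) (Fin p) ℝ) (a : Fin m) (b : Fin p) :
    dMulAeval (P + Q) U a b = dMulAeval P U a b + dMulAeval Q U a b := by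
  simp only [dMulAeval, dAeval_add, map_add, Matrix.mul_add]
  abel

lemma dMulAeval_monomial (k : ℕ) (c : ℝ) (U : Matrix (Fin m) (Fin p) ℝ) (a : Fin m) (b : Fin p) :
    dMulAeval (monomial k c) U a b = c • dMulAeval (X ^ k) U a b := by
  rw [← monomial_one_right_eq_X_pow]
  simp only [dMulAeval, dAeval_monomial, Polynomial.aeval_monomial, ← Algebra.smul_def, one_smul,
    smul_add, Matrix.mul_smul]

lemma specDiv_add {r : ℕ} (v : ℝ) (l φ φ' χ χ' : Fin r → ℝ) :
    specDiv v l (fun i => φ i + χ i) (fun i => φ' i + χ' i)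
      = specDiv v l φ φ' + specDiv v l χ χ' := by
  have (i j : Fin r) : l i * (φ i + χ i - (φ j + χ j)) / (l i - l j)
      = l i * (φ i - φ j) / (l i - l j) + l i * (χ i - χ j) / (l i - l j) := by ring
  simp only [specDiv, this, mul_add, Finset.sum_add_distrib]
  ring

lemma specDiv_smul {r : ℕ} (v c : ℝ) (l φ φ' : Fin r → ℝ) :
    specDiv v l (fun i => c * φ i) (fun i => c * φ' i) = c * specDiv v l φ φ' := by
  have (i j : Fin r) : l i * (c * φ i - c * φ j) / (l i - l j) = c * (l i * (φ i - φ j) / (l i - l j)) := by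
    ring
  simp only [specDiv, this, mul_left_comm _ c, ← Finset.mul_sum]
  ring

/-- Same shape as `sum_dMulAeval_pow`, with traces replaced by sums over nonzero eigenvalues: the
divided difference of a power is a geometric sum. -/
lemma specDiv_pow {r : ℕ} (v : ℝ) {l : Fin r → ℝ} (hl : Function.Injective l) (k : ℕ) :
    specDiv v l (fun i => l i ^ k) (fun i => k * l i ^ (k - 1))
      = (v + k) * ∑ i, l i ^ k
        + ∑ i ∈ Finset.range k, (∑ j, l j ^ (i + 1)) * ∑ j, l j ^ (k - 1 - i) := by
  have e1 (i) : l i * (k * l i ^ (k - 1)) = k * l i ^ k := by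
    cases k with
    | zero => simp
    | succ k => simp; ring
  -- On the diagonal the quotient is `0 / 0 = 0`, whereas the geometric sum equals `k * l i ^ k`;
  -- hence the correction.
  have e2 (i j) : l i * (l i ^ k - l j ^ k) / (l i - l j)
      = ∑ n ∈ Finset.range k, l i ^ (n + 1) * l j ^ (k - 1 - n)
        - if i = j then k * l i ^ k else 0 := by
    split_ifs with hij
    · subst hij
      have (n : ℕ) (hn : n ∈ Finset.range k) : l i ^ (n + 1) * l i ^ (k - 1 - n) = l i ^ k := by
        rw [← pow_add]; congr 1; have := Finset.mem_range.1 hn; omega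
      rw [Finset.sum_congr rfl this]
      simp
    · have hne : l i - l j ≠ 0 := sub_ne_zero.2 (hl.ne hij)
      rw [← geom_sum₂_mul, sub_zero, mul_div_assoc, mul_div_assoc, div_self hne, mul_one,
        Finset.mul_sum]
      exact Finset.sum_congr rfl fun n _ => by rw [pow_succ]; ring
  have e3 : ∑ i, ∑ j, ∑ n ∈ Finset.range k, l i ^ (n + 1) * l j ^ (k - 1 - n)
      = ∑ n ∈ Finset.range k, (∑ j, l j ^ (n + 1)) * ∑ j, l j ^ (k - 1 - n) := by
    simp_rw [Finset.sum_mul_sum]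
    rw [Finset.sum_comm' (t' := Finset.univ) (s' := fun _ => Finset.univ) (by simp)]
    simp_rw [Finset.sum_comm (s := Finset.range k)]
    rw [Finset.sum_comm]
  simp only [specDiv, e1, e2, Finset.sum_sub_distrib, e3, Finset.sum_ite_eq, Finset.mem_univ,
    if_true, ← Finset.mul_sum]
  ring

/-- By linearity monomials suffice. Traces count the `p - r` zero eigenvalues and eigenvalue sums do
not; this discrepancy is what turns the factor `m` into `max p m`. -/
lemma IsEigenDecomp.sum_dMulAeval {U : Matrix (Fin m) (Fin p) ℝ}
    {H : Matrix (Fin p) (Fin (min p m)) ℝ} {l : Fin (min p m) → ℝ}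
    (h : IsEigenDecomp (Uᵀ * U) H l) (P : ℝ[X]) :
    ∑ a, ∑ b, dMulAeval P U a b a b
      = specDiv (max p m : ℕ) l (fun i => P.eval (l i)) (fun i => P.derivative.eval (l i)) := by
  induction P using Polynomial.induction_on' with
  | add P Q hP hQ =>
    simp only [dMulAeval_add, Matrix.add_apply, Finset.sum_add_distrib, hP, hQ, ← specDiv_add,
      eval_add, derivative_add]
  | monomial k c =>
    have e : ∑ a, ∑ b, dMulAeval (monomial k c) U a b a b
        = c * ∑ a, ∑ b, dMulAeval (X ^ k) U a b a b := by
      simp only [dMulAeval_monomial, Matrix.smul_apply, smul_eq_mul, Finset.mul_sum]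
    have e2 : specDiv (max p m : ℕ) l (fun i => (monomial k c).eval (l i))
        (fun i => (monomial k c).derivative.eval (l i))
        = c * specDiv (max p m : ℕ) l (fun i => l i ^ k) (fun i => k * l i ^ (k - 1)) := by
      rw [← specDiv_smul]
      simp only [eval_monomial, derivative_monomial, mul_assoc]
    have hmp : ((max p m : ℕ) : ℝ) + (min p m : ℕ) = p + m := by exact_mod_cast max_add_min p m
    rw [e, e2, sum_dMulAeval_pow, specDiv_pow _ h.strictAnti.injective]
    simp only [h.trace_pow]
    congr 1
    cases k with
    | zero =>
      -- In degree zero both sides count dimensions: `m p = v r`.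
      have hmm : ((max p m : ℕ) : ℝ) * (min p m : ℕ) = p * m := by exact_mod_cast max_mul_min p m
      simp
      simp only [Nat.cast_max, Nat.cast_min] at hmm
      linarith
    | succ k =>
      -- Only the last summand contains a zeroth power, giving `p` on one side and `r` on the other;
      -- this is balanced by `p + m = v + r`. In all others both exponents are positive and zero
      -- eigenvalues do not contribute.
      rw [Finset.sum_range_succ, Finset.sum_range_succ _ k]
      have : ∑ n ∈ Finset.range k, (∑ i, l i ^ (n + 1) + ((p : ℝ) - (min p m : ℕ)) * 0 ^ (n + 1))
            * (∑ i, l i ^ (k + 1 - 1 - n) + ((p : ℝ) - (min p m : ℕ)) * 0 ^ (k + 1 - 1 - n))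
          = ∑ n ∈ Finset.range k, (∑ i, l i ^ (n + 1)) * ∑ i, l i ^ (k + 1 - 1 - n) := by
        refine Finset.sum_congr rfl fun n hn => ?_
        have : k - n ≠ 0 := by have := Finset.mem_range.1 hn; omega
        simp [this]
      rw [this]
      have hv : ((max p m : ℕ) : ℝ) = p + m - (min p m : ℕ) := by linarith
      rw [hv]
      simp
      ring

/-- The gradient of `u ↦ tr P(uᵀ u)` is `2 u P'(uᵀ u)`. This yields the terms that come from
differentiating the normalizing sum of `ψ`. -/
lemma sum_mul_trace_dAeval (P : ℝ[X]) (U W : Matrix (Fin m) (Fin p) ℝ) :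
    ∑ a, ∑ b, W a b * trace (dAeval P (Uᵀ * U) (dGram U a b))
      = 2 * trace (Polynomial.aeval (Uᵀ * U) P.derivative * (Uᵀ * W)) := by
  set D := Polynomial.aeval (Uᵀ * U) P.derivative with hD
  have hSt : (Uᵀ * U)ᵀ = Uᵀ * U := by rw [transpose_mul, transpose_transpose]
  have hDt : Dᵀ = D := by
    rw [hD]
    generalize P.derivative = Q
    induction Q using Polynomial.induction_on' with
    | add P Q hP hQ => rw [map_add, transpose_add, hP, hQ]
    | monomial k c =>
      rw [Polynomial.aeval_monomial, ← Algebra.smul_def, transpose_smul, transpose_pow, hSt]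
  have h1 (a b) : trace (D * dGram U a b) = 2 * (U * D) a b := by
    have t (M : Matrix (Fin p) (Fin m) ℝ) : trace (M * single a b (1 : ℝ)) = M b a := by
      rw [trace_mul_single]; simp
    have e1 : trace (D * ((single a b (1 : ℝ))ᵀ * U)) = (U * D) a b := by
      rw [← trace_transpose, transpose_mul, transpose_mul, transpose_transpose, hDt,
        Matrix.mul_assoc, trace_mul_comm, Matrix.mul_assoc, trace_mul_comm, t]
      conv_rhs => rw [← hDt, ← transpose_transpose U, ← transpose_mul, transpose_apply]
    have e2 : trace (D * (Uᵀ * single a b (1 : ℝ))) = (U * D) a b := by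
      rw [← Matrix.mul_assoc, t]
      conv_rhs => rw [← hDt, ← transpose_transpose U, ← transpose_mul, transpose_apply]
    rw [dGram, Matrix.mul_add, trace_add, e1, e2]
    ring
  have h2 : trace (D * (Uᵀ * W)) = ∑ a, ∑ b, W a b * (U * D) a b := by
    rw [trace_mul_comm, Matrix.mul_assoc, trace_mul_comm, Matrix.mul_assoc,
      ← hDt, ← transpose_mul, hDt]
    rw [trace]
    simp only [diag, mul_apply, transpose_apply]
  simp only [trace_dAeval, ← hD, h1]
  rw [h2, Finset.mul_sum]
  refine Finset.sum_congr rfl fun a _ => ?_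
  rw [Finset.mul_sum]
  exact Finset.sum_congr rfl fun b _ => by ring

lemma IsEigenDecomp.trace_aeval_mul {r : ℕ} {S : Matrix (Fin p) (Fin p) ℝ}
    {H : Matrix (Fin p) (Fin r) ℝ} {l : Fin r → ℝ} (h : IsEigenDecomp S H l) (P Q : ℝ[X]) :
    trace (Polynomial.aeval S P * (S * Polynomial.aeval S Q))
      = ∑ i, l i * P.eval (l i) * Q.eval (l i) := by
  have : Polynomial.aeval S P * (S * Polynomial.aeval S Q)
      = Polynomial.aeval S (X * (P * Q)) := by
    simp only [map_mul, Polynomial.aeval_X]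
    rw [← mul_assoc, ← mul_assoc]
    congr 1
    exact (Polynomial.aeval_X (R := ℝ) S ▸ (Commute.all P X).map (Polynomial.aeval S)).eq
  rw [this, h.aeval, h.trace_fun]
  simp [mul_assoc]

/-- The sum of `P` over the nonzero eigenvalues. -/
def nzTrace (m : ℕ) (P : ℝ[X]) (S : Matrix (Fin p) (Fin p) ℝ) : ℝ :=
  trace (Polynomial.aeval S P) - ((p : ℝ) - (min p m : ℕ)) * P.eval 0

lemma IsEigenDecomp.nzTrace_eq {S : Matrix (Fin p) (Fin p) ℝ}
    {H : Matrix (Fin p) (Fin (min p m)) ℝ} {l : Fin (min p m) → ℝ}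
    (h : IsEigenDecomp S H l) (P : ℝ[X]) : nzTrace m P S = ∑ i, P.eval (l i) := by
  rw [nzTrace, h.trace_aeval]; ring

/-- The vector field `u (2ψ + ψ²)(uᵀ u)` for `ψ = b P / ∑ P`. -/
def haffField (b : ℝ) (P : ℝ[X]) (U : Matrix (Fin m) (Fin p) ℝ) : Matrix (Fin m) (Fin p) ℝ :=
  (2 * b / nzTrace m P (Uᵀ * U)) • (U * Polynomial.aeval (Uᵀ * U) P)
    + (b ^ 2 / nzTrace m P (Uᵀ * U) ^ 2) • (U * Polynomial.aeval (Uᵀ * U) (P ^ 2))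

/-- The derivative of the `(i, j)` entry of `haffField` with respect to the same entry of `u`. -/
def dHaffField (b : ℝ) (P : ℝ[X]) (U : Matrix (Fin m) (Fin p) ℝ) (i : Fin m) (j : Fin p) : ℝ :=
  let T := nzTrace m P (Uᵀ * U)
  let T' := trace (dAeval P (Uᵀ * U) (dGram U i j))
  (2 * b / T) * dMulAeval P U i j i j - (2 * b / T ^ 2) * ((U * Polynomial.aeval (Uᵀ * U) P) i j * T')
  + ((b ^ 2 / T ^ 2) * dMulAeval (P ^ 2) U i j i j
    - (2 * b ^ 2 / T ^ 3) * ((U * Polynomial.aeval (Uᵀ * U) (P ^ 2)) i j * T'))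

theorem IsEigenDecomp.sum_dHaffField (b : ℝ) (P : ℝ[X]) {U : Matrix (Fin m) (Fin p) ℝ}
    {H : Matrix (Fin p) (Fin (min p m)) ℝ} {l : Fin (min p m) → ℝ}
    (h : IsEigenDecomp (Uᵀ * U) H l) :
    ∑ i, ∑ j, dHaffField b P U i j
      = haffDiv (max p m : ℕ) b l (fun i => P.eval (l i)) (fun i => P.derivative.eval (l i)) := by
  simp only [dHaffField, Finset.sum_add_distrib, Finset.sum_sub_distrib, ← Finset.mul_sum,
    h.sum_dMulAeval, sum_mul_trace_dAeval, h.nzTrace_eq]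
  simp only [← Matrix.mul_assoc Uᵀ, h.trace_aeval_mul, haffDiv, derivative_pow, eval_pow, eval_mul,
    eval_C]
  norm_num
  ring

end PolynomialDivergence

/-! ### Almost every scatter matrix has `min p m` distinct positive eigenvalues -/

section Generic

variable {q m p : ℕ}

lemma hankel_mulVec {r p : ℕ} (d : Fin p → ℝ) (c : Fin r → ℝ) (i : Fin r) :
    ((of fun i j : Fin r => ∑ k, d k ^ ((i : ℕ) + j + 1)) *ᵥ c) i
      = ∑ k, d k ^ ((i : ℕ) + 1) * ∑ j, c j * d k ^ (j : ℕ) := by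
  simp only [mulVec, dotProduct, of_apply, Finset.sum_mul, Finset.mul_sum]
  rw [Finset.sum_comm]
  refine Finset.sum_congr rfl fun k _ => Finset.sum_congr rfl fun j _ => ?_
  ring

open Polynomial in
/-- A Hankel matrix of power sums is nonsingular iff there are enough distinct nonzero nodes. -/
lemma hankel_det_ne_zero_iff {r p : ℕ} {d : Fin p → ℝ} (hd : ∀ k, 0 ≤ d k) :
    (of fun i j : Fin r => ∑ k, d k ^ ((i : ℕ) + j + 1)).det ≠ 0
      ↔ r ≤ ((Finset.univ.image d).filter (· ≠ 0)).card := by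
  set K := (Finset.univ.image d).filter (· ≠ 0) with hK
  rw [ne_eq, ← exists_mulVec_eq_zero_iff]
  constructor
  · intro h
    by_contra! hlt
    refine h ?_
    -- With fewer than `r` nonzero nodes, the coefficients of the polynomial vanishing at all of
    -- them form a kernel vector; the factor `d k` takes care of the node zero.
    set P : ℝ[X] := ∏ x ∈ K, (X - C x) with hP
    have hmon : P.Monic := monic_prod_of_monic _ _ fun x _ => monic_X_sub_C x
    have hdeg : P.natDegree = K.card := by
      rw [hP, natDegree_prod_of_monic _ _ fun x _ => monic_X_sub_C x]; simp
    refine ⟨fun i => P.coeff i, ?_, ?_⟩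
    · intro h0
      have := congrFun h0 ⟨K.card, hlt⟩
      simp only [Pi.zero_apply, ← hdeg] at this
      rw [coeff_natDegree, hmon.leadingCoeff] at this
      exact one_ne_zero this
    · ext i
      rw [hankel_mulVec, Pi.zero_apply]
      refine Finset.sum_eq_zero fun k _ => ?_
      have e : ∑ j : Fin r, P.coeff j * d k ^ (j : ℕ) = P.eval (d k) := by
        rw [eval_eq_sum_range' (hdeg ▸ hlt), Finset.sum_range]
      rw [e]
      by_cases hk : d k = 0
      · simp [hk]
      · have : P.eval (d k) = 0 := by
          rw [hP, eval_prod]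
          exact Finset.prod_eq_zero (i := d k) (by simp [hK, hk]) (by simp)
        rw [this, mul_zero]
  · rintro hcard ⟨c, hc0, hc⟩
    refine hc0 ?_
    set P : ℝ[X] := ∑ i : Fin r, C (c i) * X ^ (i : ℕ) with hP
    have heval (x : ℝ) : P.eval x = ∑ j, c j * x ^ (j : ℕ) := by
      simp [hP, eval_finsetSum]
    -- The Hankel form at `c` is `∑ d_k P(d_k)²`; as the nodes are nonnegative, `P` vanishes at
    -- every nonzero node, which is too many roots for its degree.
    have hsum : ∑ k, d k * P.eval (d k) ^ 2 = 0 := by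
      have : ∑ i, c i * ((of fun i j : Fin r => ∑ k, d k ^ ((i : ℕ) + j + 1)) *ᵥ c) i = 0 := by
        rw [hc]; simp
      rw [← this]
      simp only [hankel_mulVec, ← heval, Finset.mul_sum]
      rw [Finset.sum_comm]
      refine Finset.sum_congr rfl fun k _ => ?_
      calc _ = d k * P.eval (d k) * P.eval (d k) := by ring
        _ = _ := by
          conv_lhs => rw [heval, Finset.mul_sum, ← heval]
          exact Finset.sum_congr rfl fun i _ => by ring
    have hz (x : ℝ) (hx : x ∈ K) : P.eval x = 0 := by
      obtain ⟨hx1, hx2⟩ := Finset.mem_filter.1 hx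
      obtain ⟨k, -, rfl⟩ := Finset.mem_image.1 hx1
      have := (Finset.sum_eq_zero_iff_of_nonneg
        fun k _ => mul_nonneg (hd k) (sq_nonneg _)).1 hsum k (Finset.mem_univ k)
      simpa [hx2] using this
    have hP0 : P = 0 := by
      refine eq_zero_of_degree_lt_of_eval_finset_eq_zero K ?_ hz
      exact (degree_sum_fin_lt c).trans_le (by exact_mod_cast hcard)
    ext i
    have := congrArg (fun Q : ℝ[X] => Q.coeff i) hP0
    simpa [hP, finsetSum_coeff, coeff_C_mul, coeff_X_pow, Fin.val_inj] using this

/-- The Hankel determinant of the power sums of `uᵀ u`. -/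
def hankelDet {R : Type*} [CommRing R] (U : Matrix (Fin m) (Fin p) R) : R :=
  (of fun i j : Fin (min p m) => trace ((Uᵀ * U) ^ ((i : ℕ) + j + 1))).det

/-- Allows matrices with polynomial entries, so that the determinant along a line becomes the
evaluation of one polynomial. -/
lemma map_hankelDet {R T : Type*} [CommRing R] [CommRing T] (f : R →+* T)
    (U : Matrix (Fin m) (Fin p) R) : f (hankelDet U) = hankelDet (U.map f) := by
  rw [hankelDet, RingHom.map_det, hankelDet]
  congr 1
  ext i j
  simp only [RingHom.mapMatrix_apply, map_apply, of_apply]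
  rw [← transpose_map, ← Matrix.map_mul, ← RingHom.mapMatrix_apply, ← map_pow,
    RingHom.mapMatrix_apply, AddMonoidHom.map_trace]

lemma eigenvectorMatrix_spec {A : Matrix (Fin p) (Fin p) ℝ} (hA : A.IsHermitian) :
    ∃ V : Matrix (Fin p) (Fin p) ℝ, Vᵀ * V = 1 ∧ A = V * diagonal hA.eigenvalues * Vᵀ := by
  refine ⟨hA.eigenvectorUnitary.1, ?_, ?_⟩
  · have := Unitary.coe_star_mul_self hA.eigenvectorUnitary
    rwa [star_eq_conjTranspose, conjTranspose_eq_transpose_of_trivial] at this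
  · have := hA.spectral_theorem
    rw [Unitary.conjStarAlgAut_apply, star_eq_conjTranspose,
      conjTranspose_eq_transpose_of_trivial] at this
    exact this

lemma trace_pow_eq_sum_eigenvalues {A : Matrix (Fin p) (Fin p) ℝ} (hA : A.IsHermitian) (k : ℕ) :
    trace (A ^ k) = ∑ i, hA.eigenvalues i ^ k := by
  obtain ⟨V, hV, hs⟩ := eigenvectorMatrix_spec hA
  have hVV : V * Vᵀ = 1 := mul_eq_one_comm.1 hV
  set d := hA.eigenvalues
  have hpow : A ^ k = V * diagonal (fun i => d i ^ k) * Vᵀ := by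
    induction k with
    | zero => simp [hVV]
    | succ k ih =>
      rw [pow_succ, ih, hs]
      calc _ = V * diagonal (fun i => d i ^ k) * (Vᵀ * V) * diagonal d * Vᵀ := by
            simp only [Matrix.mul_assoc]
        _ = V * (diagonal (fun i => d i ^ k) * diagonal d) * Vᵀ := by
            rw [hV]; simp only [Matrix.mul_assoc, Matrix.one_mul]
        _ = _ := by rw [diagonal_mul_diagonal]; simp only [pow_succ]
  rw [hpow, trace_mul_comm, ← Matrix.mul_assoc, hV, Matrix.one_mul, trace_diagonal]

/-- The determinant provides at least `r` distinct nonzero eigenvalues, while the rank allows at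
most `r` nonzero ones with multiplicity. So there are exactly `r`, all simple, and the matching
eigenvector columns give `H`. -/
theorem exists_isEigenDecomp {U : Matrix (Fin m) (Fin p) ℝ} (h : hankelDet U ≠ 0) :
    ∃ (H : Matrix (Fin p) (Fin (min p m)) ℝ) (l : Fin (min p m) → ℝ),
      IsEigenDecomp (Uᵀ * U) H l := by
  have hpsd : (Uᵀ * U).PosSemidef := by
    simpa [conjTranspose_eq_transpose_of_trivial] using posSemidef_conjTranspose_mul_self U
  have hS := hpsd.isHermitian
  obtain ⟨V, hV, hs⟩ := eigenvectorMatrix_spec hS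
  have hd0 := hpsd.eigenvalues_nonneg
  simp only [hankelDet, trace_pow_eq_sum_eigenvalues hS] at h
  rw [hankel_det_ne_zero_iff hd0] at h
  set d := hS.eigenvalues with hd
  set K := (Finset.univ.image d).filter (· ≠ 0) with hK
  set J := Finset.univ.filter fun i => d i ≠ 0 with hJ
  have hKJ : K = J.image d := by
    ext x; simp only [hK, hJ, Finset.mem_filter, Finset.mem_image, Finset.mem_univ, true_and]
    constructor
    · rintro ⟨⟨k, rfl⟩, h⟩; exact ⟨k, h, rfl⟩
    · rintro ⟨k, h, rfl⟩; exact ⟨⟨k, rfl⟩, h⟩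
  have hJr : J.card ≤ min p m := by
    have h1 := hS.rank_eq_card_non_zero_eigs
    rw [Fintype.card_subtype] at h1
    rw [hJ, ← h1, rank_transpose_mul_self]
    exact le_min (rank_le_width U) (rank_le_height U)
  have hKc : K.card = min p m :=
    le_antisymm ((hKJ ▸ Finset.card_image_le).trans hJr) h
  have hJc : J.card = min p m := le_antisymm hJr (hKc ▸ hKJ ▸ Finset.card_image_le)
  -- Index reversal converts the increasing enumeration of `K` into a decreasing one.
  let l : Fin (min p m) → ℝ := fun i => K.orderEmbOfFin hKc i.rev
  have hl : StrictAnti l := fun i j hij => (K.orderEmbOfFin hKc).strictMono (Fin.rev_lt_rev.2 hij)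
  have hlK (i) : l i ∈ K := K.orderEmbOfFin_mem hKc _
  have hex (i) : ∃ j, d j ≠ 0 ∧ d j = l i := by
    have := hlK i
    rw [hKJ, Finset.mem_image] at this
    obtain ⟨j, hj, e⟩ := this
    exact ⟨j, (Finset.mem_filter.1 hj).2, e⟩
  choose j hj0 hj using hex
  have hjinj : Function.Injective j := fun a b hab => hl.injective (by rw [← hj, ← hj, hab])
  have hJimg : Finset.univ.image j = J := by
    refine Finset.eq_of_subset_of_card_le ?_ ?_
    · intro x hx
      obtain ⟨i, -, rfl⟩ := Finset.mem_image.1 hx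
      exact Finset.mem_filter.2 ⟨Finset.mem_univ _, hj0 i⟩
    · rw [Finset.card_image_of_injective _ hjinj, hJc]; simp
  refine ⟨V.submatrix id j, l, ?_, hl, fun i => ?_, ?_⟩
  · ext a b
    have := congrFun (congrFun hV (j a)) (j b)
    simp only [mul_apply, transpose_apply, submatrix_apply, id, one_apply] at this ⊢
    rw [this]
    simp [hjinj.eq_iff]
  · rw [← hj]
    exact lt_of_le_of_ne (hd0 _) (hj0 i).symm
  · conv_lhs => rw [hs]
    ext a b
    simp only [mul_apply, diagonal_apply, transpose_apply, submatrix_apply, id, mul_ite,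
      mul_zero, Finset.sum_ite_eq', Finset.mem_univ, if_true]
    have : ∑ x, V a x * d x * V b x = ∑ x ∈ J, V a x * d x * V b x := by
      refine (Finset.sum_subset (Finset.subset_univ _) fun x _ hx => ?_).symm
      have : d x = 0 := by simpa [hJ] using hx
      simp [this]
    rw [this, ← hJimg, Finset.sum_image hjinj.injOn]
    simp only [hj]

/-- The rectangular diagonal matrix with entries `1, 2, 3, …` has the distinct squares as nonzero
eigenvalues of `uᵀ u`. -/
lemma exists_hankelDet_ne_zero : ∃ U : Matrix (Fin m) (Fin p) ℝ, hankelDet U ≠ 0 := by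
  let U : Matrix (Fin m) (Fin p) ℝ := of fun i j => if (i : ℕ) = j then (j : ℝ) + 1 else 0
  let d : Fin p → ℝ := fun j => if (j : ℕ) < m then ((j : ℝ) + 1) ^ 2 else 0
  have hU : Uᵀ * U = diagonal d := by
    ext a b
    simp only [mul_apply, transpose_apply, U, of_apply, diagonal_apply, d]
    by_cases ha : (a : ℕ) < m
    · rw [Finset.sum_eq_single ⟨a, ha⟩]
      · by_cases hab : a = b
        · subst hab; simp [ha, sq]
        · simp [hab, Fin.val_inj]
      · intro i _ hi
        have : (i : ℕ) ≠ a := fun h => hi (Fin.ext h)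
        simp [this]
      · simp
    · rw [Finset.sum_eq_zero]
      · simp [ha]
      · intro i _
        have : (i : ℕ) ≠ a := fun h => ha (h ▸ i.2)
        simp [this]
  refine ⟨U, ?_⟩
  simp only [hankelDet, hU, diagonal_pow, trace_diagonal]
  refine (hankel_det_ne_zero_iff (d := d) fun k => ?_).2 ?_
  · simp only [d]; split_ifs <;> positivity
  · let g : Fin (min p m) → ℝ := fun i => ((i : ℝ) + 1) ^ 2
    have hg : Function.Injective g := fun i j hij => by
      have := (sq_eq_sq₀ (by positivity) (by positivity)).1 hij
      exact Fin.ext (by exact_mod_cast add_right_cancel this)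
    calc min p m = (Finset.univ.image g).card := by
          rw [Finset.card_image_of_injective _ hg]; simp
      _ ≤ _ := Finset.card_le_card fun x hx => by
          obtain ⟨i, -, rfl⟩ := Finset.mem_image.1 hx
          have h1 := lt_of_lt_of_le i.2 (min_le_left p m)
          have h2 := lt_of_lt_of_le i.2 (min_le_right p m)
          refine Finset.mem_filter.2 ⟨Finset.mem_image.2 ⟨⟨i, h1⟩, Finset.mem_univ _, ?_⟩, ?_⟩
          · simp [d, g, h2]
          · simp only [g]; positivity

/-- A measurable set that meets every line through a given point in a countable set is null. -/
lemma measure_eq_zero_of_countable_lines {E : Type*} [NormedAddCommGroup E] [NormedSpace ℝ E]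
    [FiniteDimensional ℝ E] [MeasurableSpace E] [BorelSpace E] (μ : Measure E)
    [μ.IsAddHaarMeasure] {Z : Set E} (hZ : MeasurableSet Z) (u : E)
    (h : ∀ w : E, {t : ℝ | u + t • w ∈ Z}.Countable) : μ Z = 0 := by
  have hm : Measurable fun x : ℝ × E => u + x.1 • x.2 := by fun_prop
  have h0 : ((volume : Measure ℝ).prod μ) ((fun x : ℝ × E => u + x.1 • x.2) ⁻¹' Z) = 0 := by
    rw [Measure.prod_apply_symm (hm hZ)]
    exact lintegral_eq_zero_of_ae_eq_zero (.of_forall fun w => (h w).measure_zero _)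
  -- By Fubini the slice at almost every `t` is null; for one `t ≠ 0` the slice is an invertible
  -- affine preimage of `Z`.
  have h1 := Measure.measure_ae_null_of_prod_null h0
  have h2 : ∀ᵐ t : ℝ, t ≠ 0 := by simp [ae_iff]
  obtain ⟨t, ht, ht0⟩ := (h1.and h2).exists
  have e : Prod.mk t ⁻¹' ((fun x : ℝ × E => u + x.1 • x.2) ⁻¹' Z)
      = (t • ·) ⁻¹' ((u + ·) ⁻¹' Z) := rfl
  simp only [Pi.zero_apply] at ht
  rw [e, Measure.addHaar_preimage_smul μ ht0, measure_preimage_add] at ht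
  have : ENNReal.ofReal |(t ^ Module.finrank ℝ E)⁻¹| ≠ 0 := by
    simp [ht0]
  exact (mul_eq_zero.1 ht).resolve_left this

lemma measurable_hankelDet : Measurable fun x : Sample q m p => hankelDet (of x.2) := by
  have h : Continuous fun x : Sample q m p => (of x.2 : Matrix (Fin m) (Fin p) ℝ) := continuous_snd
  refine Continuous.measurable ?_
  unfold hankelDet
  refine Continuous.matrix_det (continuous_matrix fun i j => ?_)
  exact ((h.matrix_transpose.matrix_mul h).pow _).matrix_trace

-- On a line through a point where the determinant is nonzero it is a nonzero polynomial in `t`,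
-- with finitely many roots.
open Polynomial in
lemma hankelDet_ae_ne_zero : ∀ᵐ x : Sample q m p, hankelDet (of x.2) ≠ 0 := by
  have := isAddHaarMeasure_volume (q := q) (m := m) (p := p)
  obtain ⟨U, hU⟩ := exists_hankelDet_ne_zero (m := m) (p := p)
  have hZ : MeasurableSet {x : Sample q m p | hankelDet (of x.2) = 0} :=
    measurable_hankelDet (measurableSet_singleton 0)
  rw [ae_iff]
  simp only [not_not]
  refine measure_eq_zero_of_countable_lines volume hZ (0, fun i j => U i j) fun w => ?_
  let W : Matrix (Fin m) (Fin p) ℝ := of w.2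
  let M : Matrix (Fin m) (Fin p) ℝ[X] := U.map C + (X : ℝ[X]) • W.map C
  let P : ℝ[X] := hankelDet M
  have hP (t : ℝ) : P.eval t = hankelDet (U + t • W) := by
    have := map_hankelDet (evalRingHom t) M
    rw [coe_evalRingHom] at this
    rw [this]
    congr 1
    ext i j
    simp [M]
    ring
  have hP0 : P ≠ 0 := by
    intro h0
    have := hP 0
    simp [h0] at this
    exact hU this.symm
  refine (P.roots.toFinset.finite_toSet.subset fun t ht => ?_).countable
  simp only [Finset.mem_coe, Multiset.mem_toFinset, mem_roots hP0, IsRoot, hP]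
  exact ht

theorem ae_exists_isEigenDecomp : ∀ᵐ x : Sample q m p,
    ∃ Hl : Matrix (Fin p) (Fin (min p m)) ℝ × (Fin (min p m) → ℝ),
      IsEigenDecomp (scatter x) Hl.1 Hl.2 := by
  filter_upwards [hankelDet_ae_ne_zero (q := q) (m := m) (p := p)] with x hx
  obtain ⟨H, l, h⟩ := exists_isEigenDecomp hx
  exact ⟨(H, l), h⟩

end Generic

/-! ### Derivatives along the coordinate directions -/

section LineDerivatives

open Polynomial

variable {q m p : ℕ}

/-- Entrywise derivative at `0` of a curve of matrices. -/
def HasEntryDeriv {k l : ℕ} (A : ℝ → Matrix (Fin k) (Fin l) ℝ) (A' : Matrix (Fin k) (Fin l) ℝ) :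
    Prop := ∀ i j, HasDerivAt (fun t => A t i j) (A' i j) 0

namespace HasEntryDeriv

variable {k l n : ℕ}

lemma const (A : Matrix (Fin k) (Fin l) ℝ) : HasEntryDeriv (fun _ => A) 0 :=
  fun i j => hasDerivAt_const 0 (A i j)

lemma add {A B : ℝ → Matrix (Fin k) (Fin l) ℝ} {A' B' : Matrix (Fin k) (Fin l) ℝ}
    (hA : HasEntryDeriv A A') (hB : HasEntryDeriv B B') :
    HasEntryDeriv (fun t => A t + B t) (A' + B') := fun i j => (hA i j).add (hB i j)

lemma smul {A : ℝ → Matrix (Fin k) (Fin l) ℝ} {A' : Matrix (Fin k) (Fin l) ℝ}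
    (c : ℝ) (hA : HasEntryDeriv A A') : HasEntryDeriv (fun t => c • A t) (c • A') :=
  fun i j => (hA i j).const_mul c

lemma transpose {A : ℝ → Matrix (Fin k) (Fin l) ℝ} {A' : Matrix (Fin k) (Fin l) ℝ}
    (hA : HasEntryDeriv A A') : HasEntryDeriv (fun t => (A t)ᵀ) A'ᵀ := fun i j => hA j i

lemma mul {A : ℝ → Matrix (Fin k) (Fin l) ℝ} {A' : Matrix (Fin k) (Fin l) ℝ}
    {B : ℝ → Matrix (Fin l) (Fin n) ℝ} {B' : Matrix (Fin l) (Fin n) ℝ}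
    (hA : HasEntryDeriv A A') (hB : HasEntryDeriv B B') :
    HasEntryDeriv (fun t => A t * B t) (A' * B 0 + A 0 * B') := fun i j => by
  simp only [Matrix.add_apply, mul_apply, ← Finset.sum_add_distrib]
  exact HasDerivAt.fun_sum fun x _ => (hA i x).mul (hB x j)

lemma trace {A : ℝ → Matrix (Fin k) (Fin k) ℝ} {A' : Matrix (Fin k) (Fin k) ℝ}
    (hA : HasEntryDeriv A A') : HasDerivAt (fun t => (A t).trace) A'.trace 0 :=
  HasDerivAt.fun_sum fun x _ => hA x x

lemma pow {A : ℝ → Matrix (Fin k) (Fin k) ℝ} {A' : Matrix (Fin k) (Fin k) ℝ}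
    (hA : HasEntryDeriv A A') (n : ℕ) : HasEntryDeriv (fun t => A t ^ n)
      (∑ i ∈ Finset.range n, A 0 ^ i * A' * A 0 ^ (n - 1 - i)) := by
  induction n with
  | zero => simpa using const (1 : Matrix (Fin k) (Fin k) ℝ)
  | succ n ih =>
    have h := ih.mul hA
    simp only [← pow_succ] at h
    convert h using 1
    rw [Finset.sum_range_succ, Finset.sum_mul]
    congr 1
    · refine Finset.sum_congr rfl fun i hi => ?_
      have := Finset.mem_range.1 hi
      rw [mul_assoc _ _ (A 0), ← pow_succ]
      congr 2
      omega
    · simp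

lemma aeval {A : ℝ → Matrix (Fin k) (Fin k) ℝ} {A' : Matrix (Fin k) (Fin k) ℝ}
    (hA : HasEntryDeriv A A') (P : ℝ[X]) :
    HasEntryDeriv (fun t => Polynomial.aeval (A t) P) (dAeval P (A 0) A') := by
  induction P using Polynomial.induction_on' with
  | add P Q hP hQ => simpa only [map_add, dAeval_add] using hP.add hQ
  | monomial n c =>
    simpa only [Polynomial.aeval_monomial, dAeval_monomial, ← Algebra.smul_def]
      using (hA.pow n).smul c

end HasEntryDeriv

/-- The coordinate direction of the `(a, b)` entry of `u`. -/
def coordDir (q : ℕ) (a : Fin m) (b : Fin p) : Sample q m p := (0, Pi.single a (Pi.single b 1))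

lemma hasEntryDeriv_snd (x : Sample q m p) (a : Fin m) (b : Fin p) :
    HasEntryDeriv (fun t : ℝ => of (x + t • coordDir q a b).2) (single a b (1 : ℝ)) := fun i j => by
  have e : (single a b (1 : ℝ) : Matrix (Fin m) (Fin p) ℝ) i j
      = (Pi.single a (Pi.single b 1) : Fin m → Fin p → ℝ) i j := by
    by_cases hi : i = a
    · subst hi
      by_cases hj : j = b
      · subst hj; simp
      · simp [hj, Ne.symm hj]
    · simp [Ne.symm hi, hi]
  have : HasDerivAt (fun t : ℝ => x.2 i j + t * (single a b (1 : ℝ) : Matrix _ _ ℝ) i j)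
      (1 * (single a b (1 : ℝ) : Matrix (Fin m) (Fin p) ℝ) i j) 0 :=
    ((hasDerivAt_id (0 : ℝ)).mul_const _).const_add _
  rw [one_mul] at this
  refine this.congr_of_eventuallyEq (.of_forall fun t => ?_)
  simp [coordDir, e]

lemma hasLineDerivAt_haffField {b : ℝ} {P : ℝ[X]} {x : Sample q m p}
    (hT : nzTrace m P (scatter x) ≠ 0) (i : Fin m) (j : Fin p) :
    HasLineDerivAt ℝ (fun x : Sample q m p => haffField b P (of x.2) i j)
      (dHaffField b P (of x.2) i j) x (coordDir q i j) := by
  have hU := hasEntryDeriv_snd x i j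
  have hS := hU.transpose.mul hU
  have h0 : (of (x + (0 : ℝ) • coordDir q i j).2 : Matrix (Fin m) (Fin p) ℝ) = of x.2 := by simp
  have hP (P : ℝ[X]) := hU.mul (hS.aeval P)
  have hTd := (hS.aeval P).trace.sub_const (((p : ℝ) - (min p m : ℕ)) * P.eval 0)
  have hT0 : nzTrace m P ((of (x + (0 : ℝ) • coordDir q i j).2)ᵀ
      * of (x + (0 : ℝ) • coordDir q i j).2) ≠ 0 := by rw [h0]; exact hT
  have h1 := ((hasDerivAt_const (0 : ℝ) (2 * b)).div hTd hT0).mul (hP P i j)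
  have h2 := ((hasDerivAt_const (0 : ℝ) (b ^ 2)).div (hTd.pow 2) (pow_ne_zero 2 hT0)).mul
    (hP (P ^ 2) i j)
  have h : HasDerivAt (fun t : ℝ => haffField b P (of (x + t • coordDir q i j).2) i j) _ 0 :=
    h1.add h2
  refine h.congr_deriv ?_
  simp only [Pi.pow_apply, Pi.div_apply, h0]
  change nzTrace m P ((of x.2)ᵀ * of x.2) ≠ 0 at hT
  have e : trace ((Polynomial.aeval ((of x.2)ᵀ * of x.2)) P)
      - ((p : ℝ) - (min p m : ℕ)) * P.eval 0 = nzTrace m P ((of x.2)ᵀ * of x.2) := rfl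
  simp only [e, dHaffField, dMulAeval, dGram]
  set T := nzTrace m P ((of x.2)ᵀ * of x.2)
  field_simp
  ring

lemma quadForm_eq_trace (Sig : Matrix (Fin p) (Fin p) ℝ) (x : Sample q m p) :
    quadForm 0 Sig x = trace (of x.1 * Sig⁻¹ * (of x.1)ᵀ) + trace (Sig⁻¹ * scatter x) := by
  rw [quadForm, sub_zero, scatter, trace_mul_comm (of x.2 * Sig⁻¹), ← Matrix.mul_assoc,
    trace_mul_comm _ Sig⁻¹]

lemma hasLineDerivAt_quadForm {Sig : Matrix (Fin p) (Fin p) ℝ} (hSig : Sig.PosDef)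
    (x : Sample q m p) (a : Fin m) (b : Fin p) :
    HasLineDerivAt ℝ (quadForm 0 Sig) (2 * (of x.2 * Sig⁻¹) a b) x (coordDir q a b) := by
  have hU := hasEntryDeriv_snd x a b
  have h := ((hU.mul (HasEntryDeriv.const Sig⁻¹)).mul hU.transpose).trace.const_add
    (trace (of x.1 * Sig⁻¹ * (of x.1)ᵀ))
  have h0 : (of (x + (0 : ℝ) • coordDir q a b).2 : Matrix (Fin m) (Fin p) ℝ) = of x.2 := by simp
  have hsymm : (Sig⁻¹)ᵀ = Sig⁻¹ := by
    have := hSig.isHermitian.inv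
    rwa [IsHermitian, conjTranspose_eq_transpose_of_trivial] at this
  unfold HasLineDerivAt
  convert h using 1
  · ext t
    simp [quadForm, coordDir]
  · simp only [h0]
    have e1 : trace (of x.2 * Sig⁻¹ * (single a b (1 : ℝ))ᵀ) = (of x.2 * Sig⁻¹) a b := by
      simp [trace_mul_single]
    have e2 : trace (single a b (1 : ℝ) * Sig⁻¹ * (of x.2)ᵀ) = (of x.2 * Sig⁻¹) a b := by
      rw [← e1, ← trace_transpose]
      simp only [transpose_mul, transpose_transpose, hsymm, Matrix.mul_assoc]
    rw [trace_add, e1, Matrix.mul_zero, add_zero, e2]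
    ring

end LineDerivatives

/-! ### Integration by parts against a compactly supported radial weight -/

section IntegrationByParts

open Polynomial Filter Topology

variable {q m p : ℕ}

lemma hasDerivAt_max_sq (y : ℝ) :
    HasDerivAt (fun y : ℝ => max y 0 ^ 2) (2 * max y 0) y := by
  rcases lt_trichotomy y 0 with hy | rfl | hy
  · have : (fun y : ℝ => max y 0 ^ 2) =ᶠ[𝓝 y] fun _ => 0 := by
      filter_upwards [gt_mem_nhds hy] with z hz
      rw [max_eq_right hz.le]; simp
    rw [max_eq_right hy.le, mul_zero]
    exact (hasDerivAt_const y (0 : ℝ)).congr_of_eventuallyEq this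
  -- At the kink, the square is `O(y²)`, hence has derivative zero.
  · have h : (fun y : ℝ => max y 0 ^ 2) =O[𝓝 0] fun y : ℝ => ‖y - 0‖ ^ 2 := by
      refine Asymptotics.IsBigO.of_bound 1 (.of_forall fun y => ?_)
      rw [one_mul, norm_pow, norm_pow, norm_norm, sub_zero]
      gcongr
      rw [Real.norm_eq_abs, Real.norm_eq_abs, abs_of_nonneg (le_max_right _ _)]
      exact max_le (le_abs_self _) (abs_nonneg _)
    have := (h.hasFDerivAt (by norm_num)).hasDerivAt
    simpa using this
  · have : (fun y : ℝ => max y 0 ^ 2) =ᶠ[𝓝 y] fun y => y ^ 2 := by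
      filter_upwards [lt_mem_nhds hy] with z hz
      rw [max_eq_left hz.le]
    rw [max_eq_left hy.le]
    simpa using (hasDerivAt_pow 2 y).congr_of_eventuallyEq this

lemma hasDerivAt_bump (s : ℝ) :
    HasDerivAt (fun s : ℝ => max (1 - s) 0 ^ 2) (-(2 * max (1 - s) 0)) s := by
  have h : HasDerivAt (fun s : ℝ => max (1 - s) 0 ^ 2) _ s :=
    (hasDerivAt_max_sq (1 - s)).comp s ((hasDerivAt_id s).const_sub 1)
  exact h.congr_deriv (by ring)

lemma continuous_quadForm (θ : Matrix (Fin q) (Fin p) ℝ) (Sig : Matrix (Fin p) (Fin p) ℝ) :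
    Continuous (quadForm θ Sig : Sample q m p → ℝ) := by
  change Continuous fun x : Sample q m p => quadForm θ Sig x
  simp only [quadForm, trace, diag, mul_apply, transpose_apply, Matrix.sub_apply, of_apply]
  fun_prop

lemma quadForm_smul (Sig : Matrix (Fin p) (Fin p) ℝ) (s : ℝ) (x : Sample q m p) :
    quadForm 0 Sig (s • x) = s ^ 2 * quadForm 0 Sig x := by
  have h1 : (of (s • x).1 : Matrix (Fin q) (Fin p) ℝ) = s • of x.1 := rfl
  have h2 : (of (s • x).2 : Matrix (Fin m) (Fin p) ℝ) = s • of x.2 := rfl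
  simp only [quadForm, h1, h2, sub_zero, transpose_smul, Matrix.smul_mul, Matrix.mul_smul,
    trace_smul, smul_eq_mul]
  ring

/-- With `Σ = B Bᵀ`, the ellipsoid is the image of the standard ball under the linear bijection
`rowMap q m B`. -/
lemma isCompact_quadForm_le {Sig : Matrix (Fin p) (Fin p) ℝ} (hSig : Sig.PosDef) :
    IsCompact {x : Sample q m p | quadForm 0 Sig x ≤ 1} := by
  obtain ⟨B, rfl⟩ := exists_factor hSig
  have hB : IsUnit B.det := by
    have := hSig.det_pos
    rw [det_mul, det_transpose] at this
    exact isUnit_iff_ne_zero.2 fun h => by simp [h] at this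
  have hstd : IsCompact {x : Sample q m p | quadForm 0 1 x ≤ 1} := by
    refine Metric.isCompact_of_isClosed_isBounded
      (isClosed_le (continuous_quadForm 0 1) continuous_const) ?_
    refine (Metric.isBounded_closedBall (x := (0 : Sample q m p)) (r := 1)).subset fun x hx => ?_
    rw [Set.mem_ofPred_eq, quadForm_std] at hx
    have hk (k : ℕ) (y : Fin k → Fin p → ℝ) (hy : ∑ i, y i ⬝ᵥ y i ≤ 1) : ‖y‖ ≤ 1 := by
      refine (pi_norm_le_iff_of_nonneg zero_le_one).2 fun i =>
        (pi_norm_le_iff_of_nonneg zero_le_one).2 fun j => ?_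
      have h1 : y i j * y i j ≤ y i ⬝ᵥ y i :=
        Finset.single_le_sum (f := fun j => y i j * y i j)
          (fun j _ => mul_self_nonneg _) (Finset.mem_univ j)
      have h2 : y i ⬝ᵥ y i ≤ ∑ i, y i ⬝ᵥ y i :=
        Finset.single_le_sum (f := fun i => y i ⬝ᵥ y i)
          (fun i _ => Finset.sum_nonneg fun j _ => mul_self_nonneg _) (Finset.mem_univ i)
      rw [Real.norm_eq_abs, ← sq_le_one_iff_abs_le_one]
      nlinarith
    have hn (k : ℕ) (y : Fin k → Fin p → ℝ) : 0 ≤ ∑ i, y i ⬝ᵥ y i :=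
      Finset.sum_nonneg fun i _ => Finset.sum_nonneg fun j _ => mul_self_nonneg _
    rw [mem_closedBall_zero_iff, Prod.norm_def]
    exact max_le (hk _ _ (by linarith [hn _ x.2])) (hk _ _ (by linarith [hn _ x.1]))
  convert hstd.image (LinearMap.continuous_of_finiteDimensional (rowMap q m B)) using 1
  have hq (x : Sample q m p) : quadForm 0 (B * Bᵀ) (rowMap q m B x) = quadForm 0 1 x := by
    have := quadForm_rowMap 0 B hB x
    rwa [show shift m (0 : Matrix (Fin q) (Fin p) ℝ) = 0 from rfl, zero_add] at this
  have hdet : LinearMap.det (rowMap q m B) ≠ 0 := by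
    rw [det_rowMap]; exact pow_ne_zero _ hB.ne_zero
  ext x
  constructor
  · intro hx
    let e := LinearEquiv.ofIsUnitDet (f := rowMap q m B) (v := Module.finBasis ℝ _)
      (v' := Module.finBasis ℝ _) (by rw [LinearMap.det_toMatrix]; exact isUnit_iff_ne_zero.2 hdet)
    refine ⟨e.symm x, ?_, e.apply_symm_apply x⟩
    have : quadForm 0 (B * Bᵀ) (rowMap q m B (e.symm x)) = quadForm 0 (B * Bᵀ) x :=
      congrArg _ (e.apply_symm_apply x)
    rw [Set.mem_ofPred_eq, ← hq, this]
    exact hx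
  · rintro ⟨y, hy, rfl⟩
    rw [Set.mem_ofPred_eq, hq]
    exact hy

/-- The weight vanishes off a compact ellipsoid, so `g` need only be continuous there. -/
lemma integrable_weight_mul {Sig : Matrix (Fin p) (Fin p) ℝ} (hSig : Sig.PosDef) {k : ℝ → ℝ}
    (hk : Continuous k) (hk0 : ∀ s, 1 < s → k s = 0) {g : Sample q m p → ℝ}
    (hg : ContinuousOn g {x | quadForm 0 Sig x ≤ 1}) :
    Integrable fun x : Sample q m p => k (quadForm 0 Sig x) * g x := by
  have := isAddHaarMeasure_volume (q := q) (m := m) (p := p)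
  refine (integrableOn_iff_integrable_of_support_subset (s := {x | quadForm 0 Sig x ≤ 1})
    fun x hx => ?_).1 ?_
  · by_contra h
    exact hx (by simp only [hk0 _ (not_le.1 h), zero_mul])
  · exact ((hk.comp (continuous_quadForm 0 Sig)).continuousOn.mul hg).integrableOn_compact
      (isCompact_quadForm_le hSig)

lemma continuous_sample_snd :
    Continuous fun x : Sample q m p => (of x.2 : Matrix (Fin m) (Fin p) ℝ) := continuous_snd

lemma continuous_scatter : Continuous (scatter : Sample q m p → _) :=
  continuous_sample_snd.matrix_transpose.matrix_mul continuous_sample_snd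

lemma continuous_nzTrace (P : ℝ[X]) :
    Continuous fun x : Sample q m p => nzTrace m P (scatter x) :=
  (((Polynomial.continuous_aeval P).comp continuous_scatter).matrix_trace).sub continuous_const

lemma continuous_mul_aeval (P : ℝ[X]) (i : Fin m) (j : Fin p) :
    Continuous fun x : Sample q m p => (of x.2 * Polynomial.aeval (scatter x) P) i j :=
  (continuous_sample_snd.matrix_mul
    ((Polynomial.continuous_aeval P).comp continuous_scatter)).matrix_elem i j

lemma continuous_dAeval (P : ℝ[X]) (a : Fin m) (b : Fin p) :
    Continuous fun x : Sample q m p => dAeval P (scatter x) (dGram (of x.2) a b) := by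
  have h1 : Continuous fun x : Sample q m p => dGram (of x.2) a b :=
    (continuous_const.matrix_mul continuous_sample_snd).add
      (continuous_sample_snd.matrix_transpose.matrix_mul continuous_const)
  refine continuous_finsetSum _ fun k _ => ?_
  have h2 : Continuous fun x : Sample q m p => ∑ i ∈ Finset.range k,
      scatter x ^ i * dGram (of x.2) a b * scatter x ^ (k - 1 - i) :=
    continuous_finsetSum _ fun i _ =>
      ((continuous_scatter.pow i).matrix_mul h1).matrix_mul (continuous_scatter.pow _)
  exact h2.const_smul (P.coeff k)

lemma continuous_dMulAeval (P : ℝ[X]) (a : Fin m) (b : Fin p) :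
    Continuous fun x : Sample q m p => dMulAeval P (of x.2) a b a b :=
  ((continuous_const.matrix_mul ((Polynomial.continuous_aeval P).comp continuous_scatter)).add
    (continuous_sample_snd.matrix_mul (continuous_dAeval P a b))).matrix_elem a b

lemma continuousOn_haffField {s : Set (Sample q m p)} {b : ℝ} {P : ℝ[X]}
    (hT : ∀ x ∈ s, nzTrace m P (scatter x) ≠ 0) (i : Fin m) (j : Fin p) :
    ContinuousOn (fun x : Sample q m p => haffField b P (of x.2) i j) s := by
  have hc := (continuous_nzTrace (q := q) (m := m) P).continuousOn (s := s)
  exact ((continuousOn_const.div hc hT).mul (continuous_mul_aeval P i j).continuousOn).add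
    ((continuousOn_const.div (hc.pow 2) fun x hx => pow_ne_zero 2 (hT x hx)).mul
      (continuous_mul_aeval (P ^ 2) i j).continuousOn)

lemma continuousOn_dHaffField {s : Set (Sample q m p)} {b : ℝ} {P : ℝ[X]}
    (hT : ∀ x ∈ s, nzTrace m P (scatter x) ≠ 0) (i : Fin m) (j : Fin p) :
    ContinuousOn (fun x : Sample q m p => dHaffField b P (of x.2) i j) s := by
  have hc := (continuous_nzTrace (q := q) (m := m) P).continuousOn (s := s)
  have ht := (continuous_dAeval (q := q) P i j).matrix_trace.continuousOn (s := s)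
  have d (c : ℝ) (n : ℕ) : ContinuousOn (fun x => c / nzTrace m P (scatter x) ^ n) s :=
    continuousOn_const.div (hc.pow n) fun x hx => pow_ne_zero n (hT x hx)
  exact (((continuousOn_const.div hc hT).mul (continuous_dMulAeval P i j).continuousOn).sub
      ((d _ 2).mul ((continuous_mul_aeval P i j).continuousOn.mul ht))).add
    (((d _ 2).mul (continuous_dMulAeval (P ^ 2) i j).continuousOn).sub
      ((d _ 3).mul ((continuous_mul_aeval (P ^ 2) i j).continuousOn.mul ht)))

/-- The Stein identity for `haffField`. -/
theorem integral_weight_mul_haffField {Sig : Matrix (Fin p) (Fin p) ℝ} (hSig : Sig.PosDef)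
    {b : ℝ} {P : ℝ[X]}
    (hT : ∀ x : Sample q m p, quadForm 0 Sig x ≤ 1 → nzTrace m P (scatter x) ≠ 0) :
    ∫ x : Sample q m p, 4 * max (1 - quadForm 0 Sig x) 0
        * trace (Sig⁻¹ * ((of x.2)ᵀ * haffField b P (of x.2)))
      = ∫ x : Sample q m p, max (1 - quadForm 0 Sig x) 0 ^ 2
        * ∑ i, ∑ j, dHaffField b P (of x.2) i j := by
  have := isAddHaarMeasure_volume (q := q) (m := m) (p := p)
  set Q : Sample q m p → ℝ := quadForm 0 Sig with hQ
  have hQc : Continuous Q := continuous_quadForm 0 Sig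
  have hk2 : Continuous fun s : ℝ => max (1 - s) 0 ^ 2 := by fun_prop
  have hk1 : Continuous fun s : ℝ => -(2 * max (1 - s) 0) := by fun_prop
  have z (s : ℝ) (hs : 1 < s) : max (1 - s) 0 = 0 := max_eq_right (by linarith)
  have hUS (i : Fin m) (j : Fin p) : Continuous fun x : Sample q m p => (of x.2 * Sig⁻¹) i j :=
    (continuous_sample_snd.matrix_mul continuous_const).matrix_elem i j
  have I1 (i : Fin m) (j : Fin p) : Integrable fun x : Sample q m p =>
      max (1 - Q x) 0 ^ 2 * dHaffField b P (of x.2) i j :=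
    integrable_weight_mul hSig hk2 (fun s hs => by rw [z s hs]; simp)
      (continuousOn_dHaffField hT i j)
  have I2 (i : Fin m) (j : Fin p) : Integrable fun x : Sample q m p =>
      -(2 * max (1 - Q x) 0) * (2 * (of x.2 * Sig⁻¹) i j * haffField b P (of x.2) i j) :=
    integrable_weight_mul hSig hk1 (fun s hs => by rw [z s hs]; simp)
      ((continuous_const.mul (hUS i j)).continuousOn.mul (continuousOn_haffField hT i j))
  have I3 (i : Fin m) (j : Fin p) : Integrable fun x : Sample q m p =>
      max (1 - Q x) 0 ^ 2 * haffField b P (of x.2) i j :=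
    integrable_weight_mul hSig hk2 (fun s hs => by rw [z s hs]; simp)
      (continuousOn_haffField hT i j)
  have ibp (i : Fin m) (j : Fin p) :
      ∫ x : Sample q m p, max (1 - Q x) 0 ^ 2 * dHaffField b P (of x.2) i j
        = -∫ x : Sample q m p, -(2 * max (1 - Q x) 0)
          * (2 * (of x.2 * Sig⁻¹) i j * haffField b P (of x.2) i j) := by
    -- The line derivative of the field is required only on the closed support of the weight. That
    -- support lies in `Q ≤ 1`, where the normalizing trace does not vanish.
    have key := integral_bilinear_hasLineDerivAt_right_eq_neg_left_of_integrable
      (μ := (volume : Measure (Sample q m p))) (B := ContinuousLinearMap.mul ℝ ℝ)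
      (f := fun x => max (1 - Q x) 0 ^ 2)
      (f' := fun x => -(2 * max (1 - Q x) 0) * (2 * (of x.2 * Sig⁻¹) i j))
      (g := fun x => haffField b P (of x.2) i j) (g' := fun x => dHaffField b P (of x.2) i j)
      (v := coordDir q i j) ?_ (by simpa using I1 i j) (by simpa using I3 i j) ?_ ?_
    · simpa [mul_assoc] using key
    · simpa [mul_assoc] using I2 i j
    · intro x _
      have h := hasLineDerivAt_quadForm hSig x i j
      unfold HasLineDerivAt at h ⊢
      have h' := hasDerivAt_bump (Q (x + (0 : ℝ) • coordDir q i j))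
      have h2 : HasDerivAt (fun t : ℝ => max (1 - Q (x + t • coordDir q i j)) 0 ^ 2) _ 0 :=
        HasDerivAt.comp (h₂ := fun s : ℝ => max (1 - s) 0 ^ 2) (0 : ℝ) h' h
      exact h2.congr_deriv (by simp)
    · intro x hx
      refine hasLineDerivAt_haffField (hT x ?_) i j
      have hcl : IsClosed {x : Sample q m p | Q x ≤ 1} := isClosed_le hQc continuous_const
      refine closure_minimal (fun y hy => ?_) hcl hx
      by_contra h
      exact hy (by simp only [z _ (not_le.1 h)]; simp)
  have e1 (x : Sample q m p) : 4 * max (1 - Q x) 0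
        * trace (Sig⁻¹ * ((of x.2)ᵀ * haffField b P (of x.2)))
      = ∑ i, ∑ j, -(-(2 * max (1 - Q x) 0)
          * (2 * (of x.2 * Sig⁻¹) i j * haffField b P (of x.2) i j)) := by
    have hsymm : (Sig⁻¹)ᵀ = Sig⁻¹ := by
      have := hSig.isHermitian.inv
      rwa [IsHermitian, conjTranspose_eq_transpose_of_trivial] at this
    have : trace (Sig⁻¹ * ((of x.2)ᵀ * haffField b P (of x.2)))
        = ∑ i, ∑ j, (of x.2 * Sig⁻¹) i j * haffField b P (of x.2) i j := by
      rw [← Matrix.mul_assoc, ← hsymm, ← transpose_mul, hsymm, trace, Finset.sum_comm]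
      simp only [diag, mul_apply (M := (of x.2 * Sig⁻¹)ᵀ), transpose_apply]
    rw [this, Finset.mul_sum]
    refine Finset.sum_congr rfl fun i _ => ?_
    rw [Finset.mul_sum]
    exact Finset.sum_congr rfl fun j _ => by ring
  have I2' (i : Fin m) (j : Fin p) : Integrable fun x : Sample q m p =>
      -(-(2 * max (1 - Q x) 0) * (2 * (of x.2 * Sig⁻¹) i j * haffField b P (of x.2) i j)) :=
    (I2 i j).neg
  simp only [e1, Finset.mul_sum]
  rw [integral_finsetSum _ fun i _ => integrable_finsetSum _ fun j _ => I2' i j,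
    integral_finsetSum _ fun i _ => integrable_finsetSum _ fun j _ => I1 i j]
  refine Finset.sum_congr rfl fun i _ => ?_
  rw [integral_finsetSum _ fun j _ => I2' i j, integral_finsetSum _ fun j _ => I1 i j]
  exact Finset.sum_congr rfl fun j _ => by rw [ibp, ← integral_neg]

end IntegrationByParts

/-! ### The Stein inequality for the limit field -/

section SteinInequality

open Polynomial Filter Topology

variable {q m p : ℕ}

open Classical in
/-- `H L (2Ψ + Ψ²) Hᵀ`, and `0` where there is no eigenvalue decomposition. -/
def haffCore (α b : ℝ) (x : Sample q m p) : Matrix (Fin p) (Fin p) ℝ :=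
  if h : ∃ Hl : Matrix (Fin p) (Fin (min p m)) ℝ × (Fin (min p m) → ℝ),
      IsEigenDecomp (scatter x) Hl.1 Hl.2 then
    h.choose.1 * diagonal (fun i => h.choose.2 i *
      (2 * haffPsi α b h.choose.2 i + haffPsi α b h.choose.2 i ^ 2)) * h.choose.1ᵀ
  else 0

lemma haffCore_eq (α b : ℝ) {x : Sample q m p} {H : Matrix (Fin p) (Fin (min p m)) ℝ}
    {l : Fin (min p m) → ℝ} (h : IsEigenDecomp (scatter x) H l) :
    haffCore α b x
      = H * diagonal (fun i => l i * (2 * haffPsi α b l i + haffPsi α b l i ^ 2)) * Hᵀ := by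
  have hex : ∃ Hl : Matrix (Fin p) (Fin (min p m)) ℝ × (Fin (min p m) → ℝ),
      IsEigenDecomp (scatter x) Hl.1 Hl.2 := ⟨(H, l), h⟩
  rw [haffCore, dif_pos hex]
  have h' := hex.choose_spec
  have ht : ∑ j, hex.choose.2 j ^ (-α) = ∑ j, l j ^ (-α) := by
    rw [← h.trace_fun (fun j => l j ^ (-α)), ← h'.trace_fun (fun j => hex.choose.2 j ^ (-α)),
      h.fun_eq h' (fun t => t ^ (-α))]
  have e := h'.fun_eq h (fun t => t * (2 * (b * t ^ (-α) / ∑ j, l j ^ (-α))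
    + (b * t ^ (-α) / ∑ j, l j ^ (-α)) ^ 2))
  simpa only [haffPsi, ht] using e

lemma scatter_smul (s : ℝ) (x : Sample q m p) : scatter (s • x) = s ^ 2 • scatter x := by
  have h2 : (of (s • x).2 : Matrix (Fin m) (Fin p) ℝ) = s • of x.2 := rfl
  simp only [scatter, h2, transpose_smul, Matrix.smul_mul, Matrix.mul_smul, smul_smul, sq]

lemma haffPsi_smul (α b : ℝ) {r : ℕ} {s : ℝ} (hs : 0 < s) {l : Fin r → ℝ} (hl : ∀ i, 0 < l i)
    (i : Fin r) : haffPsi α b (fun i => s * l i) i = haffPsi α b l i := by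
  have e (j) : (s * l j) ^ (-α) = s ^ (-α) * l j ^ (-α) := Real.mul_rpow hs.le (hl j).le
  have hs' : s ^ (-α) ≠ 0 := (Real.rpow_pos_of_pos hs _).ne'
  simp only [haffPsi, e, ← Finset.mul_sum]
  rw [mul_left_comm, mul_div_mul_left _ _ hs']

/-- `Ψ` is invariant under scaling of `L`, so the field inherits degree two from `S`; this is the
homogeneity used in the radial argument. -/
lemma haffCore_smul (α b : ℝ) {x : Sample q m p} {H : Matrix (Fin p) (Fin (min p m)) ℝ}
    {l : Fin (min p m) → ℝ} (h : IsEigenDecomp (scatter x) H l) {s : ℝ} (hs : 0 < s) :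
    haffCore α b (s • x) = s ^ 2 • haffCore α b x := by
  have hs2 : 0 < s ^ 2 := by positivity
  have h' : IsEigenDecomp (scatter (s • x)) H (fun i => s ^ 2 * l i) := by
    refine ⟨h.semiorthogonal, fun i j hij => mul_lt_mul_of_pos_left (h.strictAnti hij) hs2,
      fun i => mul_pos hs2 (h.pos i), ?_⟩
    have : (diagonal fun i => s ^ 2 * l i) = s ^ 2 • diagonal l := by
      rw [← diagonal_smul]; rfl
    rw [scatter_smul, this, Matrix.mul_smul, Matrix.smul_mul, ← h.eq]
  rw [haffCore_eq α b h', haffCore_eq α b h, ← Matrix.smul_mul, ← Matrix.mul_smul,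
    ← diagonal_smul]
  simp only [haffPsi_smul α b hs2 h.pos]
  congr 3
  ext i
  simp only [Pi.smul_apply, smul_eq_mul]
  ring

lemma trace_mul_conj_diagonal {r : ℕ} (A : Matrix (Fin p) (Fin p) ℝ)
    (H : Matrix (Fin p) (Fin r) ℝ) (d : Fin r → ℝ) :
    trace (A * (H * diagonal d * Hᵀ)) = ∑ i, d i * (Hᵀ * A * H) i i := by
  rw [← Matrix.mul_assoc, ← Matrix.mul_assoc, trace_mul_comm, ← Matrix.mul_assoc,
    ← Matrix.mul_assoc, trace]
  refine Finset.sum_congr rfl fun i _ => ?_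
  rw [diag_apply, mul_diagonal, mul_comm]

lemma conj_diag_nonneg {r : ℕ} {A : Matrix (Fin p) (Fin p) ℝ} (hA : A.PosSemidef)
    (H : Matrix (Fin p) (Fin r) ℝ) (i : Fin r) : 0 ≤ (Hᵀ * A * H) i i := by
  have := hA.conjTranspose_mul_mul_same H
  rw [conjTranspose_eq_transpose_of_trivial] at this
  exact this.diag_nonneg

lemma IsEigenDecomp.le_trace {r : ℕ} {S : Matrix (Fin p) (Fin p) ℝ}
    {H : Matrix (Fin p) (Fin r) ℝ} {l : Fin r → ℝ} (h : IsEigenDecomp S H l) (i : Fin r) :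
    l i ≤ trace S := by
  have e : trace S = ∑ i, l i := by rw [h.eq, h.trace_fun]
  rw [e]
  exact Finset.single_le_sum (fun j _ => (h.pos j).le) (Finset.mem_univ i)

/-- `ψ = b P / ∑ P`. -/
def ratio (b : ℝ) {r : ℕ} (φ : Fin r → ℝ) (i : Fin r) : ℝ := b * φ i / ∑ j, φ j

lemma ratio_mem {b : ℝ} (hb : 0 ≤ b) {r : ℕ} {φ : Fin r → ℝ} (hφ : ∀ i, 0 < φ i) (i : Fin r) :
    0 ≤ ratio b φ i ∧ ratio b φ i ≤ b := by
  have hle : φ i ≤ ∑ j, φ j := Finset.single_le_sum (fun j _ => (hφ j).le) (Finset.mem_univ i)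
  have hT := (hφ i).trans_le hle
  refine ⟨div_nonneg (mul_nonneg hb (hφ i).le) hT.le, ?_⟩
  rw [ratio, div_le_iff₀ hT]
  exact mul_le_mul_of_nonneg_left hle hb

lemma IsEigenDecomp.transpose_mul_haffField (b : ℝ) (P : ℝ[X]) {U : Matrix (Fin m) (Fin p) ℝ}
    {H : Matrix (Fin p) (Fin (min p m)) ℝ} {l : Fin (min p m) → ℝ}
    (h : IsEigenDecomp (Uᵀ * U) H l) :
    Uᵀ * haffField b P U = H * diagonal (fun i => l i *
      (2 * ratio b (fun i => P.eval (l i)) i + ratio b (fun i => P.eval (l i)) i ^ 2)) * Hᵀ := by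
  have e (P : ℝ[X]) : Uᵀ * (U * Polynomial.aeval (Uᵀ * U) P)
      = H * diagonal (fun i => l i * P.eval (l i)) * Hᵀ := by
    rw [← h.aeval, map_mul, Polynomial.aeval_X, ← Matrix.mul_assoc]
  rw [haffField, Matrix.mul_add, Matrix.mul_smul, Matrix.mul_smul, e, e, h.nzTrace_eq,
    ← Matrix.smul_mul _ _ Hᵀ, ← Matrix.smul_mul _ _ Hᵀ, ← Matrix.mul_smul H, ← Matrix.mul_smul H,
    ← Matrix.add_mul,
    ← Matrix.mul_add, ← diagonal_smul, ← diagonal_smul, diagonal_add]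
  congr 3
  ext i
  simp only [Pi.smul_apply, smul_eq_mul, eval_pow, ratio]
  ring

/-- By the mean value theorem at some `z` between `x` and `y`: `x (-P'(z)) ≤ z (-P'(z)) ≤ α P(z) ≤ α
P(x)`. -/
lemma powTaylor_antitone {α c : ℝ} (hα : 0 < α) (hc : 0 < c) (n : ℕ) {x y : ℝ}
    (hxy : x < y) (hy : y ≤ c) :
    (powTaylor α c n).eval y ≤ (powTaylor α c n).eval x ∧
      x * ((powTaylor α c n).eval x - (powTaylor α c n).eval y)
        ≤ α * (powTaylor α c n).eval x * (y - x) := by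
  set P := powTaylor α c n with hP
  have hle (z w : ℝ) (hzw : z ≤ w) (hw : w ≤ c) : P.eval w ≤ P.eval z := by
    have : AntitoneOn (fun t => P.eval t) (Set.Iic c) := by
      refine antitoneOn_of_deriv_nonpos (convex_Iic c) P.continuousOn
        P.differentiable.differentiableOn fun t ht => ?_
      rw [Polynomial.deriv]
      rw [interior_Iic] at ht
      exact derivative_powTaylor_nonpos hα hc n (le_of_lt ht)
    exact this (hzw.trans hw) hw hzw
  refine ⟨hle x y hxy.le hy, ?_⟩
  obtain ⟨z, hz, hze⟩ := exists_hasDerivAt_eq_slope (fun t => P.eval t)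
    (fun t => P.derivative.eval t) hxy P.continuousOn fun t _ => P.hasDerivAt t
  have hd := sub_pos.2 hxy
  rw [eq_div_iff hd.ne'] at hze
  have h1 := neg_mul_derivative_powTaylor_le hα hc n (hz.2.le.trans hy)
  have h2 := derivative_powTaylor_nonpos hα hc n (hz.2.le.trans hy)
  have h3 := hle x z hz.1.le (hz.2.le.trans hy)
  rw [← hP] at h1 h2
  have h4 : x * -(P.derivative.eval z) ≤ α * P.eval x :=
    calc x * -(P.derivative.eval z) ≤ z * -(P.derivative.eval z) :=
          mul_le_mul_of_nonneg_right hz.1.le (by linarith)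
      _ ≤ α * P.eval z := by linarith
      _ ≤ _ := by gcongr
  calc x * (P.eval x - P.eval y) = x * -(P.derivative.eval z) * (y - x) := by
        rw [mul_assoc, neg_mul, hze]; ring
    _ ≤ _ := mul_le_mul_of_nonneg_right h4 hd.le

lemma trace_inv_mul_scatter_le {Sig : Matrix (Fin p) (Fin p) ℝ} (hSig : Sig.PosDef)
    (x : Sample q m p) :
    0 ≤ trace (Sig⁻¹ * scatter x) ∧ trace (Sig⁻¹ * scatter x) ≤ quadForm 0 Sig x := by
  have h (k : ℕ) (y : Matrix (Fin k) (Fin p) ℝ) : 0 ≤ trace (y * Sig⁻¹ * yᵀ) := by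
    have := hSig.inv.posSemidef.mul_mul_conjTranspose_same y
    rw [conjTranspose_eq_transpose_of_trivial] at this
    exact this.trace_nonneg
  have e : trace (Sig⁻¹ * scatter x) = trace (of x.2 * Sig⁻¹ * (of x.2)ᵀ) := by
    rw [scatter, trace_mul_comm (of x.2 * Sig⁻¹), ← Matrix.mul_assoc (of x.2)ᵀ,
      trace_mul_comm _ Sig⁻¹]
  rw [quadForm_eq_trace]
  exact ⟨e ▸ h _ _, by linarith [h _ (of x.1)]⟩

lemma quadForm_nonneg {Sig : Matrix (Fin p) (Fin p) ℝ} (hSig : Sig.PosDef) (x : Sample q m p) :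
    0 ≤ quadForm 0 Sig x :=
  (trace_inv_mul_scatter_le hSig x).1.trans (trace_inv_mul_scatter_le hSig x).2

/-- Each trace is linear in the diagonal matrix, with the nonnegative diagonal entries of `Hᵀ A H`
as weights, so diagonals may be compared entrywise. -/
lemma trace_conj_bounds {r : ℕ} {A S : Matrix (Fin p) (Fin p) ℝ} (hA : A.PosSemidef)
    {H : Matrix (Fin p) (Fin r) ℝ} {l : Fin r → ℝ} (h : IsEigenDecomp S H l) {b : ℝ}
    {ψ : Fin r → ℝ} (hψ : ∀ i, 0 ≤ ψ i ∧ ψ i ≤ b) :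
    0 ≤ trace (A * (H * diagonal (fun i => l i * (2 * ψ i + ψ i ^ 2)) * Hᵀ)) ∧
      trace (A * (H * diagonal (fun i => l i * (2 * ψ i + ψ i ^ 2)) * Hᵀ))
        ≤ (2 * b + b ^ 2) * trace (A * S) := by
  have hw (i) := conj_diag_nonneg hA H i
  rw [h.eq, trace_mul_conj_diagonal, trace_mul_conj_diagonal, Finset.mul_sum]
  refine ⟨Finset.sum_nonneg fun i _ => ?_, Finset.sum_le_sum fun i _ => ?_⟩
  · have := h.pos i; have := (hψ i).1; have := hw i; positivity
  · have h1 : 2 * ψ i + ψ i ^ 2 ≤ 2 * b + b ^ 2 := by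
      have := pow_le_pow_left₀ (hψ i).1 (hψ i).2 2
      linarith [(hψ i).2]
    calc l i * (2 * ψ i + ψ i ^ 2) * (Hᵀ * A * H) i i
        ≤ l i * (2 * b + b ^ 2) * (Hᵀ * A * H) i i :=
          mul_le_mul_of_nonneg_right (mul_le_mul_of_nonneg_left h1 (h.pos i).le) (hw i)
      _ = _ := by ring

lemma haffCore_trace_nonneg {Sig : Matrix (Fin p) (Fin p) ℝ} (hSig : Sig.PosDef) {α b : ℝ}
    (hb : 0 ≤ b) (x : Sample q m p) : 0 ≤ trace (Sig⁻¹ * haffCore α b x) := by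
  by_cases hx : ∃ Hl : Matrix (Fin p) (Fin (min p m)) ℝ × (Fin (min p m) → ℝ),
      IsEigenDecomp (scatter x) Hl.1 Hl.2
  · rw [haffCore_eq α b hx.choose_spec]
    exact (trace_conj_bounds hSig.inv.posSemidef hx.choose_spec fun i =>
      ratio_mem hb (φ := fun i => hx.choose.2 i ^ (-α))
        (fun i => Real.rpow_pos_of_pos (hx.choose_spec.pos i) _) i).1
  · rw [haffCore, dif_neg hx]; simp

/-- The integrated Stein inequality for the weight `(1 - quadForm)₊²`. -/
theorem integral_haffCore_lt {Sig : Matrix (Fin p) (Fin p) ℝ} (hSig : Sig.PosDef) {α b : ℝ}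
    (hr : 2 ≤ min p m) (hα : 1 ≤ α) (hb : 0 < b)
    (hb' : b ≤ 2 * (((min p m : ℕ) : ℝ) - 1) /
      (((max p m : ℕ) : ℝ) - ((min p m : ℕ) : ℝ) + 1)) :
    (Integrable fun x : Sample q m p =>
      4 * max (1 - quadForm 0 Sig x) 0 * trace (Sig⁻¹ * haffCore α b x)) ∧
    (Integrable fun x : Sample q m p => max (1 - quadForm 0 Sig x) 0 ^ 2) ∧
    ∫ x : Sample q m p, 4 * max (1 - quadForm 0 Sig x) 0 * trace (Sig⁻¹ * haffCore α b x)
      < 2 * b * (max p m : ℕ) * ∫ x : Sample q m p, max (1 - quadForm 0 Sig x) 0 ^ 2 := by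
  have := isAddHaarMeasure_volume (q := q) (m := m) (p := p)
  have hα0 : 0 < α := by linarith
  set Q : Sample q m p → ℝ := quadForm 0 Sig with hQ
  have hQc : Continuous Q := continuous_quadForm 0 Sig
  have z (s : ℝ) (hs : 1 < s) : max (1 - s) 0 = 0 := max_eq_right (by linarith)
  -- Each eigenvalue is at most the trace, so this `c` exceeds all eigenvalues met on the ellipsoid
  -- and serves as the expansion point.
  obtain ⟨c, hc, hcK⟩ : ∃ c : ℝ, 0 < c ∧ ∀ x : Sample q m p, Q x ≤ 1 → trace (scatter x) < c := by
    obtain ⟨C, hC⟩ := (isCompact_quadForm_le (q := q) (m := m) hSig).bddAbove_image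
      continuous_scatter.matrix_trace.continuousOn
    refine ⟨max C 0 + 1, by positivity, fun x hx => ?_⟩
    have := hC ⟨x, hx, rfl⟩
    linarith [le_max_left C 0]
  have hae := ae_exists_isEigenDecomp (q := q) (m := m) (p := p)
  -- Where a decomposition exists, the trace is at least `c ^ (-α)`. Such points are dense, and the
  -- closed condition extends to the rank-deficient points, where the Stein identity also needs it.
  have hT0 (n : ℕ) (x : Sample q m p) (hx : Q x ≤ 1) :
      nzTrace m (powTaylor α c n) (scatter x) ≠ 0 := by
    have hd := Measure.dense_of_ae hae
    have hO : IsOpen {x : Sample q m p | trace (scatter x) < c} :=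
      isOpen_lt continuous_scatter.matrix_trace continuous_const
    have hcl : IsClosed {x : Sample q m p |
        c ^ (-α) ≤ nzTrace m (powTaylor α c n) (scatter x)} :=
      isClosed_le continuous_const (continuous_nzTrace _)
    have hsub := (hd.open_subset_closure_inter hO).trans (closure_minimal (t :=
      {x : Sample q m p | c ^ (-α) ≤ nzTrace m (powTaylor α c n) (scatter x)}) ?_ hcl)
    · exact ((Real.rpow_pos_of_pos hc (-α)).trans_le (hsub (hcK x hx))).ne'
    · rintro y ⟨hy, ⟨⟨H, l⟩, hl⟩⟩
      rw [Set.mem_ofPred_eq, hl.nzTrace_eq]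
      have hle (i) : l i ≤ c := (hl.le_trace i).trans (le_of_lt hy)
      exact (rpow_le_eval_powTaylor hα0 hc n (hle ⟨0, by omega⟩)).trans
        (Finset.single_le_sum (f := fun i => (powTaylor α c n).eval (l i))
          (fun i _ => (eval_powTaylor_pos hα0 hc n (hle i)).le) (Finset.mem_univ _))
  classical
  let D : Sample q m p → ℝ := fun x =>
    if h : ∃ Hl : Matrix (Fin p) (Fin (min p m)) ℝ × (Fin (min p m) → ℝ),
      IsEigenDecomp (scatter x) Hl.1 Hl.2 then
    haffDiv (max p m : ℕ) b h.choose.2 (fun i => h.choose.2 i ^ (-α))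
      (fun i => -α * h.choose.2 i ^ (-α - 1)) else 0
  let F (n : ℕ) (x : Sample q m p) : ℝ := 4 * max (1 - Q x) 0
    * trace (Sig⁻¹ * ((of x.2)ᵀ * haffField b (powTaylor α c n) (of x.2)))
  let G (n : ℕ) (x : Sample q m p) : ℝ := max (1 - Q x) 0 ^ 2
    * ∑ i, ∑ j, dHaffField b (powTaylor α c n) (of x.2) i j
  have hFG (n) : ∫ x, F n x = ∫ x, G n x := integral_weight_mul_haffField hSig (hT0 n)
  have hk1 : Continuous fun s : ℝ => 4 * max (1 - s) 0 := by fun_prop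
  have hk2 : Continuous fun s : ℝ => max (1 - s) 0 ^ 2 := by fun_prop
  have hFi (n) : Integrable (F n) := by
    refine integrable_weight_mul hSig hk1 (fun s hs => by rw [z s hs, mul_zero]) ?_
    simp only [trace, diag, mul_apply, transpose_apply]
    refine continuousOn_finsetSum _ fun i _ => continuousOn_finsetSum _ fun j _ =>
      continuousOn_const.mul (continuousOn_finsetSum _ fun k _ =>
        (continuous_sample_snd.matrix_elem k j).continuousOn.mul
          (continuousOn_haffField (hT0 n) k i))
  have hGi (n) : Integrable (G n) :=
    integrable_weight_mul hSig hk2 (fun s hs => by rw [z s hs]; simp)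
      (continuousOn_finsetSum _ fun i _ => continuousOn_finsetSum _ fun j _ =>
        continuousOn_dHaffField (hT0 n) i j)
  let bF (x : Sample q m p) : ℝ := 4 * max (1 - Q x) 0 * ((2 * b + b ^ 2) * Q x)
  have hbF : Integrable bF :=
    integrable_weight_mul hSig hk1 (fun s hs => by rw [z s hs, mul_zero])
      (continuous_const.mul hQc).continuousOn
  -- The constant is uniform in `n` because the Taylor polynomials satisfy the hypotheses of
  -- `abs_haffDiv_le` with `C = α`.
  let bG (x : Sample q m p) : ℝ :=
    max (1 - Q x) 0 ^ 2 * haffBound (min p m) (max p m : ℕ) b α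
  have hbG : Integrable bG :=
    integrable_weight_mul hSig hk2 (fun s hs => by rw [z s hs]; simp) continuousOn_const
  have hW : Integrable fun x : Sample q m p => max (1 - Q x) 0 ^ 2 := by
    simpa using integrable_weight_mul (q := q) (m := m) hSig hk2
      (fun s hs => by rw [z s hs]; simp) (g := fun _ => 1) continuousOn_const
  have hFle (n) : ∀ᵐ x, ‖F n x‖ ≤ bF x := by
    filter_upwards [hae] with x hx
    by_cases hx1 : Q x ≤ 1
    · obtain ⟨⟨H, l⟩, hl⟩ := hx
      have hle (i) : l i ≤ c := (hl.le_trace i).trans (hcK x hx1).le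
      obtain ⟨h1, h2⟩ := trace_conj_bounds hSig.inv.posSemidef hl fun i =>
        ratio_mem hb.le (fun i => eval_powTaylor_pos hα0 hc n (hle i)) i
      have hm : 0 ≤ 4 * max (1 - Q x) 0 := by positivity
      simp only [F, bF]
      rw [hl.transpose_mul_haffField, Real.norm_eq_abs, abs_of_nonneg (mul_nonneg hm h1)]
      refine mul_le_mul_of_nonneg_left (h2.trans ?_) hm
      exact mul_le_mul_of_nonneg_left (trace_inv_mul_scatter_le hSig x).2 (by positivity)
    · simp [F, bF, z _ (not_le.1 hx1)]
  have hGle (n) : ∀ᵐ x, ‖G n x‖ ≤ bG x := by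
    filter_upwards [hae] with x hx
    by_cases hx1 : Q x ≤ 1
    · obtain ⟨⟨H, l⟩, hl⟩ := hx
      have hle (i) : l i ≤ c := (hl.le_trace i).trans (hcK x hx1).le
      have hpos (i) := eval_powTaylor_pos hα0 hc n (hle i)
      have hm : 0 ≤ max (1 - Q x) 0 ^ 2 := by positivity
      simp only [G, bG]
      rw [hl.sum_dHaffField, norm_mul, Real.norm_eq_abs, Real.norm_eq_abs, abs_of_nonneg hm]
      refine mul_le_mul_of_nonneg_left ?_ hm
      refine abs_haffDiv_le (by positivity) hb.le hα0.le hl.pos hpos (fun i => ?_)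
        (fun i j hij => powTaylor_antitone hα0 hc n hij (hle j))
        (Finset.sum_pos (fun i _ => hpos i) ⟨⟨0, by omega⟩, Finset.mem_univ _⟩)
      rw [abs_of_nonpos (mul_nonpos_of_nonneg_of_nonpos (hl.pos i).le
        (derivative_powTaylor_nonpos hα0 hc n (hle i)))]
      exact neg_mul_derivative_powTaylor_le hα0 hc n (hle i)
    · simp [G, bG, z _ (not_le.1 hx1)]
  have hFt : ∀ᵐ x, Tendsto (fun n => F n x) atTop
      (𝓝 (4 * max (1 - Q x) 0 * trace (Sig⁻¹ * haffCore α b x))) := by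
    filter_upwards [hae] with x hx
    by_cases hx1 : Q x ≤ 1
    · obtain ⟨⟨H, l⟩, hl⟩ := hx
      have hle (i) : l i ≤ c := (hl.le_trace i).trans (hcK x hx1).le
      refine Tendsto.const_mul _ ?_
      have ht (i) := tendsto_eval_powTaylor (α := α) hc (hl.pos i) (hle i)
      have hS : ∑ i, l i ^ (-α) ≠ 0 := (Finset.sum_pos
        (fun i _ => Real.rpow_pos_of_pos (hl.pos i) _) ⟨⟨0, by omega⟩, Finset.mem_univ _⟩).ne'
      have hrt (i) : Tendsto (fun n => ratio b (fun i => (powTaylor α c n).eval (l i)) i) atTop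
          (𝓝 (haffPsi α b l i)) :=
        ((ht i).const_mul b).div (tendsto_finsetSum _ fun j _ => ht j) hS
      rw [haffCore_eq α b hl, trace_mul_conj_diagonal]
      have e (n) := (congrArg (fun M => trace (Sig⁻¹ * M))
        (hl.transpose_mul_haffField b (powTaylor α c n))).trans (trace_mul_conj_diagonal _ _ _)
      refine Tendsto.congr (fun n => (e n).symm) ?_
      exact tendsto_finsetSum _ fun i _ =>
        ((((hrt i).const_mul 2).add ((hrt i).pow 2)).const_mul (l i)).mul_const _
    · simp [F, z _ (not_le.1 hx1)]
  have hGt : ∀ᵐ x, Tendsto (fun n => G n x) atTop (𝓝 (max (1 - Q x) 0 ^ 2 * D x)) := by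
    filter_upwards [hae] with x hx
    by_cases hx1 : Q x ≤ 1
    · refine Tendsto.const_mul _ ?_
      simp only [D]
      rw [dif_pos hx]
      have hl := hx.choose_spec
      have hle (i) : hx.choose.2 i ≤ c := (hl.le_trace i).trans (hcK x hx1).le
      have hS : ∑ i, hx.choose.2 i ^ (-α) ≠ 0 := (Finset.sum_pos
        (fun i _ => Real.rpow_pos_of_pos (hl.pos i) _) ⟨⟨0, by omega⟩, Finset.mem_univ _⟩).ne'
      have e (n) : ∑ i, ∑ j, dHaffField b (powTaylor α c n) (of x.2) i j = _ :=
        hl.sum_dHaffField b (powTaylor α c n)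
      simp only [e]
      exact tendsto_haffDiv _ _ _
        (fun i => tendsto_eval_powTaylor (α := α) hc (hl.pos i) (hle i))
        (fun i => tendsto_derivative_powTaylor (α := α) hc (hl.pos i) (hle i)) hS
    · simp [G, z _ (not_le.1 hx1)]
  have hLF := tendsto_integral_of_dominated_convergence bF
    (fun n => (hFi n).aestronglyMeasurable) hbF hFle hFt
  have hLG := tendsto_integral_of_dominated_convergence bG
    (fun n => (hGi n).aestronglyMeasurable) hbG hGle hGt
  simp only [hFG] at hLF
  have hLim := tendsto_nhds_unique hLF hLG
  have hFint : Integrable fun x : Sample q m p =>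
      4 * max (1 - Q x) 0 * trace (Sig⁻¹ * haffCore α b x) := by
    refine hbF.mono' (aestronglyMeasurable_of_tendsto_ae _
      (fun n => (hFi n).aestronglyMeasurable) hFt) ?_
    filter_upwards [hFt, ae_all_iff.2 hFle] with x hx hx'
    exact le_of_tendsto' hx.norm hx'
  have hGint : Integrable fun x : Sample q m p => max (1 - Q x) 0 ^ 2 * D x := by
    refine hbG.mono' (aestronglyMeasurable_of_tendsto_ae _
      (fun n => (hGi n).aestronglyMeasurable) hGt) ?_
    filter_upwards [hGt, ae_all_iff.2 hGle] with x hx hx'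
    exact le_of_tendsto' hx.norm hx'
  have hv : ((min p m : ℕ) : ℝ) ≤ (max p m : ℕ) := by exact_mod_cast min_le_max
  have hDlt : ∀ᵐ x, D x < 2 * b * (max p m : ℕ) := by
    filter_upwards [hae] with x hx
    simp only [D]
    rw [dif_pos hx]
    exact haffDiv_rpow_lt hr hα hb hv hb' hx.choose_spec.pos hx.choose_spec.strictAnti.injective
  refine ⟨hFint, hW, ?_⟩
  -- The difference of the integrands is positive almost everywhere on `Q < 1`, an open set of
  -- positive measure.
  rw [hLim, ← integral_const_mul, ← sub_pos, ← integral_sub (hW.const_mul _) hGint,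
    integral_pos_iff_support_of_nonneg_ae]
  · have hO : IsOpen {x : Sample q m p | Q x < 1} := isOpen_lt hQc continuous_const
    have hpos : 0 < (volume : Measure (Sample q m p)) {x | Q x < 1} :=
      hO.measure_pos volume ⟨0, by
        have : Q 0 = 0 := by simpa using quadForm_smul Sig (0 : ℝ) (0 : Sample q m p)
        rw [Set.mem_ofPred_eq, this]; exact one_pos⟩
    refine hpos.trans_le (measure_mono_ae ?_)
    filter_upwards [hDlt] with x hx hx1
    have h1 : 0 < max (1 - Q x) 0 ^ 2 := by
      have : 0 < max (1 - Q x) 0 := lt_max_of_lt_left (sub_pos.2 hx1)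
      positivity
    have : 0 < 2 * b * (max p m : ℕ) * max (1 - Q x) 0 ^ 2 - max (1 - Q x) 0 ^ 2 * D x := by
      nlinarith
    exact this.ne'
  · filter_upwards [hDlt] with x hx
    have h1 : 0 ≤ max (1 - Q x) 0 ^ 2 := by positivity
    simp only [Pi.zero_apply]
    nlinarith
  · exact (hW.const_mul _).sub hGint

end SteinInequality

/-! ### Radial disintegration of homogeneous functions -/

section Homogeneous

open Filter Topology

lemma measure_eq_of_Iic {μ ν : Measure ℝ} (h : ∀ a, μ (Set.Iic a) = ν (Set.Iic a))
    (hfin : ∀ a, μ (Set.Iic a) ≠ ∞) : μ = ν := by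
  refine Measure.ext_of_generateFrom_of_iUnion (Set.range Set.Iic) (fun n : ℕ => Set.Iic (n : ℝ))
    ?_ ?_ ?_ (fun n => ⟨n, rfl⟩) (fun n => hfin n) ?_
  · rw [← borel_eq_generateFrom_Iic]; exact BorelSpace.measurable_eq
  · rintro _ ⟨a, rfl⟩ _ ⟨b, rfl⟩ _
    exact ⟨min a b, Set.Iic_inter_Iic.symm⟩
  · exact Set.iUnion_eq_univ_iff.2 fun x => exists_nat_ge x
  · rintro _ ⟨a, rfl⟩
    exact h a

/-- Tonelli: integrating the tail of `f` over `x` counts each `t` with weight `μ {Q < t}`. -/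
lemma lintegral_Fstar_comp {E : Type*} [MeasurableSpace E] (μ : Measure E) [SFinite μ] {Q : E → ℝ} (hQm : Measurable Q)
    {f : ℝ → ℝ} (hf : Measurable f) :
    ∫⁻ x, Fstar f (Q x) ∂μ = 2⁻¹ * ∫⁻ t, ENNReal.ofReal (f t) * μ {x | Q x < t} := by
  simp only [Fstar]
  rw [lintegral_const_mul' _ _ (by simp)]
  congr 1
  have h1 (x : E) : ∫⁻ v in Set.Ioi (Q x), ENNReal.ofReal (f v)
      = ∫⁻ v, {y : E × ℝ | Q y.1 < y.2}.indicator (fun y => ENNReal.ofReal (f y.2)) (x, v) := by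
    rw [← lintegral_indicator measurableSet_Ioi]; rfl
  have hm : MeasurableSet {y : E × ℝ | Q y.1 < y.2} :=
    measurableSet_lt (hQm.comp measurable_fst) measurable_snd
  have hmi : Measurable ({y : E × ℝ | Q y.1 < y.2}.indicator fun y => ENNReal.ofReal (f y.2)) :=
    ((hf.comp measurable_snd).ennreal_ofReal).indicator hm
  simp only [h1]
  rw [lintegral_lintegral_swap (f := fun x v =>
    {y : E × ℝ | Q y.1 < y.2}.indicator (fun y => ENNReal.ofReal (f y.2)) (x, v)) hmi.aemeasurable]
  refine lintegral_congr fun t => ?_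
  have h2 (x : E) : {y : E × ℝ | Q y.1 < y.2}.indicator (fun y => ENNReal.ofReal (f y.2)) (x, t)
      = {x | Q x < t}.indicator (fun _ => ENNReal.ofReal (f t)) x := rfl
  simp only [h2]
  rw [lintegral_indicator (show MeasurableSet {x | Q x < t} from hQm measurableSet_Iio),
    lintegral_const, Measure.restrict_apply_univ]

variable {E : Type*} [NormedAddCommGroup E] [NormedSpace ℝ E] [FiniteDimensional ℝ E]
  [MeasurableSpace E] [BorelSpace E]

lemma lintegral_eq_smul_lintegral_comp_smul (μ : Measure E) [μ.IsAddHaarMeasure] (g : E → ℝ≥0∞)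
    {s : ℝ} (hs : 0 < s) :
    ∫⁻ x, g x ∂μ = ENNReal.ofReal (s ^ Module.finrank ℝ E) * ∫⁻ x, g (s • x) ∂μ := by
  have h1 : ∫⁻ x, g (s • x) ∂μ = ∫⁻ x, g x ∂(Measure.map (s • ·) μ) :=
    ((Homeomorph.smulOfNeZero s hs.ne').measurableEmbedding.lintegral_map g).symm
  have hp : 0 < s ^ Module.finrank ℝ E := pow_pos hs _
  rw [h1, Measure.map_addHaar_smul μ hs.ne', lintegral_smul_measure, smul_eq_mul, ← mul_assoc,
    ← ENNReal.ofReal_mul hp.le, abs_of_pos (inv_pos.2 hp), mul_inv_cancel₀ hp.ne',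
    ENNReal.ofReal_one, one_mul]

lemma setLIntegral_le_smul (μ : Measure E) [μ.IsAddHaarMeasure] {Q : E → ℝ} (hQm : Measurable Q)
    (hQ : ∀ (s : ℝ) x, Q (s • x) = s ^ 2 * Q x) {h : E → ℝ≥0∞} {k : ℕ}
    (hom : ∀ s : ℝ, 0 < s → ∀ᵐ x ∂μ, h (s • x) = ENNReal.ofReal (s ^ k) * h x)
    {s : ℝ} (hs : 0 < s) :
    ∫⁻ x in {x | Q x ≤ s ^ 2}, h x ∂μ
      = ENNReal.ofReal (s ^ (Module.finrank ℝ E + k)) * ∫⁻ x in {x | Q x ≤ 1}, h x ∂μ := by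
  have hm (a : ℝ) : MeasurableSet {x | Q x ≤ a} := hQm measurableSet_Iic
  rw [← lintegral_indicator (hm _), ← lintegral_indicator (hm _),
    lintegral_eq_smul_lintegral_comp_smul μ _ hs, pow_add, ENNReal.ofReal_mul (by positivity),
    mul_assoc, ← lintegral_const_mul' (ENNReal.ofReal (s ^ k)) _ ENNReal.ofReal_ne_top]
  congr 1
  refine lintegral_congr_ae ?_
  filter_upwards [hom s hs] with x hx
  have : Q (s • x) ≤ s ^ 2 ↔ Q x ≤ 1 := by
    rw [hQ]; exact mul_le_iff_le_one_right (by positivity)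
  by_cases h1 : Q x ≤ 1
  · rw [Set.indicator_of_mem (show s • x ∈ {x | Q x ≤ s ^ 2} from this.2 h1),
      Set.indicator_of_mem (show x ∈ {x | Q x ≤ 1} from h1), hx]
  · rw [Set.indicator_of_notMem (show s • x ∉ {x | Q x ≤ s ^ 2} from fun h => h1 (this.1 h)),
      Set.indicator_of_notMem (show x ∉ {x | Q x ≤ 1} from h1), mul_zero]

/-- Letting `s → 0`. It shows that the two radial measures below do not charge `(-∞, 0]`. -/
lemma eq_zero_of_forall_le_pow {y M : ℝ≥0∞} (hM : M ≠ ∞) {n : ℕ} (hn : n ≠ 0)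
    (h : ∀ s : ℝ, 0 < s → y ≤ ENNReal.ofReal (s ^ n) * M) : y = 0 := by
  have h1 : Tendsto (fun s : ℝ => ENNReal.ofReal (s ^ n) * M) (𝓝[>] 0) (𝓝 0) := by
    have h2 : Tendsto (fun s : ℝ => ENNReal.ofReal (s ^ n)) (𝓝[>] 0) (𝓝 0) := by
      have : Continuous fun s : ℝ => ENNReal.ofReal (s ^ n) :=
        ENNReal.continuous_ofReal.comp (continuous_pow n)
      simpa [hn] using (this.tendsto 0).mono_left nhdsWithin_le_nhds
    simpa using ENNReal.Tendsto.mul_const h2 (Or.inr hM)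
  refine le_antisymm (ge_of_tendsto h1 ?_) zero_le
  filter_upwards [self_mem_nhdsWithin] with s hs using h s hs

/-- The radial integral of a function that is homogeneous of degree two, up to a constant that
does not depend on the radial profile. -/
theorem exists_lintegral_radial_eq (μ : Measure E) [μ.IsAddHaarMeasure] {Q : E → ℝ}
    (hQm : Measurable Q) (hQ0 : ∀ x, 0 ≤ Q x) (hQ : ∀ (s : ℝ) x, Q (s • x) = s ^ 2 * Q x)
    (hV : μ {x | Q x ≤ 1} ≠ ∞) {h : E → ℝ≥0∞} (hh : AEMeasurable h μ)
    (hom : ∀ s : ℝ, 0 < s → ∀ᵐ x ∂μ, h (s • x) = ENNReal.ofReal (s ^ 2) * h x)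
    (hfin : ∫⁻ x in {x | Q x ≤ 1}, h x ∂μ ≠ ∞) :
    ∃ A B : ℝ≥0∞, B ≠ 0 ∧ B ≠ ∞ ∧ ∀ g : ℝ → ℝ≥0∞, Measurable g →
      B * ∫⁻ x, g (Q x) * h x ∂μ = A * ∫⁻ t, g t * μ {x | Q x < t} := by
  set N := Module.finrank ℝ E with hN
  set V : ℝ → ℝ≥0∞ := fun t => μ {x | Q x < t} with hVd
  have hVmono : Monotone V := fun s t hst => measure_mono fun x hx => lt_of_lt_of_le hx hst
  have hVm : Measurable V := hVmono.measurable
  have hV0 (t : ℝ) (ht : t ≤ 0) : V t = 0 := by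
    have : {x | Q x < t} = ∅ :=
      Set.eq_empty_of_forall_notMem fun x hx => absurd (hQ0 x) (not_le.2 (lt_of_lt_of_le hx ht))
    simp only [hVd, this, measure_empty]
  have hVs (s : ℝ) (hs : 0 < s) (t : ℝ) : V (s ^ 2 * t) = ENNReal.ofReal (s ^ N) * V t := by
    have e : {x | Q x < t} = (s • ·) ⁻¹' {x | Q x < s ^ 2 * t} := by
      ext x
      simp only [Set.mem_ofPred_eq, Set.mem_preimage, hQ]
      exact (mul_lt_mul_iff_right₀ (by positivity)).symm
    have hp : 0 < s ^ N := pow_pos hs _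
    simp only [hVd]
    rw [e, Measure.addHaar_preimage_smul μ hs.ne', ← mul_assoc, ← ENNReal.ofReal_mul hp.le,
      abs_of_pos (inv_pos.2 hp), mul_inv_cancel₀ hp.ne', ENNReal.ofReal_one, one_mul]
  have hV1 : V 1 ≠ ∞ := ne_top_of_le_ne_top hV (measure_mono fun x (hx : Q x < 1) => hx.le)
  -- Otherwise, by scaling, all dilates would be null, yet they exhaust the space.
  have hVpos (t : ℝ) (ht : 0 < t) : V t ≠ 0 := by
    intro h0
    have h1 (n : ℕ) : V ((n + 1 : ℝ) ^ 2 * t) = 0 := by rw [hVs _ (by positivity), h0, mul_zero]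
    have h2 : μ (⋃ n : ℕ, {x | Q x < (n + 1 : ℝ) ^ 2 * t}) = 0 := measure_iUnion_null h1
    have h3 : (⋃ n : ℕ, {x | Q x < (n + 1 : ℝ) ^ 2 * t}) = Set.univ := by
      refine Set.iUnion_eq_univ_iff.2 fun x => ?_
      obtain ⟨n, hn⟩ := exists_nat_gt (Q x / t)
      refine ⟨n, ?_⟩
      rw [div_lt_iff₀ ht] at hn
      have : (n : ℝ) ≤ (n + 1 : ℝ) ^ 2 := by nlinarith [(Nat.cast_nonneg n : (0 : ℝ) ≤ n)]
      exact hn.trans_le (mul_le_mul_of_nonneg_right this ht.le)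
    rw [h3] at h2
    exact (Measure.measure_univ_ne_zero.2 (NeZero.ne μ)) h2
  let μh : Measure ℝ := (μ.withDensity h).map Q
  let ν : Measure ℝ := volume.withDensity V
  have hμh (a : ℝ) : μh (Set.Iic a) = ∫⁻ x in {x | Q x ≤ a}, h x ∂μ := by
    simp only [μh]
    rw [Measure.map_apply hQm measurableSet_Iic, withDensity_apply _ (hQm measurableSet_Iic)]
    rfl
  have hν (a : ℝ) : ν (Set.Iic a) = ∫⁻ t in Set.Iic a, V t := withDensity_apply _ measurableSet_Iic
  have sμ (s : ℝ) (hs : 0 < s) : μh (Set.Iic (s ^ 2)) = ENNReal.ofReal (s ^ (N + 2)) * μh (Set.Iic 1) := by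
    rw [hμh, hμh]; exact setLIntegral_le_smul μ hQm hQ hom hs
  have sν (s : ℝ) (hs : 0 < s) : ν (Set.Iic (s ^ 2)) = ENNReal.ofReal (s ^ (N + 2)) * ν (Set.Iic 1) := by
    have hs2 : 0 < s ^ 2 := by positivity
    rw [hν, hν, ← lintegral_indicator measurableSet_Iic, ← lintegral_indicator measurableSet_Iic,
      lintegral_eq_smul_lintegral_comp_smul volume _ hs2, Module.finrank_self, pow_one,
      add_comm, pow_add, ENNReal.ofReal_mul hs2.le, mul_assoc,
      ← lintegral_const_mul' (ENNReal.ofReal (s ^ N)) _ ENNReal.ofReal_ne_top]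
    congr 1
    refine lintegral_congr fun t => ?_
    have : s ^ 2 • t ≤ s ^ 2 ↔ t ≤ 1 := by
      rw [smul_eq_mul]; exact mul_le_iff_le_one_right hs2
    by_cases h1 : t ≤ 1
    · rw [Set.indicator_of_mem (show s ^ 2 • t ∈ Set.Iic (s ^ 2) from this.2 h1),
        Set.indicator_of_mem (show t ∈ Set.Iic 1 from h1), smul_eq_mul, hVs s hs]
    · rw [Set.indicator_of_notMem (show s ^ 2 • t ∉ Set.Iic (s ^ 2) from fun h => h1 (this.1 h)),
        Set.indicator_of_notMem (show t ∉ Set.Iic 1 from h1), mul_zero]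
  have hν1 : ν (Set.Iic 1) ≠ ∞ := by
    have hle : ∫⁻ t in Set.Iic (1 : ℝ), V t ≤ ∫⁻ t in Set.Ioc (0 : ℝ) 1, V 1 := by
      rw [← lintegral_indicator measurableSet_Iic, ← lintegral_indicator measurableSet_Ioc]
      refine lintegral_mono fun t => ?_
      by_cases h1 : t ≤ 1
      · rw [Set.indicator_of_mem (show t ∈ Set.Iic 1 from h1)]
        rcases le_or_gt t 0 with h0 | h0
        · rw [hV0 t h0]; exact zero_le
        · rw [Set.indicator_of_mem (show t ∈ Set.Ioc 0 1 from ⟨h0, h1⟩)]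
          exact hVmono h1
      · rw [Set.indicator_of_notMem (show t ∉ Set.Iic 1 from h1)]; exact zero_le
    rw [hν]
    refine ne_top_of_le_ne_top ?_ hle
    simp [hV1]
  have hν0 : ν (Set.Iic 1) ≠ 0 := by
    intro h0
    rw [hν, lintegral_eq_zero_iff hVm] at h0
    have h2 : ∀ᵐ t : ℝ, t ∈ Set.Iic (1 : ℝ) → V t = 0 :=
      (ae_restrict_iff' measurableSet_Iic).1 h0
    have h3 : (volume : Measure ℝ) (Set.Ioc 0 1) = 0 := by
      refine measure_mono_null (fun t ht => ?_) h2
      exact fun h => hVpos t ht.1 (h ht.2)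
    simp at h3
  have hμ1 : μh (Set.Iic 1) ≠ ∞ := by rw [hμh]; exact hfin
  have hpos (a : ℝ) (ha : 0 < a) : ∃ s : ℝ, 0 < s ∧ a = s ^ 2 :=
    ⟨√a, Real.sqrt_pos.2 ha, (Real.sq_sqrt ha.le).symm⟩
  have hμ0 (a : ℝ) (ha : a ≤ 0) : μh (Set.Iic a) = 0 :=
    eq_zero_of_forall_le_pow hμ1 (n := N + 2) (by omega) fun s hs => by
      rw [← sμ s hs]; exact measure_mono (Set.Iic_subset_Iic.2 (ha.trans (sq_nonneg s)))
  have hνz (a : ℝ) (ha : a ≤ 0) : ν (Set.Iic a) = 0 :=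
    eq_zero_of_forall_le_pow hν1 (n := N + 2) (by omega) fun s hs => by
      rw [← sν s hs]; exact measure_mono (Set.Iic_subset_Iic.2 (ha.trans (sq_nonneg s)))
  -- Both measures give `(-∞, s²]` the mass `s ^ (N + 2)` times that of `(-∞, 1]`, so they are
  -- proportional: for `μh`, `N` comes from the volume and `2` from `h`; for `ν`, `N` comes from `V`
  -- and `2` from `dt`.
  have key : ν (Set.Iic 1) • μh = μh (Set.Iic 1) • ν := by
    refine measure_eq_of_Iic (fun a => ?_) fun a => ?_
    · simp only [Measure.smul_apply, smul_eq_mul]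
      rcases le_or_gt a 0 with ha | ha
      · rw [hμ0 a ha, hνz a ha, mul_zero, mul_zero]
      · obtain ⟨s, hs, rfl⟩ := hpos a ha
        rw [sμ s hs, sν s hs]; ring
    · simp only [Measure.smul_apply, smul_eq_mul]
      rcases le_or_gt a 0 with ha | ha
      · rw [hμ0 a ha, mul_zero]; exact ENNReal.zero_ne_top
      · obtain ⟨s, hs, rfl⟩ := hpos a ha
        rw [sμ s hs]
        exact ENNReal.mul_ne_top hν1 (ENNReal.mul_ne_top ENNReal.ofReal_ne_top hμ1)
  refine ⟨μh (Set.Iic 1), ν (Set.Iic 1), hν0, hν1, fun g hg => ?_⟩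
  have e := congrArg (fun m : Measure ℝ => ∫⁻ t, g t ∂m) key
  simp only [lintegral_smul_measure, smul_eq_mul] at e
  have e1 : ∫⁻ t, g t ∂μh = ∫⁻ x, g (Q x) * h x ∂μ := by
    simp only [μh]
    rw [lintegral_map hg hQm]
    refine (lintegral_withDensity_eq_lintegral_mul₀ hh (hg.comp hQm).aemeasurable).trans ?_
    exact lintegral_congr fun x => mul_comm _ _
  have e2 : ∫⁻ t, g t ∂ν = ∫⁻ t, g t * V t := by
    simp only [ν]
    rw [lintegral_withDensity_eq_lintegral_mul _ hVm hg]
    exact lintegral_congr fun x => mul_comm _ _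
  rwa [e1, e2] at e

/-- The ratio of `∫ f(Q) h` to the mass of `F*(Q)` does not depend on the generator `f`. -/
theorem lintegral_radial_mul_Fstar_comm (μ : Measure E) [μ.IsAddHaarMeasure] {Q : E → ℝ}
    (hQm : Measurable Q) (hQ0 : ∀ x, 0 ≤ Q x) (hQ : ∀ (s : ℝ) x, Q (s • x) = s ^ 2 * Q x)
    (hV : μ {x | Q x ≤ 1} ≠ ∞) {h : E → ℝ≥0∞} (hh : AEMeasurable h μ)
    (hom : ∀ s : ℝ, 0 < s → ∀ᵐ x ∂μ, h (s • x) = ENNReal.ofReal (s ^ 2) * h x)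
    (hfin : ∫⁻ x in {x | Q x ≤ 1}, h x ∂μ ≠ ∞) {f g : ℝ → ℝ} (hf : Measurable f)
    (hg : Measurable g) :
    (∫⁻ x, ENNReal.ofReal (f (Q x)) * h x ∂μ) * ∫⁻ x, Fstar g (Q x) ∂μ
      = (∫⁻ x, ENNReal.ofReal (g (Q x)) * h x ∂μ) * ∫⁻ x, Fstar f (Q x) ∂μ := by
  obtain ⟨A, B, hB0, hB, key⟩ := exists_lintegral_radial_eq μ hQm hQ0 hQ hV hh hom hfin
  have kf := key (fun t => ENNReal.ofReal (f t)) hf.ennreal_ofReal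
  have kg := key (fun t => ENNReal.ofReal (g t)) hg.ennreal_ofReal
  rw [lintegral_Fstar_comp μ hQm hf, lintegral_Fstar_comp μ hQm hg]
  refine (ENNReal.mul_right_inj hB0 hB).1 ?_
  rw [← mul_assoc, kf, ← mul_assoc B, kg]
  ring

end Homogeneous

/-! ### Expectations under the elliptical law -/

section Expectation

open Filter Topology

variable {q m p : ℕ}

lemma Fstar_tent (t : ℝ) :
    Fstar (fun s => 4 * max (1 - s) 0) t = ENNReal.ofReal (max (1 - t) 0 ^ 2) := by
  have hd (s : ℝ) : HasDerivAt (fun s : ℝ => -2 * max (1 - s) 0 ^ 2) (4 * max (1 - s) 0) s :=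
    ((hasDerivAt_bump s).const_mul (-2)).congr_deriv (by ring)
  have h0 (s : ℝ) : 0 ≤ 4 * max (1 - s) 0 := by positivity
  have ht : Tendsto (fun s : ℝ => -2 * max (1 - s) 0 ^ 2) atTop (𝓝 0) := by
    refine tendsto_const_nhds.congr' ?_
    filter_upwards [eventually_ge_atTop (1 : ℝ)] with s hs
    rw [max_eq_right (by linarith)]; simp
  have hi := integrableOn_Ioi_deriv_of_nonneg' (a := t) (fun s _ => hd s) (fun s _ => h0 s) ht
  have he := integral_Ioi_of_hasDerivAt_of_tendsto' (a := t) (fun s _ => hd s) hi ht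
  rw [Fstar, ← ofReal_integral_eq_lintegral_ofReal hi (ae_of_all _ h0), he,
    show (2⁻¹ : ℝ≥0∞) = ENNReal.ofReal 2⁻¹ by
      rw [ENNReal.ofReal_inv_of_pos two_pos, ENNReal.ofReal_ofNat],
    ← ENNReal.ofReal_mul (by norm_num)]
  congr 1
  ring

lemma haffCore_congr (α b : ℝ) {x y : Sample q m p} (h : scatter x = scatter y) :
    haffCore α b x = haffCore α b y := by
  unfold haffCore
  rw [h]

/-- Integrability of the weighted function gives no information outside the ellipsoid. Rescaled
copies `x ↦ x / (n + 1)`, normalized by homogeneity, carry a weight tending to `1` everywhere. -/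
lemma aemeasurable_haffCore {Sig : Matrix (Fin p) (Fin p) ℝ} {α b : ℝ}
    (hi : Integrable fun x : Sample q m p =>
      4 * max (1 - quadForm 0 Sig x) 0 * trace (Sig⁻¹ * haffCore α b x)) :
    AEMeasurable fun x : Sample q m p => trace (Sig⁻¹ * haffCore α b x) := by
  have := isAddHaarMeasure_volume (q := q) (m := m) (p := p)
  set g : Sample q m p → ℝ := fun x =>
    4 * max (1 - quadForm 0 Sig x) 0 * trace (Sig⁻¹ * haffCore α b x) with hg
  let G (n : ℕ) (x : Sample q m p) : ℝ := (n + 1) ^ 2 / 4 * g (((n : ℝ) + 1)⁻¹ • x)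
  refine aemeasurable_of_tendsto_metrizable_ae atTop (f := G) (fun n => ?_) ?_
  · exact (hi.aestronglyMeasurable.aemeasurable.comp_quasiMeasurePreserving
      (Measure.quasiMeasurePreserving_smul volume (by positivity))).const_mul _
  · filter_upwards [ae_exists_isEigenDecomp] with x ⟨⟨H, l⟩, hl⟩
    have e (n : ℕ) : G n x = max (1 - (((n : ℝ) + 1)⁻¹) ^ 2 * quadForm 0 Sig x) 0
        * trace (Sig⁻¹ * haffCore α b x) := by
      have hn : (0 : ℝ) < (n : ℝ) + 1 := by positivity
      simp only [G, hg]
      rw [haffCore_smul α b hl (inv_pos.2 hn), quadForm_smul, Matrix.mul_smul, trace_smul,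
        smul_eq_mul]
      field_simp
    have h1 : Tendsto (fun n : ℕ => ((n : ℝ) + 1)⁻¹) atTop (𝓝 0) := by
      simpa [one_div] using tendsto_one_div_add_atTop_nhds_zero_nat (𝕜 := ℝ)
    have h2 : Tendsto (fun n : ℕ => max (1 - (((n : ℝ) + 1)⁻¹) ^ 2 * quadForm 0 Sig x) 0
        * trace (Sig⁻¹ * haffCore α b x)) atTop
        (𝓝 (max (1 - 0 ^ 2 * quadForm 0 Sig x) 0 * trace (Sig⁻¹ * haffCore α b x))) :=
      ((((h1.pow 2).mul_const _).const_sub 1).max tendsto_const_nhds).mul_const _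
    simpa [e] using h2

/-- For functions of the scatter matrix, the expectation under the law is a radial integral. -/
lemma lintegral_law {f : ℝ → ℝ} (hf : Measurable f) (θ : Matrix (Fin q) (Fin p) ℝ)
    {Sig : Matrix (Fin p) (Fin p) ℝ} (hSig : Sig.PosDef) {h : Sample q m p → ℝ≥0∞}
    (hh : AEMeasurable h) (hs : ∀ x y, scatter x = scatter y → h x = h y) :
    ∫⁻ x, h x ∂(law f θ Sig) = ENNReal.ofReal (detFactor q m Sig)
      * ∫⁻ x, ENNReal.ofReal (f (quadForm 0 Sig x)) * h x := by
  have := isAddHaarMeasure_volume (q := q) (m := m) (p := p)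
  have hd : 0 ≤ detFactor q m Sig := Real.rpow_nonneg hSig.det_pos.le _
  have hm : Measurable fun x : Sample q m p =>
      ENNReal.ofReal (detFactor q m Sig * f (quadForm θ Sig x)) :=
    ((hf.comp (measurable_quadForm θ Sig)).const_mul _).ennreal_ofReal
  -- Translation by `(θ, 0)` centres the quadratic form and leaves `S`, hence `h`, unchanged.
  rw [law, lintegral_withDensity_eq_lintegral_mul₀ hm.aemeasurable hh,
    ← lintegral_add_left_eq_self (μ := (volume : Measure (Sample q m p))) _ (shift m θ),
    ← lintegral_const_mul' _ _ ENNReal.ofReal_ne_top]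
  refine lintegral_congr fun x => ?_
  have e1 : quadForm θ Sig (shift m θ + x) = quadForm 0 Sig x := by
    have : (of (shift m θ + x).1 - θ : Matrix (Fin q) (Fin p) ℝ) = of x.1 - 0 := by
      ext i j; simp [shift]
    have h2 : (of (shift m θ + x).2 : Matrix (Fin m) (Fin p) ℝ) = of x.2 := by
      ext i j; simp [shift]
    rw [quadForm, quadForm, this, h2]
  have e2 : h (shift m θ + x) = h x := hs _ _ (by
    have h2 : (of (shift m θ + x).2 : Matrix (Fin m) (Fin p) ℝ) = of x.2 := by
      ext i j; simp [shift]
    rw [scatter, scatter, h2])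
  rw [Pi.mul_apply, e1, e2, ENNReal.ofReal_mul hd, mul_assoc]

lemma measurable_tent : Measurable fun s : ℝ => 4 * max (1 - s) 0 := by fun_prop

lemma IsEigenDecomp.trace_inv_mul_pos {r : ℕ} (hr : 0 < r) {Sig S : Matrix (Fin p) (Fin p) ℝ}
    (hSig : Sig.PosDef) {H : Matrix (Fin p) (Fin r) ℝ} {l : Fin r → ℝ}
    (h : IsEigenDecomp S H l) : 0 < trace (Sig⁻¹ * S) := by
  have hinj : Function.Injective H.mulVec := fun x y hxy => by
    have := congrArg (Hᵀ *ᵥ ·) hxy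
    simpa [h.semiorthogonal] using this
  have hpd := hSig.inv.conjTranspose_mul_mul_same hinj
  rw [conjTranspose_eq_transpose_of_trivial] at hpd
  rw [h.eq, trace_mul_conj_diagonal]
  exact Finset.sum_pos (fun i _ => mul_pos (h.pos i) hpd.diag_pos) ⟨⟨0, hr⟩, Finset.mem_univ _⟩

lemma lintegral_weight_lt {Sig : Matrix (Fin p) (Fin p) ℝ} (hSig : Sig.PosDef) {α b : ℝ}
    (hr : 2 ≤ min p m) (hα : 1 ≤ α) (hb : 0 < b)
    (hb' : b ≤ 2 * (((min p m : ℕ) : ℝ) - 1) /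
      (((max p m : ℕ) : ℝ) - ((min p m : ℕ) : ℝ) + 1)) :
    (∫⁻ x : Sample q m p, Fstar (fun s => 4 * max (1 - s) 0) (quadForm 0 Sig x)) ≠ 0 ∧
    (∫⁻ x : Sample q m p, Fstar (fun s => 4 * max (1 - s) 0) (quadForm 0 Sig x)) ≠ ∞ ∧
    (∫⁻ x : Sample q m p, ENNReal.ofReal (4 * max (1 - quadForm 0 Sig x) 0)
        * ENNReal.ofReal (trace (Sig⁻¹ * haffCore α b x)))
      < ENNReal.ofReal (2 * b * (max p m : ℕ))
        * ∫⁻ x : Sample q m p, Fstar (fun s => 4 * max (1 - s) 0) (quadForm 0 Sig x) := by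
  obtain ⟨h1, h2, h3⟩ := integral_haffCore_lt (q := q) hSig hr hα hb hb'
  have hv : (0 : ℝ) < 2 * b * (max p m : ℕ) := by
    have : (0 : ℝ) < (max p m : ℕ) := by exact_mod_cast (by omega : 0 < max p m)
    positivity
  have n1 (x : Sample q m p) :
      0 ≤ 4 * max (1 - quadForm 0 Sig x) 0 * trace (Sig⁻¹ * haffCore α b x) :=
    mul_nonneg (by positivity) (haffCore_trace_nonneg hSig hb.le x)
  have n2 (x : Sample q m p) : 0 ≤ max (1 - quadForm 0 Sig x) 0 ^ 2 := by positivity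
  have hK : ∫⁻ x : Sample q m p, Fstar (fun s => 4 * max (1 - s) 0) (quadForm 0 Sig x)
      = ENNReal.ofReal (∫ x : Sample q m p, max (1 - quadForm 0 Sig x) 0 ^ 2) := by
    rw [ofReal_integral_eq_lintegral_ofReal h2 (ae_of_all _ n2)]
    exact lintegral_congr fun x => Fstar_tent _
  have hL : ∫⁻ x : Sample q m p, ENNReal.ofReal (4 * max (1 - quadForm 0 Sig x) 0)
        * ENNReal.ofReal (trace (Sig⁻¹ * haffCore α b x))
      = ENNReal.ofReal (∫ x : Sample q m p,
        4 * max (1 - quadForm 0 Sig x) 0 * trace (Sig⁻¹ * haffCore α b x)) := by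
    rw [ofReal_integral_eq_lintegral_ofReal h1 (ae_of_all _ n1)]
    exact lintegral_congr fun x => (ENNReal.ofReal_mul (by positivity)).symm
  have hpos : 0 < 2 * b * (max p m : ℕ) * ∫ x : Sample q m p, max (1 - quadForm 0 Sig x) 0 ^ 2 :=
    (integral_nonneg n1).trans_lt h3
  rw [hK, hL, ← ENNReal.ofReal_mul hv.le]
  exact ⟨(ENNReal.ofReal_pos.2 (pos_of_mul_pos_right hpos hv.le)).ne', ENNReal.ofReal_ne_top,
    (ENNReal.ofReal_lt_ofReal_iff hpos).2 h3⟩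

lemma setLIntegral_quadForm_le_ne_top {Sig : Matrix (Fin p) (Fin p) ℝ} (hSig : Sig.PosDef)
    {h : Sample q m p → ℝ≥0∞} {c : ℝ} (hc : 0 ≤ c)
    (hle : ∀ x, h x ≤ ENNReal.ofReal (c * quadForm 0 Sig x)) :
    ∫⁻ x in {x | quadForm 0 Sig x ≤ 1}, h x ≠ ∞ := by
  have := isAddHaarMeasure_volume (q := q) (m := m) (p := p)
  have hcomp := isCompact_quadForm_le (q := q) (m := m) hSig
  refine ne_top_of_le_ne_top (b := ∫⁻ x in {x : Sample q m p | quadForm 0 Sig x ≤ 1},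
    ENNReal.ofReal c) ?_ (setLIntegral_mono' hcomp.measurableSet fun x hx => ?_)
  · rw [setLIntegral_const]
    exact ENNReal.mul_ne_top ENNReal.ofReal_ne_top hcomp.measure_lt_top.ne
  · exact (hle x).trans (ENNReal.ofReal_le_ofReal (mul_le_of_le_one_right hc hx))

lemma haffCore_trace_le {Sig : Matrix (Fin p) (Fin p) ℝ} (hSig : Sig.PosDef) {α b : ℝ}
    (hb : 0 ≤ b) (x : Sample q m p) :
    trace (Sig⁻¹ * haffCore α b x) ≤ (2 * b + b ^ 2) * quadForm 0 Sig x := by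
  have hc : 0 ≤ 2 * b + b ^ 2 := by positivity
  by_cases hx : ∃ Hl : Matrix (Fin p) (Fin (min p m)) ℝ × (Fin (min p m) → ℝ),
      IsEigenDecomp (scatter x) Hl.1 Hl.2
  · rw [haffCore_eq α b hx.choose_spec]
    exact (trace_conj_bounds hSig.inv.posSemidef hx.choose_spec fun i =>
      ratio_mem hb (φ := fun i => hx.choose.2 i ^ (-α))
        (fun i => Real.rpow_pos_of_pos (hx.choose_spec.pos i) _) i).2.trans
      (mul_le_mul_of_nonneg_left (trace_inv_mul_scatter_le hSig x).2 hc)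
  · rw [haffCore, dif_neg hx]
    simpa using mul_nonneg hc (quadForm_nonneg hSig x)

/-- The constant `K*` is positive, and `E[tr Σ⁻¹ H L (2Ψ + Ψ²) Hᵀ] < 2 b v K*`. -/
theorem lintegral_haffCore_lt {f : ℝ → ℝ} (hf : IsGenerator q m p f)
    (θ : Matrix (Fin q) (Fin p) ℝ) {Sig : Matrix (Fin p) (Fin p) ℝ} (hSig : Sig.PosDef) {α b : ℝ}
    (hr : 2 ≤ min p m) (hα : 1 ≤ α) (hb : 0 < b)
    (hb' : b ≤ 2 * (((min p m : ℕ) : ℝ) - 1) /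
      (((max p m : ℕ) : ℝ) - ((min p m : ℕ) : ℝ) + 1)) :
    0 < Kstar f q m p ∧
    (AEMeasurable fun x : Sample q m p => ENNReal.ofReal (trace (Sig⁻¹ * haffCore α b x))) ∧
    ∫⁻ x : Sample q m p, ENNReal.ofReal (trace (Sig⁻¹ * haffCore α b x)) ∂(law f θ Sig)
      < ENNReal.ofReal (2 * b * (max p m : ℕ) * Kstar f q m p) := by
  have := isAddHaarMeasure_volume (q := q) (m := m) (p := p)
  obtain ⟨hK0, hK0', hL0⟩ := lintegral_weight_lt (q := q) hSig hr hα hb hb'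
  have hint := (integral_haffCore_lt (q := q) hSig hr hα hb hb').1
  have hhm : AEMeasurable fun x : Sample q m p =>
      ENNReal.ofReal (trace (Sig⁻¹ * haffCore α b x)) :=
    (aemeasurable_haffCore hint).ennreal_ofReal
  have hV : (volume : Measure (Sample q m p)) {x | quadForm 0 Sig x ≤ 1} ≠ ∞ :=
    (isCompact_quadForm_le hSig).measure_lt_top.ne
  have hdet : 0 < detFactor q m Sig := Real.rpow_pos_of_pos hSig.det_pos _
  have hdet0 : ENNReal.ofReal (detFactor q m Sig) ≠ 0 := (ENNReal.ofReal_pos.2 hdet).ne'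
  set Kf := ∫⁻ x : Sample q m p, Fstar f (quadForm 0 Sig x) with hKf
  have hstar : starMass f m (0 : Matrix (Fin q) (Fin p) ℝ) Sig
      = ENNReal.ofReal (detFactor q m Sig) * Kf :=
    lintegral_const_mul' _ _ ENNReal.ofReal_ne_top
  have hstar1 : starMass f m (0 : Matrix (Fin q) (Fin p) ℝ) Sig
      = ENNReal.ofReal (Kstar f q m p) := by
    rw [starMass_eq f 0 hSig, Kstar, ENNReal.ofReal_toReal]
    exact (hf.starMass_lt_top 0 1 PosDef.one).ne
  have hKfin : Kf ≠ ∞ := fun h => by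
    have := hf.starMass_lt_top 0 Sig hSig
    rw [hstar, h, ENNReal.mul_top hdet0] at this
    exact lt_irrefl _ this
  -- If `K*` vanished, the ratio argument with `h = tr Σ⁻¹ S` would give `f(Q) tr Σ⁻¹ S = 0` almost
  -- everywhere. The trace is almost everywhere positive, so the density would vanish.
  have hKpos : Kf ≠ 0 := by
    intro h0
    have hSm : Measurable fun x : Sample q m p => ENNReal.ofReal (trace (Sig⁻¹ * scatter x)) :=
      ((continuous_const.matrix_mul continuous_scatter).matrix_trace).measurable.ennreal_ofReal
    have cross := lintegral_radial_mul_Fstar_comm volume (measurable_quadForm 0 Sig)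
      (quadForm_nonneg hSig) (quadForm_smul Sig) hV hSm.aemeasurable
      (fun s hs => ae_of_all _ fun x => by
        rw [scatter_smul, Matrix.mul_smul, trace_smul, smul_eq_mul,
          ENNReal.ofReal_mul (by positivity)])
      (setLIntegral_quadForm_le_ne_top hSig zero_le_one fun x => by
        rw [one_mul]; exact ENNReal.ofReal_le_ofReal (trace_inv_mul_scatter_le hSig x).2)
      hf.measurable measurable_tent
    have hm : Measurable fun x : Sample q m p =>
        ENNReal.ofReal (f (quadForm 0 Sig x)) * ENNReal.ofReal (trace (Sig⁻¹ * scatter x)) :=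
      ((hf.measurable.comp (measurable_quadForm 0 Sig)).ennreal_ofReal).mul hSm
    rw [← hKf, h0, mul_zero, mul_eq_zero, or_iff_left hK0, lintegral_eq_zero_iff hm] at cross
    have hprob := hf.isProbabilityMeasure 0 Sig hSig
    have h1 := lintegral_law (m := m) hf.measurable (0 : Matrix (Fin q) (Fin p) ℝ) hSig
      (h := fun _ => 1) aemeasurable_const (fun _ _ _ => rfl)
    have h2 : ∫⁻ x : Sample q m p, ENNReal.ofReal (f (quadForm 0 Sig x)) * 1 = 0 := by
      refine lintegral_eq_zero_of_ae_eq_zero ?_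
      filter_upwards [cross, ae_exists_isEigenDecomp] with x hx ⟨⟨H, l⟩, hl⟩
      have hpos := hl.trace_inv_mul_pos (by omega) hSig
      simpa [not_le.2 hpos] using hx
    rw [h2, mul_zero] at h1
    simp at h1
  have cross := lintegral_radial_mul_Fstar_comm volume (measurable_quadForm 0 Sig)
    (quadForm_nonneg hSig) (quadForm_smul Sig) hV hhm
    (fun s hs => by
      filter_upwards [ae_exists_isEigenDecomp] with x ⟨⟨H, l⟩, hl⟩
      rw [haffCore_smul α b hl hs, Matrix.mul_smul, trace_smul, smul_eq_mul,
        ENNReal.ofReal_mul (by positivity)])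
    (setLIntegral_quadForm_le_ne_top hSig (c := 2 * b + b ^ 2) (by positivity)
      fun x => ENNReal.ofReal_le_ofReal (haffCore_trace_le hSig hb.le x))
    hf.measurable measurable_tent
  have hlt : ∫⁻ x : Sample q m p, ENNReal.ofReal (f (quadForm 0 Sig x))
        * ENNReal.ofReal (trace (Sig⁻¹ * haffCore α b x))
      < ENNReal.ofReal (2 * b * (max p m : ℕ)) * Kf := by
    -- Multiplying by the tent's mass turns the claim, through `cross`, into the inequality already
    -- known for the tent.
    refine (ENNReal.mul_lt_mul_iff_left hK0 hK0').1 ?_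
    rw [cross, mul_right_comm]
    exact (ENNReal.mul_lt_mul_iff_left hKpos hKfin).2 hL0
  refine ⟨?_, hhm, ?_⟩
  · rw [← ENNReal.ofReal_pos, ← hstar1, hstar]
    exact pos_iff_ne_zero.2 (mul_ne_zero hdet0 hKpos)
  · rw [lintegral_law hf.measurable θ hSig hhm fun x y hxy => by rw [haffCore_congr α b hxy],
      ENNReal.ofReal_mul (by positivity), ← hstar1, hstar, mul_left_comm]
    exact (ENNReal.mul_lt_mul_iff_right hdet0 ENNReal.ofReal_ne_top).2 hlt

end Expectation

/-! ### The risk difference -/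

section Risk

variable {q m p : ℕ}

lemma conj_diagonal_mul {r : ℕ} {H : Matrix (Fin p) (Fin r) ℝ} (h : Hᵀ * H = 1)
    (x y : Fin r → ℝ) :
    H * diagonal x * Hᵀ * (H * diagonal y * Hᵀ) = H * diagonal (fun i => x i * y i) * Hᵀ := by
  rw [← diagonal_mul_diagonal]
  calc _ = H * diagonal x * (Hᵀ * H) * diagonal y * Hᵀ := by simp only [Matrix.mul_assoc]
    _ = _ := by rw [h]; simp only [Matrix.mul_assoc, Matrix.one_mul]

lemma conj_diagonal_transpose {r : ℕ} (H : Matrix (Fin p) (Fin r) ℝ) (x : Fin r → ℝ) :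
    (H * diagonal x * Hᵀ)ᵀ = H * diagonal x * Hᵀ := by
  simp [transpose_mul, Matrix.mul_assoc]

lemma IsEigenDecomp.pinv_eq {r : ℕ} {S : Matrix (Fin p) (Fin p) ℝ} {H : Matrix (Fin p) (Fin r) ℝ}
    {l : Fin r → ℝ} (h : IsEigenDecomp S H l) :
    pinv S = H * diagonal (fun i => (l i)⁻¹) * Hᵀ := by
  have hm : IsMoorePenrose S (H * diagonal (fun i => (l i)⁻¹) * Hᵀ) := by
    have hl (i) := (h.pos i).ne'
    rw [h.eq]
    refine ⟨?_, ?_, ?_, ?_⟩ <;>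
      simp only [conj_diagonal_mul h.semiorthogonal, conj_diagonal_transpose]
    · congr 3; ext i; field_simp [hl i]
    · congr 3; ext i; field_simp [hl i]
  have hex : ∃ P, IsMoorePenrose S P := ⟨_, hm⟩
  rw [pinv, dif_pos hex]
  exact hex.choose_spec.unique hm

lemma mul_residual_sq {Sig : Matrix (Fin p) (Fin p) ℝ} (hSig : Sig.PosDef)
    (A : Matrix (Fin p) (Fin p) ℝ) :
    Sig * (Sig⁻¹ * A - 1) ^ 2 = (A - Sig) * Sig⁻¹ * (A - Sig) := by
  have hu : IsUnit Sig.det := isUnit_iff_ne_zero.2 hSig.det_pos.ne'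
  have e1 : Sig * (Sig⁻¹ * A - 1) = A - Sig := by
    rw [Matrix.mul_sub, ← Matrix.mul_assoc, mul_nonsing_inv _ hu, Matrix.one_mul, Matrix.mul_one]
  have e2 : Sig⁻¹ * A - 1 = Sig⁻¹ * (A - Sig) := by
    rw [Matrix.mul_sub, nonsing_inv_mul _ hu]
  rw [sq, ← Matrix.mul_assoc, e1, e2, Matrix.mul_assoc]

/-- Needed so that `ENNReal.ofReal` in the risk does not truncate: the loss pairs `S⁺` with the
positive semidefinite `(A - Σ) Σ⁻¹ (A - Σ)`. -/
lemma IsEigenDecomp.loss_nonneg {r : ℕ} {S Sig A : Matrix (Fin p) (Fin p) ℝ} (hSig : Sig.PosDef)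
    {H : Matrix (Fin p) (Fin r) ℝ} {l : Fin r → ℝ} (h : IsEigenDecomp S H l) (hA : Aᵀ = A) :
    0 ≤ loss S Sig A := by
  have hS : Sigᵀ = Sig := by
    have := hSig.isHermitian
    rwa [IsHermitian, conjTranspose_eq_transpose_of_trivial] at this
  have hM : ((A - Sig) * Sig⁻¹ * (A - Sig)).PosSemidef := by
    have := hSig.inv.posSemidef.mul_mul_conjTranspose_same (A - Sig)
    rwa [conjTranspose_eq_transpose_of_trivial, transpose_sub, hA, hS] at this
  rw [loss, Matrix.mul_assoc, mul_residual_sq hSig, trace_mul_comm, h.pinv_eq,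
    trace_mul_conj_diagonal]
  exact Finset.sum_nonneg fun i _ =>
    mul_nonneg (inv_nonneg.2 (h.pos i).le) (conj_diag_nonneg hM H i)

/-- `(A - Σ) Σ⁻¹ (A - Σ) = A Σ⁻¹ A - 2 A + Σ`, and since `A` shares its eigenvectors with `S`, `A S⁺
A` has diagonal `l ρ²` and `A S⁺` has trace `∑ ρ`. -/
lemma IsEigenDecomp.loss_conj {r : ℕ} {S Sig : Matrix (Fin p) (Fin p) ℝ} (hSig : Sig.PosDef)
    {H : Matrix (Fin p) (Fin r) ℝ} {l : Fin r → ℝ} (h : IsEigenDecomp S H l) (ρ : Fin r → ℝ) :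
    loss S Sig (H * diagonal (fun i => l i * ρ i) * Hᵀ)
      = trace (Sig⁻¹ * (H * diagonal (fun i => l i * ρ i ^ 2) * Hᵀ)) - 2 * ∑ i, ρ i
        + trace (Sig * pinv S) := by
  set A := H * diagonal (fun i => l i * ρ i) * Hᵀ with hA
  have hu : IsUnit Sig.det := isUnit_iff_ne_zero.2 hSig.det_pos.ne'
  have hl (i) := (h.pos i).ne'
  have e : (A - Sig) * Sig⁻¹ * (A - Sig) = A * Sig⁻¹ * A - A - A + Sig := by
    rw [Matrix.sub_mul, mul_nonsing_inv _ hu, Matrix.mul_sub, Matrix.sub_mul, Matrix.sub_mul,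
      Matrix.one_mul, Matrix.one_mul, Matrix.mul_assoc A Sig⁻¹ Sig, nonsing_inv_mul _ hu,
      Matrix.mul_one]
    abel
  have e1 : trace (A * pinv S) = ∑ i, ρ i := by
    rw [hA, h.pinv_eq, conj_diagonal_mul h.semiorthogonal, h.trace_fun]
    refine Finset.sum_congr rfl fun i _ => ?_
    field_simp [hl i]
  have e2 : trace (A * Sig⁻¹ * A * pinv S)
      = trace (Sig⁻¹ * (H * diagonal (fun i => l i * ρ i ^ 2) * Hᵀ)) := by
    rw [Matrix.mul_assoc, Matrix.mul_assoc, trace_mul_comm, Matrix.mul_assoc, hA, h.pinv_eq,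
      conj_diagonal_mul h.semiorthogonal, conj_diagonal_mul h.semiorthogonal]
    congr 4
    ext i
    field_simp [hl i]
  rw [loss, Matrix.mul_assoc, mul_residual_sq hSig, trace_mul_comm, e, Matrix.add_mul,
    Matrix.sub_mul, Matrix.sub_mul, trace_add, trace_sub, trace_sub, e1, e2]
  ring

lemma sum_haffPsi (α b : ℝ) {r : ℕ} (hr : 0 < r) {l : Fin r → ℝ} (hl : ∀ i, 0 < l i) :
    ∑ i, haffPsi α b l i = b := by
  have hT : 0 < ∑ j, l j ^ (-α) :=
    Finset.sum_pos (fun i _ => Real.rpow_pos_of_pos (hl i) _) ⟨⟨0, hr⟩, Finset.mem_univ _⟩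
  simp only [haffPsi]
  rw [← Finset.sum_div, ← Finset.mul_sum, mul_div_cancel_right₀ _ hT.ne']

lemma smul_conj_diagonal {r : ℕ} (c : ℝ) (H : Matrix (Fin p) (Fin r) ℝ) (d : Fin r → ℝ) :
    c • (H * diagonal d * Hᵀ) = H * diagonal (fun i => c * d i) * Hᵀ := by
  rw [← Matrix.smul_mul, ← Matrix.mul_smul, ← diagonal_smul]
  rfl

lemma optEstimator_eq (f : ℝ → ℝ) {x : Sample q m p} {H : Matrix (Fin p) (Fin (min p m)) ℝ}
    {l : Fin (min p m) → ℝ} (h : IsEigenDecomp (scatter x) H l) :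
    optEstimator f q m p x = H * diagonal (fun i => l i * aOpt f q m p) * Hᵀ := by
  rw [optEstimator, h.eq, smul_conj_diagonal]
  simp only [mul_comm]

lemma haffEstimator_eq_conj (f : ℝ → ℝ) (α b : ℝ) {x : Sample q m p}
    {H : Matrix (Fin p) (Fin (min p m)) ℝ} {l : Fin (min p m) → ℝ}
    (h : IsEigenDecomp (scatter x) H l) :
    haffEstimator f q m p α b x
      = H * diagonal (fun i => l i * (aOpt f q m p * (1 + haffPsi α b l i))) * Hᵀ := by
  rw [haffEstimator_eq f α b x h, h.eq, Matrix.mul_assoc H (diagonal l) (diagonal _),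
    diagonal_mul_diagonal, ← Matrix.add_mul, ← Matrix.mul_add, diagonal_add, smul_conj_diagonal]
  congr 3
  ext i
  ring

lemma loss_optEstimator (f : ℝ → ℝ) {Sig : Matrix (Fin p) (Fin p) ℝ} (hSig : Sig.PosDef)
    {x : Sample q m p} {H : Matrix (Fin p) (Fin (min p m)) ℝ} {l : Fin (min p m) → ℝ}
    (h : IsEigenDecomp (scatter x) H l) :
    loss (scatter x) Sig (optEstimator f q m p x)
      = aOpt f q m p ^ 2 * trace (Sig⁻¹ * scatter x) - 2 * ((min p m : ℕ) * aOpt f q m p)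
        + trace (Sig * pinv (scatter x)) := by
  rw [optEstimator_eq f h, h.loss_conj hSig fun _ => aOpt f q m p]
  have e : H * diagonal (fun i => l i * aOpt f q m p ^ 2) * Hᵀ
      = aOpt f q m p ^ 2 • scatter x := by
    rw [h.eq, smul_conj_diagonal]; simp only [mul_comm]
  rw [e, Matrix.mul_smul, trace_smul, smul_eq_mul]
  simp

/-- The pointwise loss difference. -/
lemma loss_haffEstimator (f : ℝ → ℝ) (α b : ℝ) (hr : 0 < min p m)
    {Sig : Matrix (Fin p) (Fin p) ℝ} (hSig : Sig.PosDef) {x : Sample q m p}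
    {H : Matrix (Fin p) (Fin (min p m)) ℝ} {l : Fin (min p m) → ℝ}
    (h : IsEigenDecomp (scatter x) H l) :
    loss (scatter x) Sig (haffEstimator f q m p α b x) + 2 * (aOpt f q m p * b)
      = loss (scatter x) Sig (optEstimator f q m p x)
        + aOpt f q m p ^ 2 * trace (Sig⁻¹ * haffCore α b x) := by
  rw [optEstimator_eq f h, haffEstimator_eq_conj f α b h, h.loss_conj hSig fun _ => aOpt f q m p,
    h.loss_conj hSig fun i => aOpt f q m p * (1 + haffPsi α b l i), haffCore_eq α b h]
  simp only [trace_mul_conj_diagonal]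
  have e : ∑ i, l i * (aOpt f q m p * (1 + haffPsi α b l i)) ^ 2 * (Hᵀ * Sig⁻¹ * H) i i
      = ∑ i, l i * aOpt f q m p ^ 2 * (Hᵀ * Sig⁻¹ * H) i i + aOpt f q m p ^ 2
        * ∑ i, l i * (2 * haffPsi α b l i + haffPsi α b l i ^ 2) * (Hᵀ * Sig⁻¹ * H) i i := by
    rw [Finset.mul_sum, ← Finset.sum_add_distrib]
    exact Finset.sum_congr rfl fun i _ => by ring
  rw [e, ← Finset.mul_sum, Finset.sum_add_distrib, sum_haffPsi α b hr h.pos]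
  simp only [Finset.sum_const, Finset.card_univ, nsmul_eq_mul]
  ring

/-- The risk inequality, strict at every parameter. -/
theorem risk_haffEstimator_lt {f : ℝ → ℝ} (hf : IsGenerator q m p f)
    (θ : Matrix (Fin q) (Fin p) ℝ) {Sig : Matrix (Fin p) (Fin p) ℝ} (hSig : Sig.PosDef) {α b : ℝ}
    (hr : 2 ≤ min p m) (hα : 1 ≤ α) (hb : 0 < b)
    (hb' : b ≤ 2 * (((min p m : ℕ) : ℝ) - 1) /
      (((max p m : ℕ) : ℝ) - ((min p m : ℕ) : ℝ) + 1)) :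
    risk f θ Sig (haffEstimator f q m p α b) < risk f θ Sig (optEstimator f q m p) := by
  obtain ⟨hK, hhm, hlt⟩ := lintegral_haffCore_lt hf θ hSig hr hα hb hb'
  have hprob := hf.isProbabilityMeasure θ Sig hSig
  have hac : (law f θ Sig : Measure (Sample q m p)) ≪ volume := withDensity_absolutelyContinuous _ _
  have hae := hac.ae_le (ae_exists_isEigenDecomp (q := q) (m := m) (p := p))
  have hv : (0 : ℝ) < (max p m : ℕ) := by exact_mod_cast (by omega : 0 < max p m)
  set a := aOpt f q m p with ha
  have ha0 : 0 < a := by rw [ha, aOpt]; positivity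
  set h : Sample q m p → ℝ≥0∞ := fun x => ENNReal.ofReal (trace (Sig⁻¹ * haffCore α b x)) with hh
  -- Finiteness of this risk is what allows strictness to pass through addition in `[0, ∞]`.
  have hfin : risk f θ Sig (optEstimator f q m p) ≠ ∞ := by
    refine ne_top_of_le_ne_top (b := ∫⁻ x, (ENNReal.ofReal (a ^ 2)
      * ENNReal.ofReal (trace (Sig⁻¹ * scatter x))
      + ENNReal.ofReal (trace (Sig * pinv (scatter x)))) ∂(law f θ Sig)) ?_
      (lintegral_mono_ae ?_)
    · have hm : Measurable fun x : Sample q m p =>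
          ENNReal.ofReal (a ^ 2) * ENNReal.ofReal (trace (Sig⁻¹ * scatter x)) :=
        ((continuous_const.matrix_mul
          continuous_scatter).matrix_trace).measurable.ennreal_ofReal.const_mul _
      rw [lintegral_add_left hm, lintegral_const_mul' _ _ ENNReal.ofReal_ne_top]
      exact ENNReal.add_ne_top.2 ⟨ENNReal.mul_ne_top ENNReal.ofReal_ne_top
        (hf.moment θ Sig hSig).ne, (hf.inv_moment θ Sig hSig).ne⟩
    · filter_upwards [hae] with x ⟨⟨H, l⟩, hl⟩
      rw [loss_optEstimator f hSig hl, ← ENNReal.ofReal_mul (by positivity)]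
      refine (ENNReal.ofReal_le_ofReal ?_).trans ENNReal.ofReal_add_le
      have : 0 ≤ ((min p m : ℕ) : ℝ) * a := by positivity
      linarith
  -- The negative term `-2 a b` is moved to the left, since subtraction truncates in `[0, ∞]`.
  have hle : risk f θ Sig (haffEstimator f q m p α b) + ENNReal.ofReal (2 * (a * b))
      ≤ risk f θ Sig (optEstimator f q m p)
        + ENNReal.ofReal (a ^ 2) * ∫⁻ x, h x ∂(law f θ Sig) := by
    have e1 : risk f θ Sig (haffEstimator f q m p α b) + ENNReal.ofReal (2 * (a * b))
        = ∫⁻ x, (ENNReal.ofReal (loss (scatter x) Sig (haffEstimator f q m p α b x))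
          + ENNReal.ofReal (2 * (a * b))) ∂(law f θ Sig) := by
      rw [lintegral_add_right _ measurable_const, lintegral_const, measure_univ, mul_one, risk]
    rw [e1, ← lintegral_const_mul' _ _ ENNReal.ofReal_ne_top, risk,
      ← lintegral_add_right' _ ((hhm.mono_ac hac).const_mul _)]
    refine lintegral_mono_ae ?_
    filter_upwards [hae] with x ⟨⟨H, l⟩, hl⟩
    have hnn : 0 ≤ loss (scatter x) Sig (haffEstimator f q m p α b x) :=
      hl.loss_nonneg hSig (by rw [haffEstimator_eq_conj f α b hl, conj_diagonal_transpose])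
    rw [← ENNReal.ofReal_add hnn (by positivity),
      loss_haffEstimator f α b (by omega) hSig hl, hh, ← ENNReal.ofReal_mul (by positivity)]
    exact ENNReal.ofReal_add_le
  have hlt' : ENNReal.ofReal (a ^ 2) * ∫⁻ x, h x ∂(law f θ Sig) < ENNReal.ofReal (2 * (a * b)) := by
    -- This is `a v K* = 1`.
    have e : 2 * (a * b) = a ^ 2 * (2 * b * (max p m : ℕ) * Kstar f q m p) := by
      rw [ha, aOpt]; field_simp
    rw [e, ENNReal.ofReal_mul (by positivity)]
    exact (ENNReal.mul_lt_mul_iff_right (ENNReal.ofReal_pos.2 (by positivity)).ne'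
      ENNReal.ofReal_ne_top).2 hlt
  exact lt_of_add_lt_add_right (hle.trans_lt (ENNReal.add_lt_add_left hfin hlt'))

end Risk

end EllipticalScale

end

theorem mainTheorem4 (q m p : ℕ) (f : ℝ → ℝ) (hf : EllipticalScale.IsGenerator q m p f)
    (α b : ℝ) (hα : 1 ≤ α) (hb : 0 < b)
    (hb' : b ≤ 2 * (((min p m : ℕ) : ℝ) - 1) /
      (((max p m : ℕ) : ℝ) - ((min p m : ℕ) : ℝ) + 1)) :
    EllipticalScale.Dominates f (EllipticalScale.haffEstimator f q m p α b)
      (EllipticalScale.optEstimator f q m p) := by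
  have hle : ((min p m : ℕ) : ℝ) ≤ ((max p m : ℕ) : ℝ) := by exact_mod_cast min_le_max
  -- For `r ≤ 1` the upper bound on `b` is nonpositive, so no positive `b` is admissible.
  have hr : 2 ≤ min p m := by
    by_contra! hlt
    have h1 : ((min p m : ℕ) : ℝ) ≤ 1 := by exact_mod_cast (by omega : min p m ≤ 1)
    have := div_nonpos_of_nonpos_of_nonneg (by linarith : 2 * (((min p m : ℕ) : ℝ) - 1) ≤ 0)
      (by linarith : 0 ≤ ((max p m : ℕ) : ℝ) - ((min p m : ℕ) : ℝ) + 1)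
    linarith
  have key (θ : Matrix (Fin q) (Fin p) ℝ) (Sig : Matrix (Fin p) (Fin p) ℝ) (hSig : Sig.PosDef) :=
    EllipticalScale.risk_haffEstimator_lt hf θ hSig hr hα hb hb'
  exact ⟨fun θ Sig hSig => (key θ Sig hSig).le, 0, 1, PosDef.one, key 0 1 PosDef.one⟩
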